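/- Let $\mathbb K$ be a field of characteristic zero and $S=\bigoplus_{i\ge 1}S_i$ a graded associative (not necessarily unital) $\mathbb K$-algebra with completion $\hat S=\prod_{i\ge1}S_i$. Let $\mathcal J^g(S)=1+\hat S$ ($1$ a formal unit) with the substitution product $$\Big(\sum_{m\ge0}\alpha_m\Big)\circ\Big(\sum_{n\ge0}\beta_n\Big)=\sum_{m\ge0}\alpha_m\Big(\sum_{n\ge0}\beta_n\Big)^{m+1},\qquad \alpha_m,\beta_m\in S_m\ (m\ge 1),\ \alpha_0=\beta_0=1,$$ and let $\mathcal J^g_i(S)=\{1+\sum_{k\ge i}\alpha_k\mid \alpha_k\in S_k\}$, $i\ge1$. In a loop write $a\backslash b$ for the solution $x$ of $a\circ x=b$, and put $[a,b]=(b\circ a)\backslash(a\circ b)$ and $(a,b,c)=(a\circ(b\circ c))\backslash((a\circ b)\circ c)$. The deviations of the associator are defined recursively by $$(a_1,\dots,a_{n+3})_{i_1,\dots,i_n}=\big(A(a_{i_n})\circ A(a_{i_n+1})\big)\backslash A(a_{i_n}\circ a_{i_n+1}),\qquad A(a)=(a_1,\dots,a_{i_n-1},a,a_{i_n+2},\dots,a_{n+3})_{i_1,\dots,i_{n-1}},$$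 where $1\le i_k\le k+2$; let $P_{n,1}(x_1,\dots,x_n;y;z)=(x_1,\dots,x_n,y,z)_{1,\dots,1}$ with $n-1$ ones. A bracket of weight $n$ is an expression in $n$ indeterminates formed by repeatedly applying commutators, associators and deviations, each indeterminate being used exactly once. Then: 1. $(\mathcal J^g(S),\circ)$ is a loop with unit $1$, and $\mathcal J^g(S)=\mathcal J^g_1(S)\supseteq\mathcal J^g_2(S)\supseteq\cdots$ is an N-sequence, i.e. all $\mathcal J^g_i(S)$ are normal subloops and $P(\mathcal J^g_{i_1}(S),\dots,\mathcal J^g_{i_n}(S))\subseteq\mathcal J^g_{i_1+\cdots+i_n}(S)$ for every bracket $P$ of weight $n$ and all $i_1,\dots,i_n\ge1$. The map $x\mapsto(1+x)\circ\mathcal J^g_{i+1}(S)$ is a bijection $S_i\to\mathcal J^g_i(S)/\mathcal J^g_{i+1}(S)$ taking $+$ to $\circ$; this gives the identification $\bigoplus_{i\ge1}\mathcal J^g_i(S)/\mathcal J^g_{i+1}(S)\cong S$. 2. Under this identification $P_{n,1}$ ($n\ge1$) induces a unique graded $\mathbb K$-multilinear operation $p_{n,1}$ on $S$: it maps $S_{i_1}\times\cdots\times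 S_{i_{n+2}}$ to $S_{i_1+\cdots+i_{n+2}}$, and $P_{n,1}$ maps cosets $(1+x_t)\circ\mathcal J^g_{i_t+1}(S)$ with $x_t\in S_{i_t}$ into the coset of $1+p_{n,1}(x_1,\dots,x_{n+2})$ modulo $\mathcal J^g_{i_1+\cdots+i_{n+2}+1}(S)$. In the same sense the commutator induces a unique bilinear operation on $S$. 3. Let $*$ be the bilinear product on $S$ with $a*b=(m+1)ab$ for $a\in S_m$, $b\in S$. The operation induced by the commutator $[y,z]$ is $y*z-z*y$. 4. For $n\ge1$ and all $x_1,\dots,x_n,y,z\in S$, the Sabinin bracket $$\langle x_1,\dots,x_n;y,z\rangle:=p_{n,1}(x_1,\dots,x_n;z;y)-p_{n,1}(x_1,\dots,x_n;y;z)$$ of the N-sequence equals the Shestakov–Umirbaev bracket $p(x_1,\dots,x_n;z;y)-p(x_1,\dots,x_n;y;z)$ of the nonassociative algebra $(S,*)$, where the operations $p$ are defined recursively by $$(a^*_I*a^*_J)*a-a^*_I*(a^*_J*a)=\sum(a^*_{I(1)}*a^*_{J(1)})*p(\mathbf a_{I(2)};\mathbf a_{J(2)};a)$$ for nonempty finite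 sequences $\mathbf a_I,\mathbf a_J$ in $S$. Here $a^*_I$ is the left-normed $*$-product of the sequence (a formal unit if it is empty), the sum is over all ways of splitting each of the two sequences into a subsequence $I(1)$, resp. $J(1)$, and the complementary subsequence $I(2)$, resp. $J(2)$, and $p$ is $0$ if one of its first two arguments is empty. 5. Explicitly, if $x_t\in S_{i_t}$ for $t=1,\dots,n$, then for all $y,z\in S$ $$\langle x_1,\dots,x_n;y,z\rangle=\sum_{k\ge1}\ \sum_{I(1),\dots,I(k)}(-1)^{k+1}\,|I(k)|\,N(I(1))\cdots N(I(k))\;x_{I(1)}\cdots x_{I(k)}\,(zy-yz),$$ where the inner sum is over all ordered partitions of the sequence $I=(i_1,\dots,i_n)$ into $k$ nonempty subsequences, $x_{I'}$ is the product in increasing order of the $x_t$ belonging to the subsequence $I'$, $|I'|$ is the sum of the entries of $I'$, and $N(j_1,\dots,j_r)=(j_1+1)(j_1+j_2+1)\cdots(j_1+\cdots+j_r+1)$. -/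

import Mathlib

open Finset

/-! ### Loops, normal subloops, deviations, N-sequences -/

section LoopTheory

/-- A loop: a set with a product and a two-sided unit such that all left and right
multiplication operators are bijective. -/
structure IsLoop (Q : Type*) [Mul Q] [One Q] : Prop where
  one_mul : ∀ x : Q, 1 * x = x
  mul_one : ∀ x : Q, x * 1 = x
  left_bijective : ∀ x : Q, Function.Bijective fun y : Q => x * y
  right_bijective : ∀ x : Q, Function.Bijective fun y : Q => y * x

variable {Q : Type*} [Mul Q] [One Q]

/-- The left division `a \ b`: in a loop, the unique solution `x` of `a * x = b`. -/
noncomputable def loopLDiv (a b : Q) : Q :=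
  haveI : Nonempty Q := ⟨1⟩
  Classical.epsilon fun x : Q => a * x = b

/-- The right division `b / a`: in a loop, the unique solution `x` of `x * a = b`. -/
noncomputable def loopRDiv (b a : Q) : Q :=
  haveI : Nonempty Q := ⟨1⟩
  Classical.epsilon fun x : Q => x * a = b

/-- The commutator `[a, b] = (b a) \ (a b)`. -/
noncomputable def loopComm (a b : Q) : Q := loopLDiv (b * a) (a * b)

/-- The associator `(a, b, c) = (a (b c)) \ ((a b) c)`. -/
noncomputable def loopAssoc (a b c : Q) : Q := loopLDiv (a * (b * c)) ((a * b) * c)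

/-- The deviation `(a_1, …, a_{n+3})_{i_1, …, i_n}` of the associator; entries and positions are
numbered from `0`, so that `i k : Fin (k + 3)`. With `A x` the deviation of level `n` in which
the entries number `j` and `j + 1` are replaced by the single entry `x`, the deviation of level
`n + 1` at `j` is `(A (a_j) * A (a_{j+1})) \ A (a_j * a_{j+1})`.
(`Fin.contractNth j op a` is `(a_0, …, op a_j a_{j+1}, …)`.) -/
noncomputable def loopDeviation :
    (n : ℕ) → ((k : Fin n) → Fin ((k : ℕ) + 3)) → (Fin (n + 3) → Q) → Q
  | 0, _, a => loopAssoc (a 0) (a 1) (a 2)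
  | n + 1, i, a =>
    let A : (Q → Q → Q) → Q := fun op =>
      loopDeviation n (fun k => i k.castSucc)
        (Fin.contractNth (Fin.castSucc (n := n + 3) (i (Fin.last n))) op a)
    loopLDiv (A (fun x _ => x) * A (fun _ y => y)) (A fun x y => x * y)

/-- `P_{n+1,1}(x_1, …, x_{n+1}; y; z) = (x_1, …, x_{n+1}, y, z)_{1, …, 1}` (`n` ones), as a function
of the tuple `(x_1, …, x_{n+1}, y, z)`. -/
noncomputable def loopP (n : ℕ) (a : Fin (n + 3) → Q) : Q :=
  loopDeviation n (fun _ => 0) a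

/-- The brackets of weight `n`: the operations in `n` variables obtained by repeatedly applying
commutators, associators and deviations of the associator, every variable being used exactly
once. (The associator itself is the deviation with `n = 0`.) -/
inductive IsLoopBracket : (n : ℕ) → ((Fin n → Q) → Q) → Prop
  | var : IsLoopBracket 1 fun a => a 0
  | comm {m n : ℕ} {P : (Fin m → Q) → Q} {R : (Fin n → Q) → Q}
      (hP : IsLoopBracket m P) (hR : IsLoopBracket n R) :
      IsLoopBracket (m + n) fun a =>
        loopComm (P fun t => a (Fin.castAdd n t)) (R fun t => a (Fin.natAdd m t))
  | dev {n : ℕ} (i : (k : Fin n) → Fin ((k : ℕ) + 3)) {m : Fin (n + 3) → ℕ}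
      {P : (j : Fin (n + 3)) → (Fin (m j) → Q) → Q} (hP : ∀ j, IsLoopBracket (m j) (P j)) :
      IsLoopBracket (∑ j, m j) fun a =>
        loopDeviation n i fun j => P j fun t => a (finSigmaFinEquiv ⟨j, t⟩)

/-- The left coset `a N`. -/
def loopLeftCoset (a : Q) (N : Set Q) : Set Q := {x | ∃ c ∈ N, x = a * c}

/-- `N` is a normal subloop: a subloop with `x N = N x`, `x (y N) = (x y) N` and
`(N x) y = N (x y)` for all `x, y`. -/
structure IsNormalSubloop (N : Set Q) : Prop where
  one_mem : (1 : Q) ∈ N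
  mul_mem : ∀ a ∈ N, ∀ b ∈ N, a * b ∈ N
  ldiv_mem : ∀ a ∈ N, ∀ b ∈ N, loopLDiv a b ∈ N
  rdiv_mem : ∀ a ∈ N, ∀ b ∈ N, loopRDiv a b ∈ N
  comm_coset : ∀ x : Q, (fun c => x * c) '' N = (fun c => c * x) '' N
  left_coset : ∀ x y : Q, (fun c => x * (y * c)) '' N = (fun c => (x * y) * c) '' N
  right_coset : ∀ x y : Q, (fun c => (c * x) * y) '' N = (fun c => c * (x * y)) '' N

/-- `F 1 ⊇ F 2 ⊇ ⋯` is an N-sequence of the loop `Q` (the value `F 0` plays no role). -/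
structure IsNSequence (F : ℕ → Set Q) : Prop where
  one : F 1 = Set.univ
  anti : ∀ i, 1 ≤ i → F (i + 1) ⊆ F i
  normal : ∀ i, 1 ≤ i → IsNormalSubloop (F i)
  bracket_mem : ∀ (n : ℕ) (P : (Fin n → Q) → Q), IsLoopBracket n P →
    ∀ i : Fin n → ℕ, (∀ j, 1 ≤ i j) → ∀ a : Fin n → Q, (∀ j, a j ∈ F (i j)) →
      P a ∈ F (∑ j, i j)

/-- The quotient `F i / F (i + 1)`, as the set of cosets `a F (i + 1)` with `a ∈ F i`. -/
def loopGr (F : ℕ → Set Q) (i : ℕ) : Set (Set Q) :=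
  {X | ∃ a ∈ F i, X = loopLeftCoset a (F (i + 1))}

end LoopTheory

/-! ### The substitution loop of a graded algebra -/

section Substitution

variable {K S : Type*} [Field K] [NonUnitalRing S] [Module K S] [IsScalarTower K S S]
  [SMulCommClass K S S]

/-- The set `1 + Ŝ`, where `Ŝ` is the completion of `S = ⨁ S_n`: the formal sums
`1 + α_1 + α_2 + ⋯` with `α_n ∈ S_n`, written as the power series `1 + α_1 X + α_2 X² + ⋯` over the
algebra `K ⊕ S` obtained from `S` by adjoining a unit element. -/
def SubstLoop (𝒜 : ℕ → Submodule K S) : Type _ :=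
  {f : PowerSeries (Unitization K S) //
    PowerSeries.coeff 0 f = 1 ∧
      ∀ n, 1 ≤ n → ∃ x ∈ 𝒜 n, PowerSeries.coeff n f = (x : Unitization K S)}

namespace SubstLoop

/-- The substitution product `∑ α_m ∘ ∑ β_n = ∑ α_m (∑ β_n)^(m+1)`, where `α_m` has degree `m`. -/
noncomputable def comp (f g : PowerSeries (Unitization K S)) : PowerSeries (Unitization K S) :=
  PowerSeries.mk fun k => ∑ m ∈ range (k + 1),
    PowerSeries.coeff m f * PowerSeries.coeff (k - m) (g ^ (m + 1))

variable (𝒜 : ℕ → Submodule K S)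

noncomputable instance : One (SubstLoop 𝒜) :=
  ⟨⟨1, by simp, fun n hn => ⟨0, zero_mem _, by
    simp [PowerSeries.coeff_one, Nat.one_le_iff_ne_zero.mp hn]⟩⟩⟩

/-- The element `1 + x` for `x` homogeneous of degree `i ≥ 1`. -/
noncomputable def single (i : ℕ) (x : 𝒜 i) : SubstLoop 𝒜 :=
  ⟨PowerSeries.mk fun n => if n = 0 then 1 else if n = i then ((x : S) : Unitization K S) else 0,
    by simp, fun n hn => by
      have h0 : n ≠ 0 := Nat.one_le_iff_ne_zero.mp hn
      by_cases h : n = i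
      · subst h
        exact ⟨x, x.2, by simp [h0]⟩
      · exact ⟨0, zero_mem _, by simp [h0, h]⟩⟩

/-- The filtration `J_i = {1 + α_i + α_{i+1} + ⋯}`. -/
def filtration (i : ℕ) : Set (SubstLoop 𝒜) :=
  {f | ∀ n, 1 ≤ n → n < i → PowerSeries.coeff n f.1 = 0}

variable {𝒜} [SetLike.GradedMul 𝒜]

theorem coeff_pow_mem (g : SubstLoop 𝒜) (m : ℕ) :
    PowerSeries.coeff 0 (g.1 ^ m) = 1 ∧
      ∀ n, 1 ≤ n → ∃ x ∈ 𝒜 n, PowerSeries.coeff n (g.1 ^ m) = (x : Unitization K S) := by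
  induction m with
  | zero => exact (1 : SubstLoop 𝒜).2
  | succ m ih =>
    refine ⟨by simp [pow_succ, PowerSeries.coeff_mul, ih.1, g.2.1], fun n hn => ?_⟩
    have key : ∀ p ∈ antidiagonal n, ∃ x ∈ 𝒜 n,
        PowerSeries.coeff p.1 (g.1 ^ m) * PowerSeries.coeff p.2 g.1
          = (x : Unitization K S) := by
      rintro ⟨p, q⟩ hpq
      rw [HasAntidiagonal.mem_antidiagonal] at hpq
      dsimp only at hpq ⊢
      rcases Nat.eq_zero_or_pos p with rfl | hp
      · obtain rfl : q = n := by omega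
        rw [ih.1, one_mul]
        exact g.2.2 q hn
      · rcases Nat.eq_zero_or_pos q with rfl | hq
        · obtain rfl : p = n := by omega
          rw [g.2.1, mul_one]
          exact ih.2 p hn
        · obtain ⟨x, hx, hx'⟩ := ih.2 p hp
          obtain ⟨y, hy, hy'⟩ := g.2.2 q hq
          exact ⟨x * y, hpq ▸ SetLike.mul_mem_graded hx hy, by
            rw [hx', hy', Unitization.inr_mul]⟩
    choose! x hx hx' using key
    refine ⟨∑ p ∈ antidiagonal n, x p, sum_mem hx, ?_⟩
    rw [pow_succ, PowerSeries.coeff_mul, sum_congr rfl hx']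
    exact (map_sum (Unitization.inrNonUnitalAlgHom K S) x _).symm

noncomputable instance : Mul (SubstLoop 𝒜) :=
  ⟨fun f g => ⟨comp f.1 g.1, by
    refine ⟨by simp [comp, -PowerSeries.coeff_zero_eq_constantCoeff, f.2.1, g.2.1],
      fun n hn => ?_⟩
    have key : ∀ m ∈ range (n + 1), ∃ x ∈ 𝒜 n,
        PowerSeries.coeff m f.1 * PowerSeries.coeff (n - m) (g.1 ^ (m + 1))
          = (x : Unitization K S) := by
      intro m hm
      rw [mem_range] at hm
      obtain ⟨h1, h2⟩ := coeff_pow_mem g (m + 1)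
      rcases Nat.eq_zero_or_pos m with rfl | hm0
      · rw [f.2.1, one_mul]
        exact h2 _ (by omega)
      · obtain ⟨x, hx, hx'⟩ := f.2.2 m hm0
        rcases Nat.eq_zero_or_pos (n - m) with h0 | hnm
        · obtain rfl : m = n := by omega
          exact ⟨x, hx, by rw [h0, h1, mul_one, hx']⟩
        · obtain ⟨y, hy, hy'⟩ := h2 (n - m) hnm
          have hmn : m + (n - m) = n := by omega
          exact ⟨x * y, hmn ▸ SetLike.mul_mem_graded hx hy, by
            rw [hx', hy', Unitization.inr_mul]⟩
    choose! x hx hx' using key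
    refine ⟨∑ m ∈ range (n + 1), x m, sum_mem hx, ?_⟩
    rw [comp, PowerSeries.coeff_mk, sum_congr rfl hx']
    exact (map_sum (Unitization.inrNonUnitalAlgHom K S) x _).symm⟩⟩

variable (𝒜)

/-- The identification `S_i ≅ J_i / J_{i+1}`, `x ↦ (1 + x) J_{i+1}`. -/
def ident (i : ℕ) (x : 𝒜 i) : Set (SubstLoop 𝒜) :=
  loopLeftCoset (single 𝒜 i x) (filtration 𝒜 (i + 1))

/-- The `K`-multilinear operation `p` on `S = ⨁ S_i` is the one that the operation `P` of the
substitution loop induces on `⨁ J_i / J_{i+1} ≅ S`: `p` maps `S_{i_1} × ⋯ × S_{i_n}` to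
`S_{i_1 + ⋯ + i_n}`, and `P` maps the cosets `(1 + x_t) J_{i_t + 1}` into the coset
`(1 + p(x_1, …, x_n)) J_{i_1 + ⋯ + i_n + 1}`. -/
def Induces {n : ℕ} (P : (Fin n → SubstLoop 𝒜) → SubstLoop 𝒜)
    (p : MultilinearMap K (fun _ : Fin n => S) S) : Prop :=
  ∀ i : Fin n → ℕ, (∀ t, 1 ≤ i t) → ∀ x : (t : Fin n) → 𝒜 (i t),
    ∃ h : p (fun t => (x t : S)) ∈ 𝒜 (∑ t, i t),
      ∀ a : Fin n → SubstLoop 𝒜, (∀ t, a t ∈ ident 𝒜 (i t) (x t)) →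
        P a ∈ ident 𝒜 (∑ t, i t) ⟨p fun t => (x t : S), h⟩

end SubstLoop

/-- The bracket `⟨x_1, …, x_{n+1}; y, z⟩ = p(x_1, …, x_{n+1}; z; y) - p(x_1, …, x_{n+1}; y; z)`. -/
def sabininBracket {n : ℕ} (p : MultilinearMap K (fun _ : Fin (n + 3) => S) S)
    (x : Fin (n + 1) → S) (y z : S) : S :=
  p (Fin.snoc (n := n + 2) (Fin.snoc (n := n + 1) x z : Fin (n + 2) → S) y)
    - p (Fin.snoc (n := n + 2) (Fin.snoc (n := n + 1) x y : Fin (n + 2) → S) z)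

end Substitution

/-! ### Shestakov–Umirbaev operations of a nonassociative algebra -/

section ShestakovUmirbaev

/-- All the ways to split a list into a subsequence and the complementary subsequence, i.e. the
terms of the comultiplication `∑ a_{I(1)} ⊗ a_{I(2)}` (sum over shuffles). -/
def shuffleSplits {A : Type*} : List A → List (List A × List A)
  | [] => [([], [])]
  | a :: l => (shuffleSplits l).flatMap fun s => [(a :: s.1, s.2), (s.1, a :: s.2)]

theorem length_of_mem_shuffleSplits {A : Type*} :
    ∀ (l : List A) (s : List A × List A), s ∈ shuffleSplits l →
      s.1.length + s.2.length = l.length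
  | [], s, h => by
    simp only [shuffleSplits, List.mem_singleton] at h
    simp [h]
  | a :: l, s, h => by
    simp only [shuffleSplits, List.mem_flatMap, List.mem_cons, List.not_mem_nil, or_false] at h
    obtain ⟨s', hs', rfl | rfl⟩ := h
    · have := length_of_mem_shuffleSplits l s' hs'
      simp only [List.length_cons]
      omega
    · have := length_of_mem_shuffleSplits l s' hs'
      simp only [List.length_cons]
      omega

variable {K A : Type*} [CommRing K] [AddCommGroup A] [Module K A]

/-- The left-normed product `((a_1 * a_2) * ⋯) * a_m` of a nonempty list
(the value at the empty list is never used). -/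
def leftNormed (μ : A →ₗ[K] A →ₗ[K] A) : List A → A
  | [] => 0
  | a :: l => l.foldl (fun x y => μ x y) a

/-- `(a_I * a_J) * x`, where the product of the empty list is a formal unit element. -/
def suLeft (μ : A →ₗ[K] A →ₗ[K] A) : List A → List A → A → A
  | [], [], x => x
  | [], b :: J, x => μ (leftNormed μ (b :: J)) x
  | a :: I, [], x => μ (leftNormed μ (a :: I)) x
  | a :: I, b :: J, x => μ (μ (leftNormed μ (a :: I)) (leftNormed μ (b :: J))) x

open scoped Classical in
/-- The Shestakov–Umirbaev operation `p(a_1, …, a_m; b_1, …, b_n; c)` of the algebra `(A, μ)`,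
with value `0` if `m = 0` or `n = 0`. It is obtained from the fundamental formula
`suP_fundamental` by solving for the term with `I(1) = J(1) = ∅`. -/
noncomputable def suP (μ : A →ₗ[K] A →ₗ[K] A) (I J : List A) (c : A) : A :=
  if I = [] ∨ J = [] then 0
  else
    μ (μ (leftNormed μ I) (leftNormed μ J)) c - μ (leftNormed μ I) (μ (leftNormed μ J) c)
      - ((shuffleSplits I).attach.map fun s =>
          ((shuffleSplits J).attach.map fun t =>
            if h : s.1.1 = [] ∧ t.1.1 = [] then 0
            else suLeft μ s.1.1 t.1.1 (suP μ s.1.2 t.1.2 c)).sum).sum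
termination_by I.length + J.length
decreasing_by
  have hs := length_of_mem_shuffleSplits _ _ s.2
  have ht := length_of_mem_shuffleSplits _ _ t.2
  have : 0 < s.1.1.length + t.1.1.length := by
    rcases not_and_or.mp h with h | h
    · have := List.length_pos_iff.mpr h
      omega
    · have := List.length_pos_iff.mpr h
      omega
  omega

theorem sum_shuffleSplits_nil (I : List A) : ∀ g : List A → A,
    ((shuffleSplits I).map fun s => if s.1 = [] then g s.2 else 0).sum = g I := by
  induction I with
  | nil => intro g; simp [shuffleSplits]
  | cons a l ih =>
    intro g
    rw [← ih fun l => g (a :: l), shuffleSplits]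
    generalize shuffleSplits l = L
    induction L with
    | nil => simp
    | cons s L ihL =>
      simp only [List.flatMap_cons, List.map_append, List.sum_append, ihL]
      simp

/-- The fundamental formula
`(a_I * a_J) * c - a_I * (a_J * c) = ∑ (a_{I(1)} * a_{J(1)}) * p(a_{I(2)}; a_{J(2)}; c)`. -/
theorem suP_fundamental (μ : A →ₗ[K] A →ₗ[K] A) (I J : List A) (hI : I ≠ []) (hJ : J ≠ [])
    (c : A) :
    μ (μ (leftNormed μ I) (leftNormed μ J)) c - μ (leftNormed μ I) (μ (leftNormed μ J) c) =
      ((shuffleSplits I).map fun s => ((shuffleSplits J).map fun t =>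
        suLeft μ s.1 t.1 (suP μ s.2 t.2 c)).sum).sum := by
  classical
  have h1 : suP μ I J c = ((shuffleSplits I).map fun s => ((shuffleSplits J).map fun t =>
      if s.1 = [] ∧ t.1 = [] then suP μ s.2 t.2 c else 0).sum).sum := by
    rw [← sum_shuffleSplits_nil I fun l => suP μ l J c]
    congr 2
    funext s
    by_cases hs : s.1 = []
    · simp only [hs, true_and, if_true]
      rw [sum_shuffleSplits_nil J fun l => suP μ s.2 l c]
    · simp [hs]
  have h2 : suP μ I J c =
      μ (μ (leftNormed μ I) (leftNormed μ J)) c - μ (leftNormed μ I) (μ (leftNormed μ J) c)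
      - ((shuffleSplits I).map fun s => ((shuffleSplits J).map fun t =>
          if s.1 = [] ∧ t.1 = [] then 0 else suLeft μ s.1 t.1 (suP μ s.2 t.2 c)).sum).sum := by
    rw [suP, if_neg (by simp [hI, hJ])]
    simp only [dite_eq_ite]
    congr 1
    conv_rhs => rw [← List.attach_map_subtype_val (shuffleSplits I), List.map_map]
    congr 2
    funext s
    conv_rhs =>
      rw [Function.comp_apply, ← List.attach_map_subtype_val (shuffleSplits J), List.map_map]
    rfl
  have h3 := sub_eq_iff_eq_add'.mp (h2.symm)
  rw [h3]
  conv_lhs => rw [h1]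
  rw [← List.sum_map_add]
  congr 2
  funext s
  rw [← List.sum_map_add]
  congr 2
  funext t
  by_cases h : s.1 = [] ∧ t.1 = []
  · simp [h, suLeft]
  · simp [h]

/-- The Shestakov–Umirbaev bracket `⟨a_1, …, a_m; b, c⟩ = p(a_1, …, a_m; c; b) - p(a_1, …, a_m; b; c)`. -/
noncomputable def suBracket (μ : A →ₗ[K] A →ₗ[K] A) (I : List A) (b c : A) : A :=
  suP μ I [c] b - suP μ I [b] c

end ShestakovUmirbaev

/-! ### The product `a_m * b_n = (m + 1) a_m b_n` and the explicit formula -/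

section Explicit

variable {K S : Type*} [Field K] [NonUnitalRing S] [Module K S] [IsScalarTower K S S]
  [SMulCommClass K S S]

/-- The bilinear product on `S` with `a * b = (m + 1) a b` for `a` homogeneous of degree `m`. -/
noncomputable def starMul (𝒜 : ℕ → Submodule K S) [DirectSum.Decomposition 𝒜] :
    S →ₗ[K] S →ₗ[K] S :=
  LinearMap.mul K S ∘ₗ
    (DirectSum.toModule K ℕ S fun m => ((m : K) + 1) • (𝒜 m).subtype) ∘ₗ
      (DirectSum.decomposeLinearEquiv 𝒜).toLinearMap

theorem starMul_apply_of_mem (𝒜 : ℕ → Submodule K S) [DirectSum.Decomposition 𝒜] {m : ℕ} {a : S}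
    (ha : a ∈ 𝒜 m) (b : S) : starMul 𝒜 a b = ((m : K) + 1) • (a * b) := by
  lift a to 𝒜 m using ha
  simp [starMul, DirectSum.decomposeLinearEquiv_apply_coe, DirectSum.toModule_lof]

/-- `N(i_1, …, i_m) = (i_1 + 1) (i_1 + i_2 + 1) ⋯ (i_1 + ⋯ + i_m + 1)`. -/
def gradedN (I : List ℕ) : ℕ :=
  ((List.range I.length).map fun s => (I.take (s + 1)).sum + 1).prod

/-- The `r`-th block of the ordered partition of `{0, …, m - 1}` given by `f`, in increasing order. -/
def orderedBlock {m k : ℕ} (f : Fin m → Fin k) (r : Fin k) : List (Fin m) :=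
  (List.finRange m).filter fun t => f t = r

open scoped Classical in
/-- `∑ (-1)^(k+1) |I(k)| N(I(1)) ⋯ N(I(k)) a_{I(1)} ⋯ a_{I(k)} (c b - b c)`, the sum being over `k ≥ 1`
and all ordered partitions of the sequence `I = (i_1, …, i_m)` into `k` nonempty subsequences
`I(1), …, I(k)`, given here by surjections onto `Fin (k' + 1)` with `k' + 1 = k`. -/
noncomputable def explicitBracket {m : ℕ} (i : Fin m → ℕ) (a : Fin m → S) (b c : S) : S :=
  ∑ k' ∈ range m, ∑ f : Fin m → Fin (k' + 1) with Function.Surjective f,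
    ((-1 : ℤ) ^ (k' + 1 + 1) * (((orderedBlock f (Fin.last k')).map i).sum : ℤ)
        * ∏ r, (gradedN ((orderedBlock f r).map i) : ℤ)) •
      (((List.finRange (k' + 1)).flatMap (orderedBlock f)).map a).foldr (fun x y => x * y)
        (c * b - b * c)

end Explicit

/-! An element of the loop is a power series over `K ⊕ S` with constant term 1. The coefficient of
degree k in f ∘ g is f_k + g_k plus terms in lower coefficients, so both divisions can be solved
degree by degree. The solutions stay in every family of subgroups V_n with 1 ∈ V_0 and V_m V_n ⊆
V_{m+n} that contains the data. This stability (`exists_left_solution`, `coeffsIn_deviation`) is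
used for homogeneity, for bounds on weights and for independence of variables.

A deviation equals 1 as soon as one argument is 1 (`IsLoop.deviation_eq_one`). Mark the leading
coefficient of the t-th argument by a central variable and its later coefficients by the square of
that variable. Every monomial in a coefficient of positive degree of the deviation then contains all
the variables, and the degree bounds its weight: below i_1 + ⋯ + i_n nothing survives, and in that
degree only the product of the variables does. This gives the N-sequence property, and it shows that
leading coefficients may be computed with variables of square zero (`coeff_deviation`).

With such variables, (f, 1+η, 1+ζ) = 1 + H(ηζ - ζη), where H is the quotient of `chooseDeg f` by
`succDeg f` (`substComp_substComp`). The loop product is addition on 1 + N when N² = 0, so the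
multilinear part of P_{n,1} is that of the associator whose first argument is the product of the x_t
(`map_loopP_sub_one`). For this product, `succDeg` has the coefficient b(T) = N(i_T) x_T at a set T
of variables, and twice `chooseDeg` has |T| b(T). Hence p_{n,1}(x; y; z) = h (yz - zy), where ∑ b(U)
2h(T \ U) = |T| b(T), the sum being over U ⊆ T.

On the algebra side, the associator of `*` at a, b, c with a of degree d is d(d+1) abc, and (|I| +
1) a*_I = N(I) a_I. The fundamental formula with a single second argument thus becomes the same
convolution equation, with p(x_T; b; c) in place of 2h(T) and with bc on the right. As b(∅) = 1, its
solution is unique (`eq_of_sum_powerset_mul_eq`). So p_{n,1}(x; y; z) is half of p(x; y; z) - p(x;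
z; y), and the two brackets agree. Solving the equation by a geometric series gives the alternating
sum over ordered partitions. -/

set_option linter.unusedSectionVars false

/-! ### Congruences of power series and the substitution product -/

section Series

variable {C : Type*} [Ring C]

/-- Two power series agree in all degrees below `n`. -/
def EqUpTo (n : ℕ) (f g : PowerSeries C) : Prop :=
  ∀ m < n, PowerSeries.coeff m f = PowerSeries.coeff m g

namespace EqUpTo

variable {n : ℕ} {f g h f' g' : PowerSeries C}

theorem refl (n : ℕ) (f : PowerSeries C) : EqUpTo n f f := fun _ _ => rfl

theorem symm (h : EqUpTo n f g) : EqUpTo n g f := fun m hm => (h m hm).symm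

theorem trans (h₁ : EqUpTo n f g) (h₂ : EqUpTo n g h) : EqUpTo n f h :=
  fun m hm => (h₁ m hm).trans (h₂ m hm)

theorem mono {m : ℕ} (h : EqUpTo n f g) (hm : m ≤ n) : EqUpTo m f g :=
  fun k hk => h k (hk.trans_le hm)

theorem mul (h : EqUpTo n f f') (h' : EqUpTo n g g') : EqUpTo n (f * g) (f' * g') := by
  intro m hm
  simp only [PowerSeries.coeff_mul]
  refine sum_congr rfl fun p hp => ?_
  have := mem_antidiagonal.mp hp
  rw [h _ (by omega), h' _ (by omega)]

theorem pow (h : EqUpTo n f g) (k : ℕ) : EqUpTo n (f ^ k) (g ^ k) := by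
  induction k with
  | zero => simpa using refl n 1
  | succ k ih => simpa [pow_succ] using ih.mul h

end EqUpTo

theorem eq_of_eqUpTo {f g : PowerSeries C} (h : ∀ n, EqUpTo n f g) : f = g :=
  PowerSeries.ext fun n => h (n + 1) n n.lt_succ_self

/-- The substitution product `∑ f_m g^(m+1)`. -/
noncomputable def substComp (f g : PowerSeries C) : PowerSeries C :=
  PowerSeries.mk fun k => ∑ m ∈ range (k + 1),
    PowerSeries.coeff m f * PowerSeries.coeff (k - m) (g ^ (m + 1))

theorem coeff_substComp (f g : PowerSeries C) (k : ℕ) :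
    PowerSeries.coeff k (substComp f g) = ∑ m ∈ range (k + 1),
      PowerSeries.coeff m f * PowerSeries.coeff (k - m) (g ^ (m + 1)) :=
  PowerSeries.coeff_mk _ _

theorem coeff_substComp_head (f g : PowerSeries C) (k : ℕ) :
    PowerSeries.coeff k (substComp f g) = PowerSeries.coeff 0 f * PowerSeries.coeff k g +
      ∑ m ∈ range k,
        PowerSeries.coeff (m + 1) f * PowerSeries.coeff (k - (m + 1)) (g ^ (m + 2)) := by
  rw [coeff_substComp, sum_range_succ', add_comm]
  simp

theorem coeff_substComp_last (f g : PowerSeries C) (k : ℕ) :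
    PowerSeries.coeff k (substComp f g) =
      ∑ m ∈ range k, PowerSeries.coeff m f * PowerSeries.coeff (k - m) (g ^ (m + 1)) +
        PowerSeries.coeff k f * PowerSeries.coeff 0 (g ^ (k + 1)) := by
  rw [coeff_substComp, sum_range_succ]
  simp

theorem EqUpTo.subst {n : ℕ} {f f' g g' : PowerSeries C} (h : EqUpTo n f f')
    (h' : EqUpTo n g g') : EqUpTo n (substComp f g) (substComp f' g') := by
  intro m hm
  simp only [coeff_substComp]
  refine sum_congr rfl fun p hp => ?_
  have := mem_range.mp hp
  rw [h _ (by omega), h'.pow _ _ (by omega)]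

theorem coeff_zero_pow {g : PowerSeries C} (hg : PowerSeries.coeff 0 g = 1) (m : ℕ) :
    PowerSeries.coeff 0 (g ^ m) = 1 := by
  simp only [PowerSeries.coeff_zero_eq_constantCoeff, map_pow] at hg ⊢
  rw [hg, one_pow]

theorem coeff_zero_substComp {f g : PowerSeries C} (hf : PowerSeries.coeff 0 f = 1)
    (hg : PowerSeries.coeff 0 g = 1) : PowerSeries.coeff 0 (substComp f g) = 1 := by
  rw [coeff_substComp_head, hf, hg]
  simp

theorem one_substComp (g : PowerSeries C) : substComp 1 g = g := by
  ext k
  rw [coeff_substComp_head]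
  simp [PowerSeries.coeff_one]

theorem substComp_one (f : PowerSeries C) : substComp f 1 = f := by
  ext k
  rw [coeff_substComp_last, sum_eq_zero fun m hm => ?_]
  · simp
  · have := mem_range.mp hm
    rw [one_pow, PowerSeries.coeff_one, if_neg (by omega), mul_zero]

/-- In degree k, the series f ∘ x has the coefficient x_k plus products in which f contributes
positive degree. These involve only coefficients of x below k, so subtracting x gains one degree of
precision. -/
theorem eqUpTo_succ_sub_substComp_left {f : PowerSeries C} (hf : PowerSeries.coeff 0 f = 1)
    {n : ℕ} {x y : PowerSeries C} (h : EqUpTo n x y) :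
    EqUpTo (n + 1) (x - substComp f x) (y - substComp f y) := by
  intro k hk
  simp only [map_sub, coeff_substComp_head, hf, one_mul, sub_add_cancel_left]
  refine congrArg Neg.neg (sum_congr rfl fun m hm => ?_)
  have := mem_range.mp hm
  rw [h.pow _ _ (by omega)]

/-- Here x_k occurs only in the last summand, multiplied by the constant term of f^(k+1), which is
1. -/
theorem eqUpTo_succ_sub_substComp_right {f : PowerSeries C} (hf : PowerSeries.coeff 0 f = 1)
    {n : ℕ} {x y : PowerSeries C} (h : EqUpTo n x y) :
    EqUpTo (n + 1) (x - substComp x f) (y - substComp y f) := by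
  intro k hk
  simp only [map_sub, coeff_substComp_last, coeff_zero_pow hf, mul_one, sub_add_cancel_right]
  refine congrArg Neg.neg (sum_congr rfl fun m hm => ?_)
  have := mem_range.mp hm
  rw [h _ (by omega)]

/-- An operator that gains a degree of precision has a fixed point, the limit of its iterates. -/
theorem exists_fixedPoint_of_eqUpTo_succ {F : PowerSeries C → PowerSeries C}
    (hF : ∀ n x y, EqUpTo n x y → EqUpTo (n + 1) (F x) (F y)) :
    ∃ x, F x = x ∧ ∀ n, PowerSeries.coeff n x = PowerSeries.coeff n (F^[n + 1] 0) := by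
  have h1 : ∀ n, EqUpTo n (F^[n] 0) (F^[n + 1] 0) := by
    intro n
    induction n with
    | zero => intro m hm; omega
    | succ n ih => simpa only [Function.iterate_succ_apply'] using hF _ _ _ ih
  have h2 : ∀ n d, EqUpTo n (F^[n] 0) (F^[n + d] 0) := by
    intro n d
    induction d with
    | zero => exact EqUpTo.refl _ _
    | succ d ih => exact ih.trans ((h1 (n + d)).mono (by omega))
  refine ⟨PowerSeries.mk fun n => PowerSeries.coeff n (F^[n + 1] 0), ?_, fun n =>
    PowerSeries.coeff_mk _ _⟩
  have h3 : ∀ n, EqUpTo n (PowerSeries.mk fun n => PowerSeries.coeff n (F^[n + 1] 0)) (F^[n] 0) := by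
    intro n m hm
    rw [PowerSeries.coeff_mk]
    obtain ⟨d, rfl⟩ := Nat.exists_eq_add_of_le (Nat.succ_le_of_lt hm)
    exact h2 (m + 1) d m (by omega)
  refine eq_of_eqUpTo fun n => ?_
  have h4 := hF n _ _ (h3 n)
  rw [← Function.iterate_succ_apply' F] at h4
  exact (h4.trans (h3 (n + 1)).symm).mono (by omega)

/-- Cancellation at finite precision: since x - f ∘ x is known one degree further than x, equality
of the products propagates upwards. Besides injectivity of translations, this makes translations
carry congruence classes onto congruence classes. -/
theorem eqUpTo_of_substComp_left {f : PowerSeries C} (hf : PowerSeries.coeff 0 f = 1) {n : ℕ}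
    {x y : PowerSeries C} (h : EqUpTo n (substComp f x) (substComp f y)) : EqUpTo n x y := by
  suffices ∀ k ≤ n, EqUpTo k x y from this n le_rfl
  intro k
  induction k with
  | zero => intro _ m hm; omega
  | succ k ih =>
    intro hk m hm
    have h1 := eqUpTo_succ_sub_substComp_left hf (ih (by omega)) m hm
    rw [map_sub, map_sub, h m (by omega)] at h1
    exact sub_left_injective h1

theorem eqUpTo_of_substComp_right {f : PowerSeries C} (hf : PowerSeries.coeff 0 f = 1) {n : ℕ}
    {x y : PowerSeries C} (h : EqUpTo n (substComp x f) (substComp y f)) : EqUpTo n x y := by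
  suffices ∀ k ≤ n, EqUpTo k x y from this n le_rfl
  intro k
  induction k with
  | zero => intro _ m hm; omega
  | succ k ih =>
    intro hk m hm
    have h1 := eqUpTo_succ_sub_substComp_right hf (ih (by omega)) m hm
    rw [map_sub, map_sub, h m (by omega)] at h1
    exact sub_left_injective h1

/-! ### Power series with coefficients in a multiplicative family of subgroups -/

/-- All coefficients of `f` lie in the respective members of the family `V`. -/
def CoeffsIn (V : ℕ → AddSubgroup C) (f : PowerSeries C) : Prop :=
  ∀ n, PowerSeries.coeff n f ∈ V n

namespace CoeffsIn

variable {V : ℕ → AddSubgroup C} {f g : PowerSeries C}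

theorem zero : CoeffsIn V 0 := fun n => by simp

theorem add (hf : CoeffsIn V f) (hg : CoeffsIn V g) : CoeffsIn V (f + g) := fun n => by
  simpa using (V n).add_mem (hf n) (hg n)

theorem sub (hf : CoeffsIn V f) (hg : CoeffsIn V g) : CoeffsIn V (f - g) := fun n => by
  simpa using (V n).sub_mem (hf n) (hg n)

variable [SetLike.GradedMonoid V]

theorem one : CoeffsIn V (1 : PowerSeries C) := fun n => by
  rw [PowerSeries.coeff_one]
  split_ifs with h
  · subst h
    exact SetLike.GradedOne.one_mem
  · exact (V n).zero_mem

theorem mul (hf : CoeffsIn V f) (hg : CoeffsIn V g) : CoeffsIn V (f * g) := fun n => by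
  rw [PowerSeries.coeff_mul]
  refine sum_mem fun p hp => ?_
  rw [← mem_antidiagonal.mp hp]
  exact SetLike.GradedMul.mul_mem (hf _) (hg _)

theorem pow (hf : CoeffsIn V f) (k : ℕ) : CoeffsIn V (f ^ k) := by
  induction k with
  | zero => simp [one]
  | succ k ih => simpa [pow_succ] using ih.mul hf

theorem subst (hf : CoeffsIn V f) (hg : CoeffsIn V g) : CoeffsIn V (substComp f g) :=
  fun n => by
    rw [coeff_substComp]
    refine sum_mem fun m hm => ?_
    have h : m + (n - m) = n := by have := mem_range.mp hm; omega
    have := SetLike.GradedMul.mul_mem (hf m) (hg.pow (m + 1) (n - m))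
    rwa [h] at this

/-- The coefficient g_n is the n-th coefficient of f g minus products of earlier g_m with
coefficients of f, because f_0 = 1. It serves to see that a quotient of homogeneous series is
homogeneous. -/
theorem of_mul (hf0 : PowerSeries.coeff 0 f = 1) (hf : CoeffsIn V f) (h : CoeffsIn V (f * g)) :
    CoeffsIn V g := by
  intro n
  induction n using Nat.strong_induction_on with
  | _ n ih =>
    have h1 := h n
    rw [PowerSeries.coeff_mul, Nat.sum_antidiagonal_eq_sum_range_succ
      (fun i j => PowerSeries.coeff i f * PowerSeries.coeff j g), sum_range_succ', hf0, one_mul,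
      AddSubgroup.add_mem_cancel_left] at h1
    · simpa using h1
    · refine sum_mem fun m hm => ?_
      have h2 : m + 1 + (n - (m + 1)) = n := by have := mem_range.mp hm; omega
      have := SetLike.GradedMul.mul_mem (hf (m + 1)) (ih (n - (m + 1)) (by omega))
      rwa [h2] at this

end CoeffsIn

end Series

/-! ### The substitution loop of a ring -/

/-- Power series with constant coefficient `1`. -/
def UnipotentSeries (C : Type*) [Ring C] : Type _ :=
  {f : PowerSeries C // PowerSeries.coeff 0 f = 1}

namespace UnipotentSeries

variable {C D : Type*} [Ring C] [Ring D]

noncomputable instance : One (UnipotentSeries C) := ⟨⟨1, by simp⟩⟩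

noncomputable instance : Mul (UnipotentSeries C) :=
  ⟨fun f g => ⟨substComp f.1 g.1, coeff_zero_substComp f.2 g.2⟩⟩

theorem ext {f g : UnipotentSeries C} (h : f.1 = g.1) : f = g := Subtype.ext h

theorem one_val : (1 : UnipotentSeries C).1 = 1 := rfl

theorem mul_val (f g : UnipotentSeries C) : (f * g).1 = substComp f.1 g.1 := rfl

/-- The solution is the fixed point of x ↦ x - f ∘ x + g. The clause on `V` transfers the loop
structure to series with coefficients in prescribed subgroups, where the solution would otherwise
have to be constructed anew. -/
theorem exists_left_solution (f g : UnipotentSeries C) :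
    ∃ x : UnipotentSeries C, f * x = g ∧ ∀ (V : ℕ → AddSubgroup C) [SetLike.GradedMonoid V],
      CoeffsIn V f.1 → CoeffsIn V g.1 → CoeffsIn V x.1 := by
  obtain ⟨x, hx, hx'⟩ := exists_fixedPoint_of_eqUpTo_succ
    (F := fun x => x - substComp f.1 x + g.1) fun n x y h m hm => by
      simp only [map_add, eqUpTo_succ_sub_substComp_left f.2 h m hm]
  have hx1 : substComp f.1 x = g.1 := by
    have := hx
    rw [sub_add, sub_eq_self, sub_eq_zero] at this
    exact this
  have hx0 : PowerSeries.coeff 0 x = 1 := by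
    have := congrArg (PowerSeries.coeff 0) hx1
    rwa [coeff_substComp_head, f.2, g.2, one_mul, range_zero, sum_empty, add_zero] at this
  refine ⟨⟨x, hx0⟩, Subtype.ext hx1, fun V _ hf hg n => ?_⟩
  rw [hx']
  -- Each coefficient of the limit is a coefficient of a finite iterate, and all iterates, starting
  -- from 0, have coefficients in `V`.
  generalize n + 1 = N
  revert n
  change CoeffsIn V _
  induction N with
  | zero => exact CoeffsIn.zero
  | succ N ih =>
    rw [Function.iterate_succ_apply']
    exact (ih.sub (hf.subst ih)).add hg

theorem exists_right_solution (f g : UnipotentSeries C) :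
    ∃ x : UnipotentSeries C, x * f = g ∧ ∀ (V : ℕ → AddSubgroup C) [SetLike.GradedMonoid V],
      CoeffsIn V f.1 → CoeffsIn V g.1 → CoeffsIn V x.1 := by
  obtain ⟨x, hx, hx'⟩ := exists_fixedPoint_of_eqUpTo_succ
    (F := fun x => x - substComp x f.1 + g.1) fun n x y h m hm => by
      simp only [map_add, eqUpTo_succ_sub_substComp_right f.2 h m hm]
  have hx1 : substComp x f.1 = g.1 := by
    have := hx
    rw [sub_add, sub_eq_self, sub_eq_zero] at this
    exact this
  have hx0 : PowerSeries.coeff 0 x = 1 := by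
    have := congrArg (PowerSeries.coeff 0) hx1
    rwa [coeff_substComp_head, f.2, g.2, mul_one, range_zero, sum_empty, add_zero] at this
  refine ⟨⟨x, hx0⟩, Subtype.ext hx1, fun V _ hf hg n => ?_⟩
  rw [hx']
  generalize n + 1 = N
  revert n
  change CoeffsIn V _
  induction N with
  | zero => exact CoeffsIn.zero
  | succ N ih =>
    rw [Function.iterate_succ_apply']
    exact (ih.sub (ih.subst hf)).add hg

theorem eq_of_mul_left {f x y : UnipotentSeries C} (h : f * x = f * y) : x = y :=
  Subtype.ext (eq_of_eqUpTo fun n => eqUpTo_of_substComp_left f.2 (n := n) (by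
    rw [← mul_val, h, mul_val]; exact EqUpTo.refl _ _))

theorem eq_of_mul_right {f x y : UnipotentSeries C} (h : x * f = y * f) : x = y :=
  Subtype.ext (eq_of_eqUpTo fun n => eqUpTo_of_substComp_right f.2 (n := n) (by
    rw [← mul_val, h, mul_val]; exact EqUpTo.refl _ _))

theorem isLoop : IsLoop (UnipotentSeries C) where
  one_mul x := Subtype.ext (one_substComp x.1)
  mul_one x := Subtype.ext (substComp_one x.1)
  left_bijective x := ⟨fun _ _ => eq_of_mul_left, fun y =>
    (exists_left_solution x y).imp fun _ h => h.1⟩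
  right_bijective x := ⟨fun _ _ => eq_of_mul_right, fun y =>
    (exists_right_solution x y).imp fun _ h => h.1⟩

end UnipotentSeries

/-! ### Divisions and deviations in loops -/

namespace IsLoop

variable {Q Q' : Type*} [Mul Q] [One Q] [Mul Q'] [One Q']

theorem mul_ldiv (hQ : IsLoop Q) (a b : Q) : a * loopLDiv a b = b :=
  Classical.epsilon_spec (p := fun x : Q => a * x = b) ((hQ.left_bijective a).2 b)

theorem rdiv_mul (hQ : IsLoop Q) (a b : Q) : loopRDiv b a * a = b :=
  Classical.epsilon_spec (p := fun x : Q => x * a = b) ((hQ.right_bijective a).2 b)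

theorem ldiv_eq (hQ : IsLoop Q) {a b x : Q} (h : a * x = b) : loopLDiv a b = x :=
  (hQ.left_bijective a).1 ((hQ.mul_ldiv a b).trans h.symm)

theorem rdiv_eq (hQ : IsLoop Q) {a b x : Q} (h : x * a = b) : loopRDiv b a = x :=
  (hQ.right_bijective a).1 ((hQ.rdiv_mul a b).trans h.symm)

theorem ldiv_self (hQ : IsLoop Q) (a : Q) : loopLDiv a a = 1 := hQ.ldiv_eq (hQ.mul_one a)

theorem map_ldiv (hQ : IsLoop Q) (hQ' : IsLoop Q') {φ : Q → Q'}
    (hφ : ∀ a b, φ (a * b) = φ a * φ b) (a b : Q) :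
    φ (loopLDiv a b) = loopLDiv (φ a) (φ b) :=
  (hQ'.ldiv_eq (by rw [← hφ, hQ.mul_ldiv])).symm

theorem map_rdiv (hQ : IsLoop Q) (hQ' : IsLoop Q') {φ : Q → Q'}
    (hφ : ∀ a b, φ (a * b) = φ a * φ b) (a b : Q) :
    φ (loopRDiv a b) = loopRDiv (φ a) (φ b) :=
  (hQ'.rdiv_eq (by rw [← hφ, hQ.rdiv_mul])).symm

/-- Deviations are built from products and left divisions only. This is what allows them to be
computed over a larger or a smaller coefficient ring. -/
theorem map_deviation (hQ : IsLoop Q) (hQ' : IsLoop Q') {φ : Q → Q'}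
    (hφ : ∀ a b, φ (a * b) = φ a * φ b) :
    ∀ (n : ℕ) (i : (k : Fin n) → Fin ((k : ℕ) + 3)) (a : Fin (n + 3) → Q),
      φ (loopDeviation n i a) = loopDeviation n i fun j => φ (a j)
  | 0, i, a => by
    simp only [loopDeviation, loopAssoc, hQ.map_ldiv hQ' hφ, hφ]
  | n + 1, i, a => by
    have key : ∀ (j : Fin (n + 4)) (op : Q → Q → Q) (op' : Q' → Q' → Q'),
        (∀ x y, φ (op x y) = op' (φ x) (φ y)) →
        (fun k => φ (Fin.contractNth j op a k)) = Fin.contractNth j op' fun k => φ (a k) := by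
      intro j op op' h
      funext k
      simp only [Fin.contractNth]
      split_ifs <;> simp [h]
    simp only [loopDeviation, hQ.map_ldiv hQ' hφ, hφ, map_deviation hQ hQ' hφ n]
    rw [key _ _ (fun x _ => x) fun _ _ => rfl, key _ _ (fun _ y => y) fun _ _ => rfl,
      key _ _ _ hφ]

theorem _root_.loopDeviation_mem {N : Set Q} (hmul : ∀ a ∈ N, ∀ b ∈ N, a * b ∈ N)
    (hldiv : ∀ a ∈ N, ∀ b ∈ N, loopLDiv a b ∈ N) :
    ∀ (n : ℕ) (i : (k : Fin n) → Fin ((k : ℕ) + 3)) (a : Fin (n + 3) → Q),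
      (∀ j, a j ∈ N) → loopDeviation n i a ∈ N
  | 0, i, a, h => hldiv _ (hmul _ (h _) _ (hmul _ (h _) _ (h _))) _
      (hmul _ (hmul _ (h _) _ (h _)) _ (h _))
  | n + 1, i, a, h => by
    have key : ∀ (j : Fin (n + 4)) (op : Q → Q → Q), (∀ x ∈ N, ∀ y ∈ N, op x y ∈ N) →
        ∀ k, Fin.contractNth j op a k ∈ N := by
      intro j op hop k
      simp only [Fin.contractNth]
      split_ifs
      exacts [h _, hop _ (h _) _ (h _), h _]
    exact hldiv _ (hmul _ (loopDeviation_mem hmul hldiv n _ _ (key _ _ fun x hx _ _ => hx)) _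
      (loopDeviation_mem hmul hldiv n _ _ (key _ _ fun _ _ y hy => hy))) _
      (loopDeviation_mem hmul hldiv n _ _ (key _ _ hmul))

/-- Induction on the level. If the unit lies outside the two contracted entries, all three values of
A are 1. If it is one of these two, one of the factors is 1 and the other coincides with the value
at the product. -/
theorem deviation_eq_one (hQ : IsLoop Q) :
    ∀ (n : ℕ) (i : (k : Fin n) → Fin ((k : ℕ) + 3)) (a : Fin (n + 3) → Q) (j : Fin (n + 3)),
      a j = 1 → loopDeviation n i a = 1
  | 0, i, a, j, h => by
    simp only [loopDeviation, loopAssoc]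
    fin_cases j
    · change a 0 = 1 at h
      rw [h, hQ.one_mul, hQ.one_mul, hQ.ldiv_self]
    · change a 1 = 1 at h
      rw [h, hQ.one_mul, hQ.mul_one, hQ.ldiv_self]
    · change a 2 = 1 at h
      rw [h, hQ.mul_one, hQ.mul_one, hQ.ldiv_self]
  | n + 1, i, a, j, h => by
    set c : Fin (n + 3) := i (Fin.last n) with hc
    have hone : ∀ (op : Q → Q → Q) (k : Fin (n + 3)),
        Fin.contractNth (Fin.castSucc (n := n + 3) c) op a k = 1 →
        loopDeviation n (fun k => i k.castSucc)
          (Fin.contractNth (Fin.castSucc (n := n + 3) c) op a) = 1 :=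
      fun op k hk => deviation_eq_one hQ n _ _ k hk
    have hl : ∀ op : Q → Q → Q, (j : ℕ) < c →
        loopDeviation n (fun k => i k.castSucc)
          (Fin.contractNth (Fin.castSucc (n := n + 3) c) op a) = 1 := by
      intro op hj
      have hj' : (j : ℕ) < n + 3 := hj.trans c.2
      refine hone op ⟨j, hj'⟩ ?_
      rw [Fin.contractNth_apply_of_lt _ _ _ _ (by simpa using hj)]
      exact h
    have hr : ∀ op : Q → Q → Q, (c : ℕ) + 1 < j →
        loopDeviation n (fun k => i k.castSucc)
          (Fin.contractNth (Fin.castSucc (n := n + 3) c) op a) = 1 := by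
      intro op hj
      have hj' : (j : ℕ) - 1 < n + 3 := by omega
      refine hone op ⟨j - 1, hj'⟩ ?_
      rw [Fin.contractNth_apply_of_gt _ _ _ _ (by simp; omega)]
      convert h
      ext
      simp
      omega
    have hmid : ∀ op : Q → Q → Q, Fin.contractNth (Fin.castSucc (n := n + 3) c) op a c =
        op (a (Fin.castSucc c)) (a (Fin.succ c)) := fun op =>
      Fin.contractNth_apply_of_eq _ _ _ _ (by simp)
    have hfun : ∀ op op' : Q → Q → Q,
        op (a (Fin.castSucc c)) (a (Fin.succ c)) = op' (a (Fin.castSucc c)) (a (Fin.succ c)) →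
        Fin.contractNth (Fin.castSucc (n := n + 3) c) op a =
          Fin.contractNth (Fin.castSucc (n := n + 3) c) op' a := by
      intro op op' heq
      funext k
      rcases lt_trichotomy (k : ℕ) c with hk | hk | hk
      · rw [Fin.contractNth_apply_of_lt _ _ _ _ (by simpa using hk),
          Fin.contractNth_apply_of_lt _ _ _ _ (by simpa using hk)]
      · obtain rfl : k = c := Fin.ext hk
        rw [hmid, hmid, heq]
      · rw [Fin.contractNth_apply_of_gt _ _ _ _ (by simpa using hk),
          Fin.contractNth_apply_of_gt _ _ _ _ (by simpa using hk)]
    simp only [loopDeviation, ← hc]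
    rcases lt_trichotomy (j : ℕ) c with hj | hj | hj
    · rw [hl _ hj, hl _ hj, hl _ hj, hQ.one_mul, hQ.ldiv_self]
    · obtain rfl : j = Fin.castSucc c := Fin.ext hj
      rw [hone (fun x _ => x) c (by rw [hmid, h]), hQ.one_mul,
        hfun (fun _ y => y) (fun x y => x * y) (by simp only [h, hQ.one_mul]), hQ.ldiv_self]
    · rcases Nat.eq_or_lt_of_le (Nat.succ_le_of_lt hj) with hj' | hj'
      · obtain rfl : j = Fin.succ c := Fin.ext hj'.symm
        rw [hone (fun _ y => y) c (by rw [hmid, h]), hQ.mul_one,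
          hfun (fun x _ => x) (fun x y => x * y) (by simp only [h, hQ.mul_one]), hQ.ldiv_self]
      · rw [hr _ hj', hr _ hj', hr _ hj', hQ.one_mul, hQ.ldiv_self]

end IsLoop

/-! ### Low-degree coefficients of the substitution product -/

section Series

variable {C : Type*} [Ring C]

/-- Comparison with f ∘ 1 = f. The correction term pairs f_{m+1} with the deviation of g^(m+2) from
1, so it vanishes as long as one of f, g is close enough to 1. -/
theorem coeff_substComp_eq_add {f g : PowerSeries C} (hf : PowerSeries.coeff 0 f = 1) {k : ℕ}
    (hk : k ≠ 0) :
    PowerSeries.coeff k (substComp f g) = PowerSeries.coeff k f + PowerSeries.coeff k g +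
      ∑ m ∈ range k, PowerSeries.coeff (m + 1) f *
        (PowerSeries.coeff (k - (m + 1)) (g ^ (m + 2)) - PowerSeries.coeff (k - (m + 1)) 1) := by
  have h1 := coeff_substComp_head f 1 k
  rw [substComp_one, hf, one_mul, PowerSeries.coeff_one, if_neg hk, zero_add] at h1
  simp only [one_pow] at h1
  simp only [mul_sub, sum_sub_distrib, ← h1, coeff_substComp_head, hf, one_mul]
  abel

theorem EqUpTo.coeff_mul_eq_add {n : ℕ} (hn : n ≠ 0) {f g : PowerSeries C} (hf : EqUpTo n f 1)
    (hg : EqUpTo n g 1) :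
    PowerSeries.coeff n (f * g) = PowerSeries.coeff n f + PowerSeries.coeff n g := by
  obtain ⟨n, rfl⟩ := Nat.exists_eq_succ_of_ne_zero hn
  rw [PowerSeries.coeff_mul, Nat.sum_antidiagonal_eq_sum_range_succ
    (fun i j => PowerSeries.coeff i f * PowerSeries.coeff j g), sum_range_succ, sum_range_succ',
    sum_eq_zero fun m hm => ?_, hf 0 (by omega), Nat.sub_self, hg 0 (by omega)]
  · simp [add_comm]
  · have := mem_range.mp hm
    rw [hf (m + 1) (by omega), PowerSeries.coeff_one, if_neg (by omega), zero_mul]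

theorem EqUpTo.coeff_pow_of_lt {n k : ℕ} {g : PowerSeries C} (hg : EqUpTo n g 1) (hk : k < n)
    (m : ℕ) : PowerSeries.coeff k (g ^ m) = PowerSeries.coeff k 1 := by
  rw [hg.pow m k hk, one_pow]

theorem EqUpTo.coeff_pow {n : ℕ} (hn : n ≠ 0) {f : PowerSeries C} (hf : EqUpTo n f 1) (m : ℕ) :
    PowerSeries.coeff n (f ^ m) = m * PowerSeries.coeff n f := by
  induction m with
  | zero => simp [PowerSeries.coeff_one, hn]
  | succ m ih =>
    rw [pow_succ, EqUpTo.coeff_mul_eq_add hn (by simpa using hf.pow m) hf, ih]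
    push_cast
    rw [add_mul, one_mul]

theorem EqUpTo.coeff_substComp_self {k : ℕ} (hk : k ≠ 0) {f g : PowerSeries C}
    (hf : PowerSeries.coeff 0 f = 1) (hg : EqUpTo k g 1) :
    PowerSeries.coeff k (substComp f g) = PowerSeries.coeff k f + PowerSeries.coeff k g := by
  rw [coeff_substComp_eq_add hf hk, add_eq_left]
  refine sum_eq_zero fun m hm => ?_
  have := mem_range.mp hm
  rw [hg.coeff_pow_of_lt (by omega) _, sub_self, mul_zero]

theorem EqUpTo.coeff_substComp_of_lt {i j k : ℕ} (hk : k ≠ 0) (hkij : k < i + j)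
    {f g : PowerSeries C} (hf0 : PowerSeries.coeff 0 f = 1) (hf : EqUpTo i f 1)
    (hg : EqUpTo j g 1) :
    PowerSeries.coeff k (substComp f g) = PowerSeries.coeff k f + PowerSeries.coeff k g := by
  rw [coeff_substComp_eq_add hf0 hk, add_eq_left]
  refine sum_eq_zero fun m hm => ?_
  have := mem_range.mp hm
  by_cases hmi : m + 1 < i
  · rw [hf _ hmi, PowerSeries.coeff_one, if_neg (by omega), zero_mul]
  · rw [hg.coeff_pow_of_lt (by omega) _, sub_self, mul_zero]

/-- Only f_i meets a nonzero coefficient of a power of g minus 1. That power has exponent i + 1,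
which is the origin of the factor in the product `*`. -/
theorem EqUpTo.coeff_substComp_add {i j : ℕ} (hi : i ≠ 0) (hj : j ≠ 0) {f g : PowerSeries C}
    (hf0 : PowerSeries.coeff 0 f = 1) (hf : EqUpTo i f 1) (hg : EqUpTo j g 1) :
    PowerSeries.coeff (i + j) (substComp f g) =
      PowerSeries.coeff (i + j) f + PowerSeries.coeff (i + j) g +
        PowerSeries.coeff i f * ((i + 1 : ℕ) * PowerSeries.coeff j g) := by
  obtain ⟨i, rfl⟩ := Nat.exists_eq_succ_of_ne_zero hi
  rw [coeff_substComp_eq_add hf0 (by omega), add_right_inj, sum_eq_single i]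
  · rw [Nat.succ_eq_add_one, Nat.add_sub_cancel_left, hg.coeff_pow hj, PowerSeries.coeff_one,
      if_neg hj, sub_zero]
  · intro m hm hmi
    have := mem_range.mp hm
    by_cases hmi' : m < i
    · rw [hf _ (by omega), PowerSeries.coeff_one, if_neg (by omega), zero_mul]
    · rw [hg.coeff_pow_of_lt (by omega) _, sub_self, mul_zero]
  · intro h
    rw [mem_range] at h
    omega

end Series

/-! ### Leading coefficients of divisions and commutators -/

namespace UnipotentSeries

variable {C : Type*} [Ring C]

theorem eqUpTo_ldiv {n : ℕ} {f g : UnipotentSeries C} (h : EqUpTo n f.1 g.1) :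
    EqUpTo n (loopLDiv f g).1 1 := by
  refine eqUpTo_of_substComp_left f.2 ?_
  rw [← mul_val, isLoop.mul_ldiv, substComp_one]
  exact h.symm

theorem eqUpTo_rdiv {n : ℕ} {f g : UnipotentSeries C} (h : EqUpTo n f.1 g.1) :
    EqUpTo n (loopRDiv g f).1 1 := by
  refine eqUpTo_of_substComp_right f.2 ?_
  rw [← mul_val, isLoop.rdiv_mul, one_substComp]
  exact h.symm

theorem coeff_ldiv {n : ℕ} (hn : n ≠ 0) {f g : UnipotentSeries C} (h : EqUpTo n f.1 g.1) :
    PowerSeries.coeff n (loopLDiv f g).1 = PowerSeries.coeff n g.1 - PowerSeries.coeff n f.1 := by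
  have h1 := (eqUpTo_ldiv h).coeff_substComp_self hn f.2
  rw [← mul_val, isLoop.mul_ldiv] at h1
  rw [h1, add_sub_cancel_left]

/-- Below degree i + j the product just adds coefficients, so the order of the factors is
irrelevant. -/
theorem eqUpTo_mul_mul_of_eqUpTo_one {i j : ℕ} {f g : UnipotentSeries C} (hf : EqUpTo i f.1 1)
    (hg : EqUpTo j g.1 1) : EqUpTo (i + j) (g * f).1 (f * g).1 := by
  intro k hk
  rcases eq_or_ne k 0 with rfl | hk0
  · rw [(g * f).2, (f * g).2]
  · rw [mul_val, mul_val, hf.coeff_substComp_of_lt hk0 hk f.2 hg,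
      hg.coeff_substComp_of_lt hk0 (by omega) g.2 hf, add_comm]

theorem eqUpTo_comm {i j : ℕ} {f g : UnipotentSeries C} (hf : EqUpTo i f.1 1)
    (hg : EqUpTo j g.1 1) : EqUpTo (i + j) (loopComm f g).1 1 :=
  eqUpTo_ldiv (eqUpTo_mul_mul_of_eqUpTo_one hf hg)

theorem coeff_comm {i j : ℕ} (hi : i ≠ 0) (hj : j ≠ 0) {f g : UnipotentSeries C}
    (hf : EqUpTo i f.1 1) (hg : EqUpTo j g.1 1) :
    PowerSeries.coeff (i + j) (loopComm f g).1 =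
      PowerSeries.coeff i f.1 * ((i + 1 : ℕ) * PowerSeries.coeff j g.1) -
        PowerSeries.coeff j g.1 * ((j + 1 : ℕ) * PowerSeries.coeff i f.1) := by
  rw [loopComm, coeff_ldiv (by omega) (eqUpTo_mul_mul_of_eqUpTo_one hf hg), mul_val, mul_val,
    hf.coeff_substComp_add hi hj f.2 hg, add_comm i j, hg.coeff_substComp_add hj hi g.2 hf]
  abel

end UnipotentSeries

/-! ### The graded subloop, its filtration and its graded quotients -/

namespace SubstLoop

variable {K S : Type*} [Field K] [NonUnitalRing S] [Module K S] [IsScalarTower K S S]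
  [SMulCommClass K S S] {𝒜 : ℕ → Submodule K S}

/-- An element of the substitution loop as a power series with constant coefficient `1`. -/
def toUnipotent (f : SubstLoop 𝒜) : UnipotentSeries (Unitization K S) := ⟨f.1, f.2.1⟩

theorem toUnipotent_val (f : SubstLoop 𝒜) : (toUnipotent f).1 = f.1 := rfl

theorem toUnipotent_injective : Function.Injective (toUnipotent (𝒜 := 𝒜)) := fun _ _ h =>
  Subtype.ext (congrArg (fun u : UnipotentSeries (Unitization K S) => u.1) h)

theorem toUnipotent_one : toUnipotent (1 : SubstLoop 𝒜) = 1 := rfl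

variable (𝒜) in
/-- The homogeneous components of `K ⊕ S`, with the integers in degree `0`. -/
noncomputable def component (n : ℕ) : AddSubgroup (Unitization K S) :=
  if n = 0 then AddSubgroup.zmultiples 1
  else (𝒜 n).toAddSubgroup.map (Unitization.inrNonUnitalAlgHom K S : S →+ Unitization K S)

theorem mem_component {n : ℕ} (hn : n ≠ 0) {r : Unitization K S} :
    r ∈ component 𝒜 n ↔ ∃ x ∈ 𝒜 n, r = (x : Unitization K S) := by
  rw [component, if_neg hn]
  simp [eq_comm]

theorem coeffsIn_component (f : SubstLoop 𝒜) : CoeffsIn (component 𝒜) f.1 := by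
  intro n
  rcases eq_or_ne n 0 with rfl | hn
  · rw [f.2.1, component, if_pos rfl]
    exact AddSubgroup.mem_zmultiples 1
  · rw [mem_component hn]
    exact f.2.2 n (Nat.one_le_iff_ne_zero.mpr hn)

theorem mem_filtration_iff {i : ℕ} {f : SubstLoop 𝒜} : f ∈ filtration 𝒜 i ↔ EqUpTo i f.1 1 := by
  refine ⟨fun h m hm => ?_, fun h m hm hmi => ?_⟩
  · rcases Nat.eq_zero_or_pos m with rfl | hm0
    · rw [f.2.1, PowerSeries.coeff_one, if_pos rfl]
    · rw [h m hm0 hm, PowerSeries.coeff_one, if_neg (by omega)]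
  · rw [h m hmi, PowerSeries.coeff_one, if_neg (by omega)]

theorem filtration_anti {i j : ℕ} (h : i ≤ j) : filtration 𝒜 j ⊆ filtration 𝒜 i :=
  fun _ hf n hn hni => hf n hn (hni.trans_le h)

theorem filtration_one : filtration 𝒜 1 = Set.univ :=
  Set.eq_univ_of_forall fun _ n hn hn1 => absurd hn1 (by omega)

theorem filtration_eq (i : ℕ) : filtration 𝒜 i = {c | EqUpTo i c.1 (1 : SubstLoop 𝒜).1} :=
  Set.ext fun _ => mem_filtration_iff

theorem coeff_single (i : ℕ) (hi : i ≠ 0) (x : 𝒜 i) :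
    PowerSeries.coeff i (single 𝒜 i x).1 = ((x : S) : Unitization K S) := by
  simp [single, hi]

theorem eqUpTo_single (i : ℕ) (x : 𝒜 i) : EqUpTo i (single 𝒜 i x).1 1 := by
  intro m hm
  simp [single, PowerSeries.coeff_one, hm.ne]

variable [SetLike.GradedMul 𝒜]

/-- Integer multiples of 1 are enough in degree 0, since all constant terms are 1. With this family,
stability of coefficients under division makes the graded series a subloop. -/
instance : SetLike.GradedMonoid (component 𝒜) where
  one_mem := by
    rw [component, if_pos rfl]
    exact AddSubgroup.mem_zmultiples 1
  mul_mem i j a b ha hb := by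
    rcases eq_or_ne i 0 with rfl | hi
    · rw [component, if_pos rfl] at ha
      obtain ⟨z, rfl⟩ := AddSubgroup.mem_zmultiples_iff.mp ha
      rw [zero_add, smul_mul_assoc, one_mul]
      exact zsmul_mem hb z
    rcases eq_or_ne j 0 with rfl | hj
    · rw [component, if_pos rfl] at hb
      obtain ⟨z, rfl⟩ := AddSubgroup.mem_zmultiples_iff.mp hb
      rw [add_zero, mul_smul_comm, mul_one]
      exact zsmul_mem ha z
    · obtain ⟨x, hx, rfl⟩ := (mem_component hi).mp ha
      obtain ⟨y, hy, rfl⟩ := (mem_component hj).mp hb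
      rw [mem_component (by omega)]
      exact ⟨x * y, SetLike.mul_mem_graded hx hy, (Unitization.inr_mul K x y).symm⟩

theorem toUnipotent_mul (f g : SubstLoop 𝒜) :
    toUnipotent (f * g) = toUnipotent f * toUnipotent g := rfl

/-- The converse of `coeffsIn_component`. -/
def ofCoeffsIn (f : UnipotentSeries (Unitization K S)) (hf : CoeffsIn (component 𝒜) f.1) :
    SubstLoop 𝒜 :=
  ⟨f.1, f.2, fun n hn => (mem_component (Nat.one_le_iff_ne_zero.mp hn)).mp (hf n)⟩

theorem isLoop : IsLoop (SubstLoop 𝒜) where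
  one_mul x := toUnipotent_injective (by
    rw [toUnipotent_mul, toUnipotent_one, UnipotentSeries.isLoop.one_mul])
  mul_one x := toUnipotent_injective (by
    rw [toUnipotent_mul, toUnipotent_one, UnipotentSeries.isLoop.mul_one])
  left_bijective f := by
    refine ⟨fun x y (h : f * x = f * y) => toUnipotent_injective
      (UnipotentSeries.eq_of_mul_left (f := toUnipotent f) ?_), fun g => ?_⟩
    · rw [← toUnipotent_mul, h, toUnipotent_mul]
    obtain ⟨x, hx, hx'⟩ := UnipotentSeries.exists_left_solution (toUnipotent f) (toUnipotent g)
    exact ⟨ofCoeffsIn x (hx' _ (coeffsIn_component f) (coeffsIn_component g)),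
      toUnipotent_injective ((toUnipotent_mul _ _).trans hx)⟩
  right_bijective f := by
    refine ⟨fun x y (h : x * f = y * f) => toUnipotent_injective
      (UnipotentSeries.eq_of_mul_right (f := toUnipotent f) ?_), fun g => ?_⟩
    · rw [← toUnipotent_mul, h, toUnipotent_mul]
    obtain ⟨x, hx, hx'⟩ := UnipotentSeries.exists_right_solution (toUnipotent f) (toUnipotent g)
    exact ⟨ofCoeffsIn x (hx' _ (coeffsIn_component f) (coeffsIn_component g)),
      toUnipotent_injective ((toUnipotent_mul _ _).trans hx)⟩

theorem toUnipotent_ldiv (f g : SubstLoop 𝒜) :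
    toUnipotent (loopLDiv f g) = loopLDiv (toUnipotent f) (toUnipotent g) :=
  isLoop.map_ldiv UnipotentSeries.isLoop toUnipotent_mul f g

theorem toUnipotent_rdiv (f g : SubstLoop 𝒜) :
    toUnipotent (loopRDiv f g) = loopRDiv (toUnipotent f) (toUnipotent g) :=
  isLoop.map_rdiv UnipotentSeries.isLoop toUnipotent_mul _ _

theorem toUnipotent_comm (f g : SubstLoop 𝒜) :
    toUnipotent (loopComm f g) = loopComm (toUnipotent f) (toUnipotent g) :=
  toUnipotent_ldiv _ _

theorem toUnipotent_deviation (n : ℕ) (i : (k : Fin n) → Fin ((k : ℕ) + 3))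
    (a : Fin (n + 3) → SubstLoop 𝒜) :
    toUnipotent (loopDeviation n i a) = loopDeviation n i fun j => toUnipotent (a j) :=
  isLoop.map_deviation UnipotentSeries.isLoop toUnipotent_mul n i a

/-- Translations preserve and reflect congruence modulo degree i. Hence every iterated translate of
a term of the filtration is the congruence class of a product, and the conditions for normality
become unit laws. -/
theorem image_mul_left_filtration (x y : SubstLoop 𝒜) (i : ℕ) :
    (fun c => x * c) '' {c | EqUpTo i c.1 y.1} = {z | EqUpTo i z.1 (x * y).1} := by
  ext z
  constructor
  · rintro ⟨c, hc, rfl⟩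
    exact (EqUpTo.refl i x.1).subst hc
  · intro hz
    obtain ⟨c, rfl⟩ := (isLoop.left_bijective x).2 z
    exact ⟨c, eqUpTo_of_substComp_left x.2.1 hz, rfl⟩

theorem image_mul_right_filtration (x y : SubstLoop 𝒜) (i : ℕ) :
    (fun c => c * x) '' {c | EqUpTo i c.1 y.1} = {z | EqUpTo i z.1 (y * x).1} := by
  ext z
  constructor
  · rintro ⟨c, hc, rfl⟩
    exact EqUpTo.subst hc (EqUpTo.refl i x.1)
  · intro hz
    obtain ⟨c, rfl⟩ := (isLoop.right_bijective x).2 z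
    exact ⟨c, eqUpTo_of_substComp_right x.2.1 hz, rfl⟩

theorem isNormalSubloop_filtration (i : ℕ) : IsNormalSubloop (filtration 𝒜 i) where
  one_mem := mem_filtration_iff.mpr (EqUpTo.refl _ _)
  mul_mem a ha b hb := by
    rw [mem_filtration_iff] at *
    have := ha.subst hb
    rwa [substComp_one] at this
  ldiv_mem a ha b hb := by
    rw [mem_filtration_iff] at *
    rw [← toUnipotent_val, toUnipotent_ldiv]
    exact UnipotentSeries.eqUpTo_ldiv (ha.trans hb.symm)
  rdiv_mem a ha b hb := by
    rw [mem_filtration_iff] at *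
    rw [← toUnipotent_val, toUnipotent_rdiv]
    exact UnipotentSeries.eqUpTo_rdiv (hb.trans ha.symm)
  comm_coset x := by
    rw [filtration_eq, image_mul_left_filtration, image_mul_right_filtration, isLoop.mul_one,
      isLoop.one_mul]
  left_coset x y := by
    rw [← Set.image_image (fun c => x * c) (fun c => y * c), filtration_eq,
      image_mul_left_filtration, image_mul_left_filtration, image_mul_left_filtration,
      isLoop.mul_one, isLoop.mul_one]
  right_coset x y := by
    rw [← Set.image_image (fun c => c * y) (fun c => c * x), filtration_eq,
      image_mul_right_filtration, image_mul_right_filtration, image_mul_right_filtration,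
      isLoop.one_mul, isLoop.one_mul]

theorem leftCoset_filtration (a : SubstLoop 𝒜) (i : ℕ) :
    loopLeftCoset a (filtration 𝒜 i) = {z | EqUpTo i z.1 a.1} := by
  have := image_mul_left_filtration a 1 i
  rw [← filtration_eq, isLoop.mul_one] at this
  rw [← this]
  ext z
  simp [loopLeftCoset, eq_comm]

/-- The dictionary between cosets and leading coefficients, through which all statements on induced
operations are proved. -/
theorem mem_ident_iff {i : ℕ} (hi : i ≠ 0) (x : 𝒜 i) (f : SubstLoop 𝒜) :
    f ∈ ident 𝒜 i x ↔ EqUpTo i f.1 1 ∧ PowerSeries.coeff i f.1 = ((x : S) : Unitization K S) := by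
  rw [ident, leftCoset_filtration, Set.mem_ofPred_eq]
  refine ⟨fun h => ⟨(h.mono i.le_succ).trans (eqUpTo_single i x), ?_⟩, fun h m hm => ?_⟩
  · rw [h i i.lt_succ_self, coeff_single i hi]
  · rcases Nat.lt_succ_iff_lt_or_eq.mp hm with hm | rfl
    · exact h.1.trans (eqUpTo_single i x).symm m hm
    · rw [h.2, coeff_single m hi]

theorem bijOn_ident {i : ℕ} (hi : i ≠ 0) :
    Set.BijOn (ident 𝒜 i) Set.univ (loopGr (filtration 𝒜) i) := by
  refine ⟨fun x _ => ⟨single 𝒜 i x, mem_filtration_iff.mpr (eqUpTo_single i x), rfl⟩,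
    fun x _ y _ h => ?_, ?_⟩
  · have hx : single 𝒜 i x ∈ ident 𝒜 i x :=
      (mem_ident_iff hi x _).mpr ⟨eqUpTo_single i x, coeff_single i hi x⟩
    rw [h] at hx
    have := ((mem_ident_iff hi y _).mp hx).2
    rw [coeff_single i hi] at this
    exact Subtype.ext (Unitization.inr_injective this)
  · rintro X ⟨a, ha, rfl⟩
    obtain ⟨x, hx, hx'⟩ := a.2.2 i (Nat.one_le_iff_ne_zero.mpr hi)
    have h : a ∈ ident 𝒜 i ⟨x, hx⟩ := (mem_ident_iff hi _ _).mpr ⟨mem_filtration_iff.mp ha, hx'⟩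
    refine ⟨⟨x, hx⟩, trivial, ?_⟩
    rw [ident, leftCoset_filtration, Set.mem_ofPred_eq] at h
    rw [ident, leftCoset_filtration, leftCoset_filtration]
    exact Set.ext fun z => ⟨fun hz => hz.trans h.symm, fun hz => hz.trans h⟩

theorem mul_mem_ident {i : ℕ} (hi : i ≠ 0) (x y : 𝒜 i) {a b : SubstLoop 𝒜}
    (ha : a ∈ ident 𝒜 i x) (hb : b ∈ ident 𝒜 i y) : a * b ∈ ident 𝒜 i (x + y) := by
  rw [mem_ident_iff hi] at *
  refine ⟨mem_filtration_iff.mp ((isNormalSubloop_filtration i).mul_mem _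
    (mem_filtration_iff.mpr ha.1) _ (mem_filtration_iff.mpr hb.1)), ?_⟩
  change PowerSeries.coeff i (substComp a.1 b.1) = _
  rw [hb.1.coeff_substComp_self hi a.2.1, ha.2, hb.2]
  simp

end SubstLoop

/-! ### Change of the coefficient ring and stability of deviations -/

namespace UnipotentSeries

variable {C D : Type*} [Ring C] [Ring D]

/-- The homomorphism of substitution loops induced by a ring homomorphism. -/
noncomputable def map (φ : C →+* D) (f : UnipotentSeries C) : UnipotentSeries D :=
  ⟨PowerSeries.map φ f.1, by rw [PowerSeries.coeff_map, f.2, map_one]⟩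

theorem coeff_map (φ : C →+* D) (f : UnipotentSeries C) (n : ℕ) :
    PowerSeries.coeff n (map φ f).1 = φ (PowerSeries.coeff n f.1) :=
  PowerSeries.coeff_map _ _ _

theorem map_mul (φ : C →+* D) (f g : UnipotentSeries C) : map φ (f * g) = map φ f * map φ g := by
  refine Subtype.ext (PowerSeries.ext fun n => ?_)
  rw [coeff_map, mul_val, mul_val, coeff_substComp, coeff_substComp, map_sum]
  refine sum_congr rfl fun m _ => ?_
  rw [_root_.map_mul, coeff_map]
  congr 1
  change _ = PowerSeries.coeff _ ((PowerSeries.map φ g.1) ^ _)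
  rw [← map_pow, PowerSeries.coeff_map]

theorem map_deviation (φ : C →+* D) (n : ℕ) (d : (k : Fin n) → Fin ((k : ℕ) + 3))
    (a : Fin (n + 3) → UnipotentSeries C) :
    map φ (loopDeviation n d a) = loopDeviation n d fun j => map φ (a j) :=
  isLoop.map_deviation isLoop (map_mul φ) n d a

theorem coeffsIn_ldiv {V : ℕ → AddSubgroup C} [SetLike.GradedMonoid V] {f g : UnipotentSeries C}
    (hf : CoeffsIn V f.1) (hg : CoeffsIn V g.1) : CoeffsIn V (loopLDiv f g).1 := by
  obtain ⟨x, hx, hx'⟩ := exists_left_solution f g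
  rw [isLoop.ldiv_eq hx]
  exact hx' V hf hg

theorem coeffsIn_deviation {V : ℕ → AddSubgroup C} [SetLike.GradedMonoid V] (n : ℕ)
    (d : (k : Fin n) → Fin ((k : ℕ) + 3)) {a : Fin (n + 3) → UnipotentSeries C}
    (h : ∀ j, CoeffsIn V (a j).1) : CoeffsIn V (loopDeviation n d a).1 :=
  loopDeviation_mem (N := {f : UnipotentSeries C | CoeffsIn V f.1})
    (fun _ ha _ hb => CoeffsIn.subst ha hb) (fun _ ha _ hb => coeffsIn_ldiv ha hb) n d a h

/-- The series `1 + r X^i`. -/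
noncomputable def monomial (i : ℕ) (r : C) : UnipotentSeries C :=
  ⟨PowerSeries.mk fun m => if m = 0 then 1 else if m = i then r else 0, by simp⟩

theorem coeff_monomial (i : ℕ) (r : C) (m : ℕ) :
    PowerSeries.coeff m (monomial i r).1 = if m = 0 then 1 else if m = i then r else 0 := by
  simp only [monomial, PowerSeries.coeff_mk]

end UnipotentSeries

/-! ### Polynomials in central variables over a noncommutative ring -/

namespace MarkedRing

variable {C D : Type*} [Ring C] [Ring D] {ι : Type*} [Fintype ι] [DecidableEq ι]

/-- An additive map out of a monoid algebra that is multiplicative on monomials, as a ring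
homomorphism. -/
def ringHomOfSingle {M : Type*} [AddMonoid M] (ψ : AddMonoidAlgebra C M →+ D)
    (h1 : ψ (AddMonoidAlgebra.single 0 1) = 1)
    (hmul : ∀ μ r ν s, ψ (AddMonoidAlgebra.single (μ + ν) (r * s)) =
      ψ (AddMonoidAlgebra.single μ r) * ψ (AddMonoidAlgebra.single ν s)) :
    AddMonoidAlgebra C M →+* D :=
  { ψ with
    map_one' := by rw [AddMonoidAlgebra.one_def]; exact h1
    map_mul' := fun x y => by
      change ψ (x * y) = ψ x * ψ y
      induction x using AddMonoidAlgebra.induction_linear with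
      | zero => simp
      | add x x' hx hx' => rw [add_mul, map_add, hx, hx', map_add, add_mul]
      | single μ r =>
        induction y using AddMonoidAlgebra.induction_linear with
        | zero => simp
        | add y y' hy hy' => rw [mul_add, map_add, hy, hy', map_add, mul_add]
        | single ν s => rw [AddMonoidAlgebra.single_mul_single, hmul] }

variable (C ι) in
/-- The substitution of `1` for all variables. -/
noncomputable def evalOne : AddMonoidAlgebra C (ι → ℕ) →+* C :=
  AddMonoidAlgebra.liftNCRingHom (RingHom.id C) 1 fun _ _ => Commute.one_right _

theorem evalOne_single (μ : ι → ℕ) (r : C) : evalOne C ι (AddMonoidAlgebra.single μ r) = r := by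
  simp [evalOne]

variable (C) in
/-- The substitution of `0` for the variable `j`. -/
noncomputable def kill (j : ι) : AddMonoidAlgebra C (ι → ℕ) →+* AddMonoidAlgebra C (ι → ℕ) :=
  ringHomOfSingle
    { toFun := fun φ => AddMonoidAlgebra.ofCoeff (φ.coeff.filter fun μ => μ j = 0)
      map_zero' := AddMonoidAlgebra.ext (Finsupp.filter_zero _)
      map_add' := fun x y => AddMonoidAlgebra.ext Finsupp.filter_add }
    (by
      change AddMonoidAlgebra.ofCoeff _ = _
      rw [AddMonoidAlgebra.coeff_single,
        Finsupp.filter_single_of_pos (fun μ : ι → ℕ => μ j = 0) rfl]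
      rfl)
    fun μ r ν s => by
      have h : ∀ (μ : ι → ℕ) (r : C), AddMonoidAlgebra.ofCoeff
          ((AddMonoidAlgebra.single μ r).coeff.filter fun μ => μ j = 0) =
            if μ j = 0 then AddMonoidAlgebra.single μ r else 0 := by
        intro μ r
        split_ifs with h
        · rw [AddMonoidAlgebra.coeff_single, Finsupp.filter_single_of_pos (fun μ : ι → ℕ => μ j = 0) h]
          rfl
        · rw [AddMonoidAlgebra.coeff_single, Finsupp.filter_single_of_neg (fun μ : ι → ℕ => μ j = 0) h]
          rfl
      change AddMonoidAlgebra.ofCoeff _ = AddMonoidAlgebra.ofCoeff _ * AddMonoidAlgebra.ofCoeff _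
      rw [h, h, h]
      by_cases h1 : μ j = 0 <;> by_cases h2 : ν j = 0 <;>
        simp [h1, h2, AddMonoidAlgebra.single_mul_single]

theorem coeff_kill (j : ι) (φ : AddMonoidAlgebra C (ι → ℕ)) {μ : ι → ℕ} (hμ : μ j = 0) :
    (kill C j φ).coeff μ = φ.coeff μ :=
  Finsupp.filter_apply_pos _ _ hμ

theorem kill_single_of_ne (j : ι) {μ : ι → ℕ} (hμ : μ j ≠ 0) (r : C) :
    kill C j (AddMonoidAlgebra.single μ r) = 0 := by
  change AddMonoidAlgebra.ofCoeff _ = _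
  rw [AddMonoidAlgebra.coeff_single, Finsupp.filter_single_of_neg (fun μ : ι → ℕ => μ j = 0) hμ]
  rfl

/-- The least degree of a product of coefficients, the `t`-th one of which is marked `μ t` times:
the coefficients of the `t`-th factor have degree at least `i t` if marked once, and more than that
if marked twice. -/
def weight (i μ : ι → ℕ) : ℕ := ∑ t, if μ t = 0 then 0 else if μ t = 1 then i t else i t + 1

theorem weight_zero (i : ι → ℕ) : weight i 0 = 0 := by simp [weight]

theorem weight_single_one (i : ι → ℕ) (t : ι) : weight i (Pi.single t 1) = i t := by
  rw [weight, sum_eq_single t]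
  · simp
  · intro s _ hs
    simp [Pi.single_eq_of_ne hs]
  · simp

theorem weight_single_two (i : ι → ℕ) (t : ι) : weight i (Pi.single t 2) = i t + 1 := by
  rw [weight, sum_eq_single t]
  · simp
  · intro s _ hs
    simp [Pi.single_eq_of_ne hs]
  · simp

/-- The critical case is a variable that occurs once in each factor: then i t + 1 ≤ 2 i t, which is
where i t ≥ 1 enters. -/
theorem weight_add_le {i : ι → ℕ} (hi : ∀ t, 1 ≤ i t) (μ ν : ι → ℕ) :
    weight i (μ + ν) ≤ weight i μ + weight i ν := by
  simp only [weight, ← sum_add_distrib, Pi.add_apply]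
  refine sum_le_sum fun t _ => ?_
  have := hi t
  split_ifs <;> omega

theorem sum_le_weight {i μ : ι → ℕ} (hμ : ∀ t, μ t ≠ 0) : ∑ t, i t ≤ weight i μ := by
  refine sum_le_sum fun t _ => ?_
  have := hμ t
  split_ifs <;> omega

theorem eq_one_of_weight_le {i μ : ι → ℕ} (hμ : ∀ t, μ t ≠ 0) (h : weight i μ ≤ ∑ t, i t) :
    μ = 1 := by
  by_contra hne
  obtain ⟨t, ht⟩ := Function.ne_iff.mp hne
  refine absurd h (not_le.mpr (sum_lt_sum (fun t _ => ?_) ⟨t, mem_univ _, ?_⟩))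
  · have := hμ t
    split_ifs <;> omega
  · rw [if_neg (hμ t), if_neg (show ¬ μ t = 1 from ht)]
    exact Nat.lt_succ_self _

variable (C) in
/-- The polynomials of weight at most `k`. -/
def weightLE (i : ι → ℕ) (k : ℕ) : AddSubgroup (AddMonoidAlgebra C (ι → ℕ)) where
  carrier := {φ | ∀ μ, k < weight i μ → φ.coeff μ = 0}
  zero_mem' := fun _ _ => rfl
  add_mem' := fun {x y} hx hy μ h => by
    rw [AddMonoidAlgebra.coeff_add, Finsupp.add_apply, hx μ h, hy μ h, add_zero]
  neg_mem' := fun {x} hx μ h => by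
    rw [AddMonoidAlgebra.coeff_neg, Finsupp.neg_apply, hx μ h, neg_zero]

theorem single_mem_weightLE {i μ : ι → ℕ} {k : ℕ} (h : weight i μ ≤ k) (r : C) :
    AddMonoidAlgebra.single μ r ∈ weightLE C i k := by
  intro ν hν
  rw [AddMonoidAlgebra.coeff_single, Finsupp.single_apply, if_neg]
  rintro rfl
  omega

/-- Subadditivity of the weight. It follows that in a deviation of marked series the coefficient of
degree k has weight at most k. -/
theorem gradedMonoid_weightLE {i : ι → ℕ} (hi : ∀ t, 1 ≤ i t) :
    SetLike.GradedMonoid (weightLE C i) where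
  one_mem := by
    rw [AddMonoidAlgebra.one_def]
    exact single_mem_weightLE (weight_zero i).le 1
  mul_mem k l φ ψ hφ hψ μ hμ := by
    classical
    rw [AddMonoidAlgebra.coeff_mul]
    refine sum_eq_zero fun μ₁ _ => sum_eq_zero fun μ₂ _ => ?_
    dsimp only
    split_ifs with h
    · subst h
      have := weight_add_le hi μ₁ μ₂
      rcases lt_or_ge k (weight i μ₁) with h1 | h1
      · rw [hφ _ h1, zero_mul]
      · rw [hψ _ (by omega), mul_zero]
    · rfl

/-- The series `f` with the coefficient in degree `i` marked once by the variable `t`, and all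
further coefficients marked twice. -/
noncomputable def mark (i : ℕ) (t : ι) (f : UnipotentSeries C) :
    UnipotentSeries (AddMonoidAlgebra C (ι → ℕ)) :=
  ⟨PowerSeries.mk fun m => if m = 0 then 1 else if m = i then
      AddMonoidAlgebra.single (Pi.single t 1) (PowerSeries.coeff m f.1)
    else AddMonoidAlgebra.single (Pi.single t 2) (PowerSeries.coeff m f.1), by simp⟩

theorem coeff_mark (i : ℕ) (t : ι) (f : UnipotentSeries C) (m : ℕ) :
    PowerSeries.coeff m (mark i t f).1 = if m = 0 then 1 else if m = i then
      AddMonoidAlgebra.single (Pi.single t 1) (PowerSeries.coeff m f.1)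
    else AddMonoidAlgebra.single (Pi.single t 2) (PowerSeries.coeff m f.1) := by
  simp only [mark, PowerSeries.coeff_mk]

theorem map_evalOne_mark (i : ℕ) (t : ι) (f : UnipotentSeries C) :
    UnipotentSeries.map (evalOne C ι) (mark i t f) = f := by
  refine Subtype.ext (PowerSeries.ext fun m => ?_)
  rw [UnipotentSeries.coeff_map, coeff_mark]
  split_ifs with h
  · rw [h, f.2, map_one]
  · rw [evalOne_single]
  · rw [evalOne_single]

theorem map_kill_mark (i : ℕ) (t : ι) (f : UnipotentSeries C) :
    UnipotentSeries.map (kill C t) (mark i t f) = 1 := by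
  refine Subtype.ext (PowerSeries.ext fun m => ?_)
  rw [UnipotentSeries.coeff_map, coeff_mark, UnipotentSeries.one_val, PowerSeries.coeff_one]
  split_ifs with h
  · rw [map_one]
  · rw [kill_single_of_ne _ (by simp)]
  · rw [kill_single_of_ne _ (by simp)]

theorem coeffsIn_mark {i : ι → ℕ} (t : ι) {f : UnipotentSeries C} (hf : EqUpTo (i t) f.1 1) :
    CoeffsIn (weightLE C i) (mark (i t) t f).1 := by
  intro m
  rw [coeff_mark]
  split_ifs with h0 h
  · rw [AddMonoidAlgebra.one_def]
    exact single_mem_weightLE (by simp [weight_zero]) 1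
  · exact single_mem_weightLE (by rw [weight_single_one, h]) _
  · rcases lt_or_ge m (i t) with h1 | h1
    · rw [hf m h1, PowerSeries.coeff_one, if_neg h0, AddMonoidAlgebra.single_zero]
      exact zero_mem _
    · exact single_mem_weightLE (by rw [weight_single_two]; omega) _

/-! ### The multilinear part -/

/-- The exponent of the product of the variables in `T`. -/
def indicator (T : Finset ι) : ι → ℕ := fun t => if t ∈ T then 1 else 0

theorem indicator_injective : Function.Injective (indicator (ι := ι)) := fun T U h => by
  ext t
  have := congrFun h t
  simp only [indicator] at this
  split_ifs at this with h1 h2 h2 <;> simp_all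

theorem indicator_sdiff_add {U W V : Finset ι} (h1 : U ⊆ W) (h2 : W ⊆ V) :
    indicator (W \ U) + indicator (V \ W) = indicator (V \ U) := by
  funext t
  have := @h1 t
  have := @h2 t
  simp only [Pi.add_apply, indicator, mem_sdiff]
  by_cases a : t ∈ U <;> by_cases b : t ∈ W <;> by_cases c : t ∈ V <;> simp_all

variable (C ι) in
/-- The truncation of polynomials modulo the squares of the variables, represented on the
incidence algebra of the lattice of sets of variables: the product of the variables in `T` acts by
adjoining `T`. -/
noncomputable def squarefree :
    AddMonoidAlgebra C (ι → ℕ) →+* IncidenceAlgebra C (Finset ι) :=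
  ringHomOfSingle
    { toFun := fun φ =>
        { toFun := fun U V => if U ≤ V then φ.coeff (indicator (V \ U)) else 0
          eq_zero_of_not_le' := fun U V h => if_neg h }
      map_zero' := by ext; simp
      map_add' := fun x y => by
        ext U V
        change (if U ≤ V then (x + y).coeff _ else 0) =
          (if U ≤ V then x.coeff _ else 0) + (if U ≤ V then y.coeff _ else 0)
        split_ifs
        simp }
    (by
      ext U V
      rw [IncidenceAlgebra.one_apply]
      change (if U ≤ V then (AddMonoidAlgebra.single 0 (1 : C)).coeff _ else 0) = _
      rw [AddMonoidAlgebra.coeff_single, Finsupp.single_apply]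
      by_cases h : U = V
      · subst h
        simp [indicator, funext_iff]
      · rw [if_neg h]
        by_cases h1 : U ≤ V
        · rw [if_pos h1, if_neg]
          intro h2
          have h3 : indicator (∅ : Finset ι) = indicator (V \ U) := by
            rw [← h2]; funext; simp [indicator]
          have h4 := indicator_injective h3
          exact absurd (Subset.antisymm h1 (sdiff_eq_empty_iff_subset.mp h4.symm)) h
        · rw [if_neg h1])
    fun μ r ν s => by
      ext U V
      rw [IncidenceAlgebra.mul_apply]
      change (if U ≤ V then (AddMonoidAlgebra.single (μ + ν) (r * s)).coeff _ else 0) =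
        ∑ W ∈ Icc U V, (if U ≤ W then (AddMonoidAlgebra.single μ r).coeff _ else 0) *
          (if W ≤ V then (AddMonoidAlgebra.single ν s).coeff _ else 0)
      simp only [AddMonoidAlgebra.coeff_single, Finsupp.single_apply]
      have hsum : ∀ W ∈ Icc U V,
          ((if U ≤ W then (if μ = indicator (W \ U) then r else 0) else 0) *
            (if W ≤ V then (if ν = indicator (V \ W) then s else 0) else 0)) =
          if μ = indicator (W \ U) ∧ ν = indicator (V \ W) then r * s else 0 := by
        intro W hW
        rw [mem_Icc] at hW
        rw [if_pos hW.1, if_pos hW.2, ite_and, ite_mul, zero_mul, mul_ite, mul_zero]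
      rw [sum_congr rfl hsum]
      by_cases h1 : U ≤ V
      swap
      · rw [Icc_eq_empty h1, sum_empty, if_neg h1]
      rw [if_pos h1]
      by_cases h2 : μ + ν = indicator (V \ U)
      · have key : ∀ t, μ t + ν t = if t ∈ V ∧ t ∉ U then 1 else 0 := fun t => by
          have := congrFun h2 t
          simpa only [Pi.add_apply, indicator, mem_sdiff] using this
        -- The supports of μ and ν are disjoint with union V \ U. So there is exactly one
        -- intermediate set, namely U with the variables of μ adjoined.
        have hW : μ = indicator ((U ∪ univ.filter fun t => μ t ≠ 0) \ U) ∧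
            ν = indicator (V \ (U ∪ univ.filter fun t => μ t ≠ 0)) := by
          constructor <;> funext t <;> have hk := key t <;>
            simp only [indicator, mem_sdiff, mem_union, mem_filter, mem_univ, true_and] <;> grind
        rw [if_pos h2, sum_eq_single (U ∪ univ.filter fun t => μ t ≠ 0), if_pos hW]
        · intro W hW' hne
          refine if_neg fun h => hne ?_
          rw [mem_Icc] at hW'
          have h3 := indicator_injective (h.1.symm.trans hW.1)
          ext t
          have h4 := congrArg (t ∈ ·) h3
          have := @hW'.1 t
          simp only [mem_sdiff, mem_union, eq_iff_iff] at h4 ⊢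
          tauto
        · intro h
          refine absurd (mem_Icc.mpr ⟨subset_union_left, union_subset h1 fun t ht => ?_⟩) h
          rw [mem_filter] at ht
          by_contra hV
          have := key t
          rw [if_neg (fun h => hV h.1)] at this
          omega
      · rw [if_neg h2]
        refine (sum_eq_zero fun W hW => if_neg fun h => h2 ?_).symm
        rw [mem_Icc] at hW
        rw [h.1, h.2, indicator_sdiff_add hW.1 hW.2]

theorem squarefree_apply (φ : AddMonoidAlgebra C (ι → ℕ)) (U V : Finset ι) :
    squarefree C ι φ U V = if U ≤ V then φ.coeff (indicator (V \ U)) else 0 := rfl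

variable (C) in
/-- The image of `r` times the variable `t` in the incidence algebra. -/
noncomputable def nilp (t : ι) (r : C) : IncidenceAlgebra C (Finset ι) :=
  squarefree C ι (AddMonoidAlgebra.single (Pi.single t 1) r)

theorem nilp_apply (t : ι) (r : C) (U V : Finset ι) :
    nilp C t r U V = if U ≤ V ∧ V \ U = {t} then r else 0 := by
  rw [nilp, squarefree_apply, AddMonoidAlgebra.coeff_single, Finsupp.single_apply, ite_and]
  have h : (Pi.single t 1 : ι → ℕ) = indicator {t} := by
    funext s
    simp [indicator, Pi.single_apply]
  simp only [h, indicator_injective.eq_iff, eq_comm]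

theorem squarefree_single_two (t : ι) (r : C) :
    squarefree C ι (AddMonoidAlgebra.single (Pi.single t 2) r) = 0 := by
  ext U V
  have h : (Pi.single t 2 : ι → ℕ) ≠ indicator (V \ U) := fun h => by
    have := congrFun h t
    simp only [Pi.single_eq_same, indicator] at this
    split_ifs at this
    omega
  rw [squarefree_apply, AddMonoidAlgebra.coeff_single, Finsupp.single_apply, if_neg h]
  simp

theorem map_squarefree_mark (i : ℕ) (t : ι) (f : UnipotentSeries C) :
    UnipotentSeries.map (squarefree C ι) (mark i t f) =
      UnipotentSeries.monomial i (nilp C t (PowerSeries.coeff i f.1)) := by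
  refine Subtype.ext (PowerSeries.ext fun m => ?_)
  rw [UnipotentSeries.coeff_map, coeff_mark, UnipotentSeries.coeff_monomial]
  split_ifs with h0 h
  · rw [map_one]
  · rw [h, nilp]
  · rw [squarefree_single_two]

/-- Monomials without the variable t survive the substitution of 0 for it. But this substitution
turns the t-th argument into 1, and with it the whole deviation. -/
theorem coeff_mark_deviation {n : ℕ} (d : (k : Fin n) → Fin ((k : ℕ) + 3)) {i : Fin (n + 3) → ℕ}
    (a : Fin (n + 3) → UnipotentSeries C) {k : ℕ} (hk : k ≠ 0) (μ : Fin (n + 3) → ℕ)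
    (hμ : ∃ t, μ t = 0) :
    (PowerSeries.coeff k (loopDeviation n d fun t => mark (i t) t (a t)).1).coeff μ = 0 := by
  obtain ⟨t, ht⟩ := hμ
  rw [← coeff_kill t _ ht, ← UnipotentSeries.coeff_map, UnipotentSeries.map_deviation,
    UnipotentSeries.isLoop.deviation_eq_one n d _ t (map_kill_mark _ _ _),
    UnipotentSeries.one_val, PowerSeries.coeff_one, if_neg hk]
  rfl

/-- A deviation of series in the terms of the filtration lies in the term whose number is the sum
of the numbers of the arguments. -/
theorem eqUpTo_deviation {n : ℕ} (d : (k : Fin n) → Fin ((k : ℕ) + 3)) {i : Fin (n + 3) → ℕ}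
    (hi : ∀ t, 1 ≤ i t) {a : Fin (n + 3) → UnipotentSeries C}
    (ha : ∀ t, EqUpTo (i t) (a t).1 1) : EqUpTo (∑ t, i t) (loopDeviation n d a).1 1 := by
  intro k hk
  rcases eq_or_ne k 0 with rfl | hk0
  · rw [(loopDeviation n d a).2, PowerSeries.coeff_one, if_pos rfl]
  have := gradedMonoid_weightLE (C := C) hi
  -- Monomials lacking a variable have coefficient 0. Those containing all of them have weight at
  -- least `∑ t, i t`, more than the degree allows.
  have h0 : PowerSeries.coeff k (loopDeviation n d fun t => mark (i t) t (a t)).1 = 0 := by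
    refine AddMonoidAlgebra.ext (Finsupp.ext fun μ => ?_)
    by_cases hμ : ∃ t, μ t = 0
    · exact coeff_mark_deviation d a hk0 μ hμ
    · push Not at hμ
      exact UnipotentSeries.coeffsIn_deviation n d (fun t => coeffsIn_mark t (ha t)) k μ
        (hk.trans_le (sum_le_weight hμ))
  have h1 := UnipotentSeries.coeff_map (evalOne C _)
    (loopDeviation n d fun t => mark (i t) t (a t)) k
  rw [UnipotentSeries.map_deviation, h0, map_zero] at h1
  simp only [map_evalOne_mark] at h1
  rw [h1, PowerSeries.coeff_one, if_neg hk0]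

/-- The leading coefficient of a deviation is the multilinear part of the deviation of the leading
terms. -/
theorem coeff_deviation {n : ℕ} (d : (k : Fin n) → Fin ((k : ℕ) + 3)) {i : Fin (n + 3) → ℕ}
    (hi : ∀ t, 1 ≤ i t) {a : Fin (n + 3) → UnipotentSeries C}
    (ha : ∀ t, EqUpTo (i t) (a t).1 1) :
    PowerSeries.coeff (∑ t, i t) (loopDeviation n d a).1 =
      PowerSeries.coeff (∑ t, i t) (loopDeviation n d fun t =>
        UnipotentSeries.monomial (i t) (nilp C t (PowerSeries.coeff (i t) (a t).1))).1 ∅ univ := by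
  have := gradedMonoid_weightLE (C := C) hi
  have hk0 : ∑ t, i t ≠ 0 := by
    have := single_le_sum (f := i) (fun t _ => Nat.zero_le _) (mem_univ 0)
    have := hi 0
    omega
  set φ := PowerSeries.coeff (∑ t, i t) (loopDeviation n d fun t => mark (i t) t (a t)).1 with hφ
  -- The exponent `1` is one in every variable: it is the only exponent without zeros whose weight
  -- does not exceed the degree.
  have h0 : φ = AddMonoidAlgebra.single 1 (φ.coeff 1) := by
    refine AddMonoidAlgebra.ext (Finsupp.ext fun μ => ?_)
    rw [AddMonoidAlgebra.coeff_single, Finsupp.single_apply]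
    split_ifs with h
    · rw [h]
    · by_cases hμ : ∃ t, μ t = 0
      · exact coeff_mark_deviation d a hk0 μ hμ
      · push Not at hμ
        refine UnipotentSeries.coeffsIn_deviation n d (fun t => coeffsIn_mark t (ha t)) _ μ
          (not_le.mp fun hle => h (eq_one_of_weight_le hμ hle).symm)
  -- On a multiple of the product of all variables, the substitution of 1 and the entry of the
  -- incidence matrix from `∅` to `univ` read off the same coefficient.
  have h1 := UnipotentSeries.coeff_map (evalOne C _)
    (loopDeviation n d fun t => mark (i t) t (a t)) (∑ t, i t)
  have h2 := UnipotentSeries.coeff_map (squarefree C _)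
    (loopDeviation n d fun t => mark (i t) t (a t)) (∑ t, i t)
  rw [UnipotentSeries.map_deviation, ← hφ] at h1 h2
  simp only [map_evalOne_mark, map_squarefree_mark] at h1 h2
  rw [h1, h2, squarefree_apply, if_pos (empty_subset _), h0, evalOne_single]
  have h3 : indicator (univ \ ∅ : Finset (Fin (n + 3))) = 1 := by
    funext t
    simp [indicator]
  rw [h3, AddMonoidAlgebra.coeff_single, Finsupp.single_eq_same]

end MarkedRing

/-! ### Deviations of series with square zero -/

section SquareZero

variable {C : Type*} [Ring C]

/-- The operator multiplying the coefficient in degree `m` by `m + 1`. -/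
noncomputable def succDeg (f : PowerSeries C) : PowerSeries C :=
  PowerSeries.mk fun m => (m + 1) • PowerSeries.coeff m f

/-- The operator multiplying the coefficient in degree `m` by `(m + 1).choose 2`. -/
noncomputable def chooseDeg (f : PowerSeries C) : PowerSeries C :=
  PowerSeries.mk fun m => (m + 1).choose 2 • PowerSeries.coeff m f

theorem coeff_succDeg (f : PowerSeries C) (m : ℕ) :
    PowerSeries.coeff m (succDeg f) = (m + 1) • PowerSeries.coeff m f :=
  PowerSeries.coeff_mk _ _

theorem coeff_chooseDeg (f : PowerSeries C) (m : ℕ) :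
    PowerSeries.coeff m (chooseDeg f) = (m + 1).choose 2 • PowerSeries.coeff m f :=
  PowerSeries.coeff_mk _ _

theorem succDeg_add (f g : PowerSeries C) : succDeg (f + g) = succDeg f + succDeg g := by
  ext m
  simp only [coeff_succDeg, map_add, smul_add]

theorem succDeg_one : succDeg (1 : PowerSeries C) = 1 := by
  ext m
  rw [coeff_succDeg, PowerSeries.coeff_one]
  split_ifs with h <;> simp [h]

/-- `succDeg` is the Euler derivation plus the identity, so the Leibniz rule acquires a correction
by f g. -/
theorem succDeg_mul (f g : PowerSeries C) :
    succDeg (f * g) = succDeg f * g + f * succDeg g - f * g := by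
  ext m
  simp only [coeff_succDeg, map_sub, map_add, PowerSeries.coeff_mul, ← sum_add_distrib,
    ← sum_sub_distrib, smul_sum, smul_mul_assoc, mul_smul_comm]
  refine sum_congr rfl fun p hp => ?_
  rw [← mem_antidiagonal.mp hp, ← add_smul, eq_sub_iff_add_eq, ← succ_nsmul]
  congr 1
  omega

/-- In degree m this is (m+1)² = (m+1) + 2 · C(m+1, 2). -/
theorem succDeg_succDeg (f : PowerSeries C) :
    succDeg (succDeg f) = succDeg f + chooseDeg f + chooseDeg f := by
  ext m
  simp only [coeff_succDeg, coeff_chooseDeg, map_add, ← add_smul, smul_smul]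
  congr 1
  have h := Nat.triangle_succ m
  rw [Nat.choose_two_right, Nat.add_sub_cancel]
  have h2 : 2 ∣ (m + 1) * m := by
    rw [mul_comm]
    exact (Nat.even_mul_succ_self m).two_dvd
  obtain ⟨c, hc⟩ := h2
  rw [hc, Nat.mul_div_cancel_left _ two_pos]
  linarith

/-- The coefficient f_m is multiplied by g^(m+1), which brings in the factors m + 1 and C(m+1, 2).
-/
theorem substComp_eq_of_pow_eq {f g ξ θ : PowerSeries C}
    (h : ∀ m, g ^ m = 1 + m • ξ + m.choose 2 • θ) :
    substComp f g = f + succDeg f * ξ + chooseDeg f * θ := by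
  ext k
  rw [coeff_substComp, map_add, map_add, PowerSeries.coeff_mul, PowerSeries.coeff_mul,
    Nat.sum_antidiagonal_eq_sum_range_succ
      (fun i j => PowerSeries.coeff i (succDeg f) * PowerSeries.coeff j ξ),
    Nat.sum_antidiagonal_eq_sum_range_succ
      (fun i j => PowerSeries.coeff i (chooseDeg f) * PowerSeries.coeff j θ)]
  simp only [h, map_add, mul_add, sum_add_distrib, map_nsmul, coeff_succDeg, coeff_chooseDeg,
    mul_smul_comm, smul_mul_assoc]
  congr 2
  rw [sum_range_succ, sum_eq_zero fun m hm => ?_]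
  · simp
  · have := mem_range.mp hm
    rw [PowerSeries.coeff_one, if_neg (by omega), mul_zero]

theorem one_add_pow_eq {ξ θ : PowerSeries C} (h2 : ξ * ξ = θ) (h3 : θ * ξ = 0) (m : ℕ) :
    (1 + ξ) ^ m = 1 + m • ξ + m.choose 2 • θ := by
  induction m with
  | zero => simp
  | succ m ih =>
    rw [pow_succ, ih, Nat.choose_succ_succ' m 1, Nat.choose_one_right]
    simp only [mul_add, add_mul, smul_mul_assoc, h2, h3, mul_one, one_mul, smul_zero, add_smul,
      one_smul]
    abel

/-- A two-sided ideal with square zero. -/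
structure IsSquareZeroIdeal (N : AddSubgroup C) : Prop where
  mul_mem_left : ∀ a, ∀ x ∈ N, a * x ∈ N
  mul_mem_right : ∀ x ∈ N, ∀ a, x * a ∈ N
  mul_eq_zero : ∀ x ∈ N, ∀ y ∈ N, x * y = 0

namespace IsSquareZeroIdeal

variable {N N' : AddSubgroup C}

theorem coeffsIn_mul_left (hN : IsSquareZeroIdeal N) (f : PowerSeries C) {g : PowerSeries C}
    (hg : CoeffsIn (fun _ => N) g) : CoeffsIn (fun _ => N) (f * g) := fun n => by
  rw [PowerSeries.coeff_mul]
  exact sum_mem fun p _ => hN.mul_mem_left _ _ (hg _)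

theorem coeffsIn_mul_right (hN : IsSquareZeroIdeal N) {f : PowerSeries C}
    (hf : CoeffsIn (fun _ => N) f) (g : PowerSeries C) : CoeffsIn (fun _ => N) (f * g) :=
  fun n => by
    rw [PowerSeries.coeff_mul]
    exact sum_mem fun p _ => hN.mul_mem_right _ (hf _) _

theorem series_mul_eq_zero (hN : IsSquareZeroIdeal N) {f g : PowerSeries C}
    (hf : CoeffsIn (fun _ => N) f) (hg : CoeffsIn (fun _ => N) g) : f * g = 0 := by
  ext n
  rw [PowerSeries.coeff_mul, map_zero]
  exact sum_eq_zero fun p _ => hN.mul_eq_zero _ (hf _) _ (hg _)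

theorem coeffsIn_succDeg {f : PowerSeries C} (hf : CoeffsIn (fun _ => N) f) :
    CoeffsIn (fun _ => N) (succDeg f) := fun n => by
  rw [coeff_succDeg]
  exact nsmul_mem (hf n) _

theorem substComp_one_add (hN : IsSquareZeroIdeal N) (f : PowerSeries C) {ξ : PowerSeries C}
    (hξ : CoeffsIn (fun _ => N) ξ) : substComp f (1 + ξ) = f + succDeg f * ξ := by
  rw [substComp_eq_of_pow_eq (θ := 0)
    (one_add_pow_eq (hN.series_mul_eq_zero hξ hξ) (zero_mul _)), mul_zero, add_zero]

/-- Write s and c for `succDeg` and `chooseDeg`. With ξ = η + ζ + s(η)ζ one has ξ² = ηζ + ζη and ξ³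
= 0, so f ∘ ((1+η) ∘ (1+ζ)) = f + s(f)ξ + c(f)(ηζ + ζη). The other bracketing is f + s(f)η + s(f +
s(f)η)ζ, where s(s(f)η) = 2c(f)η + s(f)s(η). The difference is c(f)(ηζ - ζη) = s(f)H(ηζ - ζη),
exactly what the right factor adds, because its products with all terms in η or ζ vanish. -/
theorem substComp_substComp (hN : IsSquareZeroIdeal N) (hN' : IsSquareZeroIdeal N')
    {f H η ζ : PowerSeries C} (hη : CoeffsIn (fun _ => N) η) (hζ : CoeffsIn (fun _ => N') ζ)
    (hH : succDeg f * H = chooseDeg f) :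
    substComp (substComp f (substComp (1 + η) (1 + ζ))) (1 + H * (η * ζ - ζ * η)) =
      substComp (substComp f (1 + η)) (1 + ζ) := by
  have hδ : CoeffsIn (fun _ => N) (H * (η * ζ - ζ * η)) :=
    hN.coeffsIn_mul_left _ ((hN.coeffsIn_mul_right hη _).sub (hN.coeffsIn_mul_left _ hη))
  have hδ' : CoeffsIn (fun _ => N') (H * (η * ζ - ζ * η)) :=
    hN'.coeffsIn_mul_left _ ((hN'.coeffsIn_mul_left _ hζ).sub (hN'.coeffsIn_mul_right hζ _))
  have h1 : substComp (1 + η) (1 + ζ) = 1 + (η + ζ + succDeg η * ζ) := by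
    rw [hN'.substComp_one_add _ hζ, succDeg_add, succDeg_one, add_mul, one_mul]
    abel
  have hηη : η * η = 0 := hN.series_mul_eq_zero hη hη
  have hζζ : ζ * ζ = 0 := hN'.series_mul_eq_zero hζ hζ
  have h2 : (η + ζ + succDeg η * ζ) * (η + ζ + succDeg η * ζ) = η * ζ + ζ * η := by
    have a1 : η * (succDeg η * ζ) = 0 := by
      rw [← mul_assoc, hN.series_mul_eq_zero hη (coeffsIn_succDeg hη), zero_mul]
    have a2 : ζ * (succDeg η * ζ) = 0 :=
      hN'.series_mul_eq_zero hζ (hN'.coeffsIn_mul_left _ hζ)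
    have a3 : succDeg η * ζ * η = 0 :=
      hN.series_mul_eq_zero (hN.coeffsIn_mul_right (coeffsIn_succDeg hη) _) hη
    have a4 : succDeg η * ζ * ζ = 0 := by rw [mul_assoc, hζζ, mul_zero]
    have a5 : succDeg η * ζ * (succDeg η * ζ) = 0 := by rw [mul_assoc, a2, mul_zero]
    simp only [add_mul, mul_add, hηη, hζζ, a1, a2, a3, a4, a5]
    abel
  have h3 : (η * ζ + ζ * η) * (η + ζ + succDeg η * ζ) = 0 := by
    have a1 : CoeffsIn (fun _ => N) (η * ζ + ζ * η) :=
      (hN.coeffsIn_mul_right hη _).add (hN.coeffsIn_mul_left _ hη)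
    have a2 : CoeffsIn (fun _ => N') (η * ζ + ζ * η) :=
      (hN'.coeffsIn_mul_left _ hζ).add (hN'.coeffsIn_mul_right hζ _)
    rw [mul_add, mul_add, hN.series_mul_eq_zero a1 hη, hN'.series_mul_eq_zero a2 hζ,
      hN'.series_mul_eq_zero a2 (hN'.coeffsIn_mul_left _ hζ), add_zero, add_zero]
  have h4 : ∀ θ : PowerSeries C, CoeffsIn (fun _ => N) θ →
      succDeg θ * (H * (η * ζ - ζ * η)) = 0 := fun θ hθ =>
    hN.series_mul_eq_zero (coeffsIn_succDeg hθ) hδ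
  have h5 : ∀ θ : PowerSeries C, CoeffsIn (fun _ => N') θ →
      succDeg θ * (H * (η * ζ - ζ * η)) = 0 := fun θ hθ =>
    hN'.series_mul_eq_zero (coeffsIn_succDeg hθ) hδ'
  rw [h1, substComp_eq_of_pow_eq (one_add_pow_eq h2 h3), hN.substComp_one_add _ hδ,
    hN'.substComp_one_add _ hζ, hN.substComp_one_add _ hη]
  simp only [succDeg_add, mul_add, add_mul]
  rw [h4 _ (hN.coeffsIn_mul_left _ hη), h5 _ (hN'.coeffsIn_mul_left _ hζ),
    h5 _ (hN'.coeffsIn_mul_left _ (hN'.coeffsIn_mul_left _ hζ)),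
    h4 _ (hN.coeffsIn_mul_left _ (hN.coeffsIn_mul_right hη _)),
    h4 _ (hN.coeffsIn_mul_left _ (hN.coeffsIn_mul_left _ hη)), ← mul_assoc (succDeg f) H, hH,
    succDeg_mul, succDeg_succDeg]
  noncomm_ring

variable {y z : UnipotentSeries C}

theorem assoc_val (hN : IsSquareZeroIdeal N) (hN' : IsSquareZeroIdeal N')
    (hy : CoeffsIn (fun _ => N) (y.1 - 1)) (hz : CoeffsIn (fun _ => N') (z.1 - 1))
    (f : UnipotentSeries C) {H : PowerSeries C} (hH : succDeg f.1 * H = chooseDeg f.1) :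
    (loopAssoc f y z).1 =
      1 + H * ((y.1 - 1) * (z.1 - 1) - (z.1 - 1) * (y.1 - 1)) := by
  have h0 : PowerSeries.coeff 0
      (1 + H * ((y.1 - 1) * (z.1 - 1) - (z.1 - 1) * (y.1 - 1))) = 1 := by
    have := y.2
    have := z.2
    simp_all
  have h1 : loopAssoc f y z = ⟨_, h0⟩ := by
    refine UnipotentSeries.isLoop.ldiv_eq (UnipotentSeries.ext ?_)
    have := hN.substComp_substComp hN' hy hz hH
    rwa [add_sub_cancel, add_sub_cancel] at this
  rw [h1]

theorem exists_succDeg_mul_eq (f : UnipotentSeries C) :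
    ∃ H : PowerSeries C, succDeg f.1 * H = chooseDeg f.1 := by
  refine ⟨PowerSeries.invOfUnit (succDeg f.1) 1 * chooseDeg f.1, ?_⟩
  rw [← mul_assoc, PowerSeries.mul_invOfUnit, one_mul]
  rw [← PowerSeries.coeff_zero_eq_constantCoeff_apply, coeff_succDeg, f.2]
  simp

theorem coeffsIn_assoc_sub_one (hN : IsSquareZeroIdeal N) (hN' : IsSquareZeroIdeal N')
    (hy : CoeffsIn (fun _ => N) (y.1 - 1)) (hz : CoeffsIn (fun _ => N') (z.1 - 1))
    (f : UnipotentSeries C) : CoeffsIn (fun _ => N) ((loopAssoc f y z).1 - 1) := by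
  obtain ⟨H, hH⟩ := exists_succDeg_mul_eq f
  rw [hN.assoc_val hN' hy hz f hH, add_sub_cancel_left]
  exact hN.coeffsIn_mul_left _ ((hN.coeffsIn_mul_right hy _).sub (hN.coeffsIn_mul_left _ hy))

/-- On 1 + N the second-order terms of the substitution product vanish, so the loop is the additive
group of N there. -/
theorem ldiv_mul_sub_one (hN : IsSquareZeroIdeal N) {a b c : UnipotentSeries C}
    (ha : CoeffsIn (fun _ => N) (a.1 - 1)) (hb : CoeffsIn (fun _ => N) (b.1 - 1))
    (hc : CoeffsIn (fun _ => N) (c.1 - 1)) :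
    (loopLDiv (a * b) c).1 - 1 = (c.1 - 1) - (a.1 - 1) - (b.1 - 1) := by
  have h0 : PowerSeries.coeff 0 (1 + ((c.1 - 1) - (a.1 - 1) - (b.1 - 1))) = 1 := by
    have := a.2
    have := b.2
    have := c.2
    simp_all
  have h1 : loopLDiv (a * b) c = ⟨_, h0⟩ := by
    refine UnipotentSeries.isLoop.ldiv_eq (UnipotentSeries.ext ?_)
    change substComp (substComp a.1 b.1) _ = c.1
    rw [hN.substComp_one_add _ ((hc.sub ha).sub hb)]
    have hab : substComp a.1 b.1 = 1 + ((a.1 - 1) + (b.1 - 1)) := by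
      have h := hN.substComp_one_add a.1 hb
      rw [add_sub_cancel] at h
      have h' : succDeg a.1 * (b.1 - 1) = b.1 - 1 := by
        have : a.1 = 1 + (a.1 - 1) := by abel
        rw [this, succDeg_add, succDeg_one, add_mul, one_mul,
          hN.series_mul_eq_zero (coeffsIn_succDeg ha) hb, add_zero]
      rw [h, h']
      abel
    rw [hab, succDeg_add, succDeg_one, add_mul, one_mul,
      hN.series_mul_eq_zero (coeffsIn_succDeg (ha.add hb)) ((hc.sub ha).sub hb)]
    abel
  rw [h1, add_sub_cancel_left]

end IsSquareZeroIdeal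

end SquareZero

/-! ### The recursion for the operations P_{n,1} -/

section Contract

variable {Q : Type*}

theorem contractNth_zero_apply {n : ℕ} (op : Q → Q → Q) (a : Fin (n + 2) → Q) :
    Fin.contractNth (Fin.castSucc (n := n + 1) 0) op a =
      Fin.cons (op (a 0) (a 1)) fun k : Fin n => a k.succ.succ := by
  funext k
  refine Fin.cases ?_ (fun k => ?_) k
  · rw [Fin.contractNth_apply_of_eq _ _ _ _ (by simp)]
    rfl
  · rw [Fin.contractNth_apply_of_gt _ _ _ _ (by simp)]
    rfl

theorem loopP_zero [Mul Q] [One Q] (a : Fin 3 → Q) : loopP 0 a = loopAssoc (a 0) (a 1) (a 2) := by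
  rw [loopP, loopDeviation]

theorem loopP_succ [Mul Q] [One Q] (n : ℕ) (a : Fin (n + 4) → Q) :
    loopP (n + 1) a =
      loopLDiv (loopP n (Fin.cons (a 0) fun k : Fin (n + 2) => a k.succ.succ) *
          loopP n (Fin.cons (a 1) fun k : Fin (n + 2) => a k.succ.succ))
        (loopP n (Fin.cons (a 0 * a 1) fun k : Fin (n + 2) => a k.succ.succ)) := by
  simp only [loopP, loopDeviation]
  rw [contractNth_zero_apply, contractNth_zero_apply, contractNth_zero_apply]
  rfl

end Contract

/-! ### P_{n,1} with last two arguments in square-zero ideals -/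

namespace IsSquareZeroIdeal

variable {C : Type*} [Ring C] {N N' : AddSubgroup C}

theorem coeffsIn_loopP_sub_one (hN : IsSquareZeroIdeal N) (hN' : IsSquareZeroIdeal N') (n : ℕ)
    (a : Fin (n + 3) → UnipotentSeries C)
    (hy : CoeffsIn (fun _ => N) ((a ⟨n + 1, by omega⟩).1 - 1))
    (hz : CoeffsIn (fun _ => N') ((a ⟨n + 2, by omega⟩).1 - 1)) :
    CoeffsIn (fun _ => N) ((loopP n a).1 - 1) := by
  induction n with
  | zero => rw [loopP_zero]; exact hN.coeffsIn_assoc_sub_one hN' hy hz _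
  | succ n ih =>
    rw [loopP_succ, hN.ldiv_mul_sub_one (ih _ hy hz) (ih _ hy hz) (ih _ hy hz)]
    exact ((ih _ hy hz).sub (ih _ hy hz)).sub (ih _ hy hz)

theorem loopP_succ_sub_one (hN : IsSquareZeroIdeal N) (hN' : IsSquareZeroIdeal N') (n : ℕ)
    (a : Fin (n + 4) → UnipotentSeries C)
    (hy : CoeffsIn (fun _ => N) ((a ⟨n + 2, by omega⟩).1 - 1))
    (hz : CoeffsIn (fun _ => N') ((a ⟨n + 3, by omega⟩).1 - 1)) :
    (loopP (n + 1) a).1 - 1 =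
      ((loopP n (Fin.cons (a 0 * a 1) fun k : Fin (n + 2) => a k.succ.succ)).1 - 1) -
      ((loopP n (Fin.cons (a 0) fun k : Fin (n + 2) => a k.succ.succ)).1 - 1) -
      ((loopP n (Fin.cons (a 1) fun k : Fin (n + 2) => a k.succ.succ)).1 - 1) := by
  rw [loopP_succ, hN.ldiv_mul_sub_one] <;>
    exact hN.coeffsIn_loopP_sub_one hN' n _ hy hz

/-- If each entry depends on a variable of its own, then an additive functional which vanishes on
the series that do not depend on all variables takes the same value on the deviation and on the
associator of the product of the entries but the last two. -/
theorem map_loopP_sub_one (hN : IsSquareZeroIdeal N) (hN' : IsSquareZeroIdeal N')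
    {ι : Type*} (W : ι → AddSubgroup C) (hW : ∀ t, SetLike.GradedMonoid fun _ : ℕ => W t)
    {A : Type*} [AddCommGroup A] (κ : PowerSeries C →+ A)
    (hκ : ∀ t f, CoeffsIn (fun _ => W t) f → κ f = 0) (n : ℕ)
    (a : Fin (n + 3) → UnipotentSeries C) (τ : Fin (n + 3) → ι)
    (ha : ∀ s t, s ≠ t → CoeffsIn (fun _ => W (τ t)) (a s).1)
    (hy : CoeffsIn (fun _ => N) ((a ⟨n + 1, by omega⟩).1 - 1))
    (hz : CoeffsIn (fun _ => N') ((a ⟨n + 2, by omega⟩).1 - 1)) :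
    κ ((loopP n a).1 - 1) = κ ((loopAssoc
      ((List.ofFn fun t : Fin n => a ⟨t + 1, by omega⟩).foldl (fun x y => x * y) (a 0))
      (a ⟨n + 1, by omega⟩) (a ⟨n + 2, by omega⟩)).1 - 1) := by
  induction n with
  | zero => rw [loopP_zero]; rfl
  | succ n ih =>
    -- Each of the two subtracted terms omits one of the first two entries. The remaining entries do
    -- not depend on the variable of the omitted one, so κ vanishes on the term.
    have hvanish : ∀ (t : Fin (n + 4)) (b : UnipotentSeries C),
        CoeffsIn (fun _ => W (τ t)) b.1 → (∀ k : Fin (n + 2), k.succ.succ ≠ t) →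
        κ ((loopP n (Fin.cons b fun k : Fin (n + 2) => a k.succ.succ)).1 - 1) = 0 := by
      intro t b hb hk
      have := hW (τ t)
      refine hκ (τ t) _ (CoeffsIn.sub ?_ CoeffsIn.one)
      refine UnipotentSeries.coeffsIn_deviation n _ fun j => ?_
      refine Fin.cases hb (fun k => ?_) j
      exact ha _ _ (hk k)
    rw [hN.loopP_succ_sub_one hN' n a hy hz, map_sub, map_sub,
      hvanish 1 (a 0) (ha _ _ (Fin.ne_of_val_ne (by simp))) (fun k => Fin.ne_of_val_ne (by simp)),
      hvanish 0 (a 1) (ha _ _ (Fin.ne_of_val_ne (by simp))) (fun k => Fin.ne_of_val_ne (by simp)),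
      sub_zero, sub_zero,
      -- The product of the first two entries keeps the variable of its first factor; the variable
      -- of the second is no longer needed.
      ih _ (Fin.cons (τ 0) fun k : Fin (n + 2) => τ k.succ.succ) ?_ hy hz, List.ofFn_succ,
      List.foldl_cons]
    · rfl
    · intro s t hst
      induction s using Fin.cases with
      | zero =>
        induction t using Fin.cases with
        | zero => exact absurd rfl hst
        | succ t =>
          have := hW (τ t.succ.succ)
          exact CoeffsIn.subst (ha 0 t.succ.succ (Fin.ne_of_val_ne (by simp)))
            (ha 1 t.succ.succ (Fin.ne_of_val_ne (by simp)))
      | succ s =>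
        induction t using Fin.cases with
        | zero => exact ha s.succ.succ 0 (Fin.ne_of_val_ne (by simp))
        | succ t =>
          exact ha s.succ.succ t.succ.succ fun h => hst (Fin.succ_injective _ h)

end IsSquareZeroIdeal

/-! ### Coefficients of products of series in square-zero variables -/

namespace MarkedRing

variable {C : Type*} [Ring C] {ι : Type*} [Fintype ι] [DecidableEq ι]

theorem incidence_add_apply (f g : IncidenceAlgebra C (Finset ι)) (U V : Finset ι) :
    (f + g) U V = f U V + g U V := rfl

theorem incidence_neg_apply (f : IncidenceAlgebra C (Finset ι)) (U V : Finset ι) :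
    (-f) U V = -f U V := rfl

variable (C) in
/-- The elements of the incidence algebra that do not depend on the variable `t`. -/
def indepOf (t : ι) : AddSubgroup (IncidenceAlgebra C (Finset ι)) where
  carrier := {f | ∀ U V, t ∉ U → t ∈ V → f U V = 0}
  zero_mem' := fun _ _ _ _ => rfl
  add_mem' := fun {f g} hf hg U V hU hV => by
    rw [incidence_add_apply, hf U V hU hV, hg U V hU hV, add_zero]
  neg_mem' := fun {f} hf U V hU hV => by rw [incidence_neg_apply, hf U V hU hV, neg_zero]

/-- On a chain U ⊆ W ⊆ V from a set without t to one with t, the variable is adjoined in one of the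
two steps, and the corresponding factor is 0. The family is constant in the degree. -/
instance (t : ι) : SetLike.GradedMonoid fun _ : ℕ => indepOf C t where
  one_mem := fun U V hU hV => by
    rw [IncidenceAlgebra.one_apply, if_neg]
    rintro rfl
    exact hU hV
  mul_mem _ _ f g hf hg U V hU hV := by
    rw [IncidenceAlgebra.mul_apply]
    refine sum_eq_zero fun W _ => ?_
    by_cases hW : t ∈ W
    · rw [hf U W hU hW, zero_mul]
    · rw [hg W V hW hV, mul_zero]

variable (C) in
/-- The multiples of the variable `t` in the incidence algebra. -/
def multiplesOf (t : ι) : AddSubgroup (IncidenceAlgebra C (Finset ι)) where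
  carrier := {f | ∀ U V, (t ∈ U ∨ t ∉ V) → f U V = 0}
  zero_mem' := fun _ _ _ => rfl
  add_mem' := fun {f g} hf hg U V h => by
    rw [incidence_add_apply, hf U V h, hg U V h, add_zero]
  neg_mem' := fun {f} hf U V h => by rw [incidence_neg_apply, hf U V h, neg_zero]

theorem isSquareZeroIdeal_multiplesOf (t : ι) : IsSquareZeroIdeal (multiplesOf C t) where
  mul_mem_left a f hf U V h := by
    rw [IncidenceAlgebra.mul_apply]
    refine sum_eq_zero fun W hW => ?_
    rw [hf W V (h.imp_left fun h => (mem_Icc.mp hW).1 h), mul_zero]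
  mul_mem_right f hf a U V h := by
    rw [IncidenceAlgebra.mul_apply]
    refine sum_eq_zero fun W hW => ?_
    rw [hf U W (h.imp_right fun h hW' => h ((mem_Icc.mp hW).2 hW')), zero_mul]
  mul_eq_zero f hf g hg := by
    ext U V
    rw [IncidenceAlgebra.mul_apply]
    refine sum_eq_zero fun W hW => ?_
    by_cases h : t ∈ W
    · rw [hg W V (Or.inl h), mul_zero]
    · rw [hf U W (Or.inr h), zero_mul]

variable (C) in
/-- The elements of the incidence algebra that are homogeneous of degree `k`, where the variable `t`
has degree `i t`. -/
def homogeneous (i : ι → ℕ) (k : ℕ) : AddSubgroup (IncidenceAlgebra C (Finset ι)) where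
  carrier := {f | (∀ U V, U ⊆ V → f U V = f ∅ (V \ U)) ∧ ∀ T, ∑ t ∈ T, i t ≠ k → f ∅ T = 0}
  zero_mem' := ⟨fun _ _ _ => rfl, fun _ _ => rfl⟩
  add_mem' := fun {f g} hf hg => by
    refine ⟨fun U V h => ?_, fun T hT => ?_⟩
    · rw [incidence_add_apply, incidence_add_apply, hf.1 U V h, hg.1 U V h]
    · rw [incidence_add_apply, hf.2 T hT, hg.2 T hT, add_zero]
  neg_mem' := fun {f} hf => by
    refine ⟨fun U V h => ?_, fun T hT => ?_⟩
    · rw [incidence_neg_apply, incidence_neg_apply, hf.1 U V h]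
    · rw [incidence_neg_apply, hf.2 T hT, neg_zero]

theorem Icc_empty_left (T : Finset ι) : Icc ∅ T = T.powerset := by
  ext U
  rw [mem_Icc, mem_powerset]
  exact and_iff_right (empty_subset U)

/-- An interval from U to V is carried to one from ∅ to V \ U by removing U, so translation
invariance of the entries survives multiplication. Such matrices are determined by their row at ∅,
as squarefree polynomials are by their coefficients. -/
instance (i : ι → ℕ) : SetLike.GradedMonoid (homogeneous C i) where
  one_mem := by
    refine ⟨fun U V h => ?_, fun T hT => ?_⟩
    · rw [IncidenceAlgebra.one_apply, IncidenceAlgebra.one_apply]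
      refine if_congr ⟨fun h' => ?_, fun h' => ?_⟩ rfl rfl
      · rw [h', sdiff_self]
        rfl
      · exact h.antisymm (sdiff_eq_empty_iff_subset.mp h'.symm)
    · rw [IncidenceAlgebra.one_apply, if_neg]
      rintro rfl
      exact hT sum_empty
  mul_mem k l f g hf hg := by
    refine ⟨fun U V h => ?_, fun T hT => ?_⟩
    · rw [IncidenceAlgebra.mul_apply, IncidenceAlgebra.mul_apply]
      refine sum_nbij' (fun W => W \ U) (fun T => U ∪ T) ?_ ?_ ?_ ?_ ?_
      · intro W hW
        rw [mem_Icc] at hW ⊢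
        exact ⟨empty_subset _, sdiff_subset_sdiff hW.2 Subset.rfl⟩
      · intro T hT
        rw [mem_Icc] at hT ⊢
        exact ⟨subset_union_left, union_subset h (hT.2.trans sdiff_subset)⟩
      · intro W hW
        rw [mem_Icc] at hW
        exact union_sdiff_of_subset hW.1
      · intro T hT
        rw [mem_Icc] at hT
        refine union_sdiff_cancel_left (disjoint_left.mpr fun t ht ht' => ?_)
        exact (mem_sdiff.mp (hT.2 ht')).2 ht
      · intro W hW
        rw [mem_Icc] at hW
        rw [hf.1 U W hW.1, hg.1 W V hW.2, hg.1 (W \ U) (V \ U) (sdiff_subset_sdiff hW.2 Subset.rfl),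
          sdiff_sdiff_sdiff_cancel_right hW.1]
    · rw [IncidenceAlgebra.mul_apply]
      refine sum_eq_zero fun W hW => ?_
      rw [mem_Icc] at hW
      by_cases h1 : ∑ t ∈ W, i t = k
      · rw [hg.1 W T hW.2, hg.2, mul_zero]
        intro h2
        apply hT
        rw [← h1, ← h2, add_comm, sum_sdiff hW.2]
      · rw [hf.2 W h1, zero_mul]

/-- The coefficient at the product of the variables in `T` of a homogeneous series. -/
noncomputable def entry (i : ι → ℕ) (T : Finset ι) :
    PowerSeries (IncidenceAlgebra C (Finset ι)) →+ C where
  toFun f := PowerSeries.coeff (∑ t ∈ T, i t) f ∅ T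
  map_zero' := by rw [map_zero]; rfl
  map_add' f g := by rw [map_add]; rfl

theorem entry_apply (i : ι → ℕ) (T : Finset ι) (f : PowerSeries (IncidenceAlgebra C (Finset ι))) :
    entry i T f = PowerSeries.coeff (∑ t ∈ T, i t) f ∅ T := rfl

variable {i : ι → ℕ}

theorem nsmul_incidence_apply (m : ℕ) (f : IncidenceAlgebra C (Finset ι)) (U V : Finset ι) :
    (m • f) U V = m • f U V := by
  induction m with
  | zero => simp
  | succ m ih => rw [add_smul, one_smul, incidence_add_apply, ih, add_smul, one_smul]

theorem entry_one (T : Finset ι) :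
    entry i T (1 : PowerSeries (IncidenceAlgebra C (Finset ι))) = if T = ∅ then 1 else 0 := by
  rw [entry_apply, PowerSeries.coeff_one]
  by_cases hT : T = ∅
  · subst hT
    simp
  · rw [if_neg hT]
    split_ifs
    · rw [IncidenceAlgebra.one_apply, if_neg (Ne.symm hT)]
    · rfl

/-- Homogeneity forces the degrees of the two factors once U is chosen, so the double sum over
degrees and sets collapses to a convolution over subsets. -/
theorem entry_mul {f g : PowerSeries (IncidenceAlgebra C (Finset ι))}
    (hf : CoeffsIn (homogeneous C i) f) (hg : CoeffsIn (homogeneous C i) g) (T : Finset ι) :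
    entry i T (f * g) = ∑ U ∈ T.powerset, entry i U f * entry i (T \ U) g := by
  have hsum : ∀ (s : Finset (ℕ × ℕ)) (F : ℕ × ℕ → IncidenceAlgebra C (Finset ι)),
      (∑ p ∈ s, F p) ∅ T = ∑ p ∈ s, F p ∅ T := fun s F =>
    map_sum (⟨⟨fun f => f ∅ T, rfl⟩, fun _ _ => rfl⟩ : IncidenceAlgebra C (Finset ι) →+ C) F s
  rw [entry_apply, PowerSeries.coeff_mul, hsum]
  simp only [IncidenceAlgebra.mul_apply, Icc_empty_left]
  rw [sum_comm]
  refine sum_congr rfl fun U hU => ?_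
  rw [mem_powerset] at hU
  have hd : ∑ t ∈ U, i t + ∑ t ∈ T \ U, i t = ∑ t ∈ T, i t := by
    rw [add_comm, sum_sdiff hU]
  rw [sum_eq_single (∑ t ∈ U, i t, ∑ t ∈ T \ U, i t)]
  · rw [entry_apply, entry_apply, (hg _).1 U T hU]
  · rintro ⟨k, l⟩ hkl hne
    rw [HasAntidiagonal.mem_antidiagonal] at hkl
    dsimp only at hkl ⊢
    rw [(hf k).2 U, zero_mul]
    rintro rfl
    exact hne (Prod.ext rfl (by dsimp only; omega))
  · intro h
    exact absurd (HasAntidiagonal.mem_antidiagonal.mpr hd) h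

theorem entry_succDeg (f : PowerSeries (IncidenceAlgebra C (Finset ι))) (T : Finset ι) :
    entry i T (succDeg f) = (∑ t ∈ T, i t + 1) • entry i T f := by
  rw [entry_apply, coeff_succDeg, nsmul_incidence_apply, entry_apply]

theorem entry_chooseDeg (f : PowerSeries (IncidenceAlgebra C (Finset ι))) (T : Finset ι) :
    entry i T (chooseDeg f) = (∑ t ∈ T, i t + 1).choose 2 • entry i T f := by
  rw [entry_apply, coeff_chooseDeg, nsmul_incidence_apply, entry_apply]

theorem coeffsIn_homogeneous_succDeg {f : PowerSeries (IncidenceAlgebra C (Finset ι))}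
    (hf : CoeffsIn (homogeneous C i) f) : CoeffsIn (homogeneous C i) (succDeg f) := fun n => by
  rw [coeff_succDeg]
  exact nsmul_mem (hf n) _

theorem coeffsIn_homogeneous_chooseDeg {f : PowerSeries (IncidenceAlgebra C (Finset ι))}
    (hf : CoeffsIn (homogeneous C i) f) : CoeffsIn (homogeneous C i) (chooseDeg f) := fun n => by
  rw [coeff_chooseDeg]
  exact nsmul_mem (hf n) _

variable (hi : ∀ t, 1 ≤ i t) (x : ι → C)

/-- The series `1 + x_t X^(i_t)` with the coefficient multiplied by the variable `t`. -/
noncomputable def generic (i : ι → ℕ) (x : ι → C) (t : ι) :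
    UnipotentSeries (IncidenceAlgebra C (Finset ι)) :=
  UnipotentSeries.monomial (i t) (nilp C t (x t))

theorem coeff_generic_sub_one (hi : ∀ t, 1 ≤ i t) (x : ι → C) (t : ι) (m : ℕ) :
    PowerSeries.coeff m ((generic i x t).1 - 1) = if m = i t then nilp C t (x t) else 0 := by
  have := hi t
  rw [map_sub, generic, UnipotentSeries.coeff_monomial, PowerSeries.coeff_one]
  split_ifs with h1 h2 <;> first | omega | simp

theorem nilp_mem_multiplesOf (t : ι) (r : C) : nilp C t r ∈ multiplesOf C t := by
  intro U V h
  rw [nilp_apply, if_neg]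
  rintro ⟨h1, h2⟩
  have : t ∈ V \ U := h2 ▸ mem_singleton_self t
  rw [mem_sdiff] at this
  tauto

theorem nilp_mem_indepOf {s t : ι} (hst : s ≠ t) (r : C) : nilp C s r ∈ indepOf C t := by
  intro U V hU hV
  rw [nilp_apply, if_neg]
  rintro ⟨h1, h2⟩
  have : t ∈ V \ U := mem_sdiff.mpr ⟨hV, hU⟩
  rw [h2, mem_singleton] at this
  exact hst this.symm

theorem nilp_mem_homogeneous (t : ι) (r : C) : nilp C t r ∈ homogeneous C i (i t) := by
  refine ⟨fun U V h => ?_, fun T hT => ?_⟩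
  · rw [nilp_apply, nilp_apply, sdiff_empty]
    exact if_congr ⟨fun h => ⟨empty_subset _, h.2⟩, fun h' => ⟨h, h'.2⟩⟩ rfl rfl
  · rw [nilp_apply, if_neg]
    rintro ⟨-, h⟩
    rw [sdiff_empty] at h
    rw [h, sum_singleton] at hT
    exact hT rfl

theorem coeffsIn_generic_sub_one {V : ℕ → AddSubgroup (IncidenceAlgebra C (Finset ι))}
    (hi : ∀ t, 1 ≤ i t) (x : ι → C) (t : ι) (h : nilp C t (x t) ∈ V (i t)) :
    CoeffsIn V ((generic i x t).1 - 1) := fun m => by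
  rw [coeff_generic_sub_one hi]
  split_ifs with hm
  · exact hm ▸ h
  · exact zero_mem _

theorem coeffsIn_generic {V : ℕ → AddSubgroup (IncidenceAlgebra C (Finset ι))}
    [SetLike.GradedMonoid V] (hi : ∀ t, 1 ≤ i t) (x : ι → C) (t : ι)
    (h : nilp C t (x t) ∈ V (i t)) : CoeffsIn V (generic i x t).1 := by
  have := (coeffsIn_generic_sub_one hi x t h).add (CoeffsIn.one (V := V))
  rwa [sub_add_cancel] at this

theorem entry_generic_sub_one (hi : ∀ t, 1 ≤ i t) (x : ι → C) (t : ι) (T : Finset ι) :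
    entry i T ((generic i x t).1 - 1) = if T = {t} then x t else 0 := by
  rw [entry_apply, coeff_generic_sub_one hi]
  by_cases hT : T = {t}
  · subst hT
    rw [if_pos (sum_singleton _ _), if_pos rfl, nilp_apply, if_pos]
    exact ⟨empty_subset _, sdiff_empty⟩
  · rw [if_neg hT]
    split_ifs
    · rw [nilp_apply, if_neg]
      rw [sdiff_empty]
      exact fun h => hT h.2
    · rfl

/-- The product of generic series, bracketed from the left. -/
noncomputable def genericProd (i : ι → ℕ) (x : ι → C) (l : List ι) :
    UnipotentSeries (IncidenceAlgebra C (Finset ι)) :=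
  (l.map (generic i x)).foldl (fun a b => a * b) 1

theorem genericProd_append (l : List ι) (t : ι) :
    genericProd i x (l ++ [t]) = genericProd i x l * generic i x t := by
  simp [genericProd]

theorem genericProd_append_val (hi : ∀ t, 1 ≤ i t) (l : List ι) (t : ι) :
    (genericProd i x (l ++ [t])).1 =
      (genericProd i x l).1 + succDeg (genericProd i x l).1 * ((generic i x t).1 - 1) := by
  have := (isSquareZeroIdeal_multiplesOf t).substComp_one_add (genericProd i x l).1
    (coeffsIn_generic_sub_one hi x t (nilp_mem_multiplesOf t (x t)))
  rwa [add_sub_cancel, ← UnipotentSeries.mul_val, ← genericProd_append] at this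

theorem coeffsIn_genericProd (hi : ∀ t, 1 ≤ i t) (l : List ι) :
    CoeffsIn (homogeneous C i) (genericProd i x l).1 := by
  induction l using List.reverseRecOn with
  | nil => exact CoeffsIn.one
  | append_singleton l t ih =>
    rw [genericProd_append]
    exact ih.subst (coeffsIn_generic hi x t (nilp_mem_homogeneous t (x t)))

/-- The coefficient `N(i_T) x_T` of a product of generic series, where `T` is taken in the order of
the list `l`. -/
def gradedCoeff (i : ι → ℕ) (x : ι → C) (l : List ι) : C :=
  gradedN (l.map i) • (l.map x).prod

theorem gradedN_append (l : List ℕ) (a : ℕ) :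
    gradedN (l ++ [a]) = gradedN l * ((l ++ [a]).sum + 1) := by
  simp only [gradedN, List.length_append, List.length_singleton, List.range_succ, List.map_append,
    List.prod_append, List.map_singleton, List.prod_singleton]
  congr 1
  · refine congrArg List.prod (List.map_congr_left fun s hs => ?_)
    rw [List.mem_range] at hs
    rw [List.take_append_of_le_length (by omega)]
  · rw [List.take_of_length_le (by simp)]

theorem sum_filter_mem_of_subset {l : List ι} (hl : l.Nodup) {T : Finset ι}
    (hT : T ⊆ l.toFinset) : ((l.filter (· ∈ T)).map i).sum = ∑ t ∈ T, i t := by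
  rw [← List.sum_toFinset i (hl.filter _)]
  congr 1
  ext t
  simp only [List.toFinset_filter, mem_filter, decide_eq_true_eq]
  exact ⟨fun h => h.2, fun h => ⟨hT h, h⟩⟩

/-- By `genericProd_append_val`, adjoining t multiplies the coefficient at T \ {t} by its degree
plus one and then by x_t on the right. The coefficient at T therefore lacks only the last factor of
N, which the factor in front supplies. -/
theorem entry_genericProd (hi : ∀ t, 1 ≤ i t) {l : List ι} (hl : l.Nodup) (T : Finset ι) :
    (¬ T ⊆ l.toFinset → entry i T (genericProd i x l).1 = 0) ∧
      (T ⊆ l.toFinset → (∑ t ∈ T, i t + 1) • entry i T (genericProd i x l).1 =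
        gradedCoeff i x (l.filter (· ∈ T))) := by
  induction l using List.reverseRecOn generalizing T with
  | nil =>
    have h1 : genericProd i x ([] : List ι) = 1 := rfl
    rw [h1, UnipotentSeries.one_val, entry_one]
    simp only [List.toFinset_nil, subset_empty]
    refine ⟨fun h => if_neg h, fun h => ?_⟩
    subst h
    simp [gradedCoeff, gradedN]
  | append_singleton l t ih =>
    have hl' : l.Nodup := (List.nodup_append.mp hl).1
    have ht : t ∉ l := fun h => by
      have := (List.nodup_append.mp hl).2.2 t h t (by simp)
      exact this rfl
    have key : entry i T (genericProd i x (l ++ [t])).1 = entry i T (genericProd i x l).1 +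
        if t ∈ T then
          (∑ s ∈ T.erase t, i s + 1) • entry i (T.erase t) (genericProd i x l).1 * x t else 0 := by
      rw [genericProd_append_val x hi, map_add, entry_mul (coeffsIn_homogeneous_succDeg
        (coeffsIn_genericProd x hi l)) (coeffsIn_generic_sub_one hi x t
          (nilp_mem_homogeneous t (x t)))]
      congr 1
      simp only [entry_generic_sub_one hi, entry_succDeg, mul_ite, mul_zero]
      split_ifs with htT
      · rw [sum_eq_single (T.erase t), if_pos (sdiff_erase_self htT)]
        · intro U hU hne
          refine if_neg fun h => hne ?_
          rw [← _root_.sdiff_sdiff_eq_self (mem_powerset.mp hU), h, sdiff_singleton_eq_erase]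
        · intro h
          exact absurd (mem_powerset.mpr (erase_subset _ _)) h
      · refine sum_eq_zero fun U hU => if_neg fun h => htT ?_
        have : t ∈ T \ U := h ▸ mem_singleton_self t
        exact (mem_sdiff.mp this).1
    have htl : ∀ U : Finset ι, t ∈ U → ¬ U ⊆ l.toFinset := fun U hU h =>
      ht (List.mem_toFinset.mp (h hU))
    have hsub : T ⊆ (l ++ [t]).toFinset ↔ T.erase t ⊆ l.toFinset := by
      rw [List.toFinset_append, union_comm, List.toFinset_cons, List.toFinset_nil,
        insert_empty_eq, ← insert_eq, subset_insert_iff]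
    rw [key, hsub]
    by_cases htT : t ∈ T
    · rw [if_pos htT, (ih hl' T).1 (htl T htT), zero_add]
      refine ⟨fun h => ?_, fun h => ?_⟩
      · rw [(ih hl' _).1 h, smul_zero, zero_mul]
      · rw [(ih hl' _).2 h]
        have hfil : (l ++ [t]).filter (· ∈ T) = l.filter (· ∈ T.erase t) ++ [t] := by
          rw [List.filter_append]
          congr 1
          · refine List.filter_congr fun s hs => ?_
            have : s ≠ t := fun h => ht (h ▸ hs)
            simp [this]
          · simp [htT]
        have hsum : ((l.filter (· ∈ T.erase t) ++ [t]).map i).sum = ∑ s ∈ T, i s := by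
          rw [List.map_append, List.sum_append, sum_filter_mem_of_subset hl' h]
          simpa using sum_erase_add T i htT
        rw [hfil, gradedCoeff, gradedCoeff, List.map_append, List.map_append, List.map_singleton,
          gradedN_append]
        rw [List.map_append, List.map_singleton] at hsum
        rw [hsum, List.prod_append, List.map_singleton, List.prod_singleton, mul_comm, mul_smul,
          smul_mul_assoc]
    · rw [if_neg htT, add_zero, erase_eq_of_notMem htT, List.filter_append]
      have : [t].filter (· ∈ T) = [] := by simp [htT]
      rw [this, List.append_nil]
      exact ih hl' T

theorem entry_generic_mul (hi : ∀ t, 1 ≤ i t) {s t : ι} (hst : s ≠ t) (T : Finset ι) :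
    entry i T (((generic i x s).1 - 1) * ((generic i x t).1 - 1)) =
      if T = {s, t} then x s * x t else 0 := by
  rw [entry_mul (coeffsIn_generic_sub_one hi x s (nilp_mem_homogeneous s (x s)))
    (coeffsIn_generic_sub_one hi x t (nilp_mem_homogeneous t (x t)))]
  simp only [entry_generic_sub_one hi]
  have h1 : ({s, t} : Finset ι) \ {s} = {t} := by
    ext u
    simp only [mem_sdiff, mem_insert, mem_singleton]
    constructor
    · tauto
    · rintro rfl
      exact ⟨Or.inr rfl, hst.symm⟩
  split_ifs with hT
  · subst hT
    rw [sum_eq_single {s}, if_pos rfl, if_pos h1]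
    · intro U _ hU
      rw [if_neg hU, zero_mul]
    · intro h
      exact absurd (mem_powerset.mpr (by simp)) h
  · refine sum_eq_zero fun U hU => ?_
    by_cases h : U = {s}
    · subst h
      rw [if_neg (c := T \ {s} = {t}), mul_zero]
      intro h2
      apply hT
      rw [← union_sdiff_of_subset (mem_powerset.mp hU), h2]
      rfl
    · rw [if_neg h, zero_mul]

theorem gradedCoeff_map {α : Type*} [Fintype α] [DecidableEq α] (e : α → ι) (l : List α) :
    gradedCoeff i x (l.map e) = gradedCoeff (fun t => i (e t)) (fun t => x (e t)) l := by
  simp only [gradedCoeff, List.map_map]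
  rfl

/-- The multilinear part of the deviation `(x_1, …, x_{n+1}, y, z)_{1, …, 1}` is a multiple of
`y z - z y`. -/
theorem exists_entry_loopP_eq (n : ℕ) {i : Fin (n + 3) → ℕ} (hi : ∀ t, 1 ≤ i t)
    (x : Fin (n + 3) → C) :
    ∃ h : Finset (Fin (n + 1)) → C,
      (∀ T : Finset (Fin (n + 1)), ∑ U ∈ T.powerset,
        gradedCoeff (fun t => i (Fin.castAdd 2 t)) (fun t => x (Fin.castAdd 2 t))
            ((List.finRange (n + 1)).filter (· ∈ U)) * (2 • h (T \ U)) =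
          (∑ t ∈ T, i (Fin.castAdd 2 t)) •
            gradedCoeff (fun t => i (Fin.castAdd 2 t)) (fun t => x (Fin.castAdd 2 t))
              ((List.finRange (n + 1)).filter (· ∈ T))) ∧
      entry i univ (loopP n (generic i x)).1 =
        h univ * (x ⟨n + 1, by omega⟩ * x ⟨n + 2, by omega⟩ -
          x ⟨n + 2, by omega⟩ * x ⟨n + 1, by omega⟩) := by
  set e : Fin (n + 1) ↪ Fin (n + 3) := Fin.castAddEmb 2 with he
  set l : List (Fin (n + 3)) := (List.finRange (n + 1)).map e with hl
  set y : Fin (n + 3) := ⟨n + 1, by omega⟩ with hy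
  set z : Fin (n + 3) := ⟨n + 2, by omega⟩ with hz
  have hyz : y ≠ z := Fin.ne_of_val_ne (by simp [hy, hz])
  have hnodup : l.Nodup := (List.nodup_finRange _).map e.injective
  have hmap : ∀ T : Finset (Fin (n + 1)), T.map e ⊆ l.toFinset := by
    intro T t ht
    obtain ⟨s, -, rfl⟩ := mem_map.mp ht
    rw [List.mem_toFinset]
    exact List.mem_map_of_mem (List.mem_finRange s)
  obtain ⟨H, hH⟩ := IsSquareZeroIdeal.exists_succDeg_mul_eq (genericProd i x l)
  have hP := coeffsIn_genericProd x hi l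
  have hHhom : CoeffsIn (homogeneous C i) H := by
    refine CoeffsIn.of_mul (f := succDeg (genericProd i x l).1) ?_
      (coeffsIn_homogeneous_succDeg hP) (hH ▸ coeffsIn_homogeneous_chooseDeg hP)
    rw [coeff_succDeg, (genericProd i x l).2]
    simp
  have hentry : ∀ T : Finset (Fin (n + 1)), entry i (T.map e) (succDeg (genericProd i x l).1) =
      gradedCoeff (fun t => i (e t)) (fun t => x (e t))
        ((List.finRange (n + 1)).filter (· ∈ T)) := by
    intro T
    rw [entry_succDeg, (entry_genericProd x hi hnodup _).2 (hmap T), ← gradedCoeff_map (i := i) x e, hl,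
      List.filter_map]
    refine congrArg (fun p => gradedCoeff i x (((List.finRange (n + 1)).filter p).map e)) ?_
    funext s
    simp
  -- The witness is the table of coefficients of H at sets formed from the first `n + 1` variables.
  refine ⟨fun T => entry i (T.map e) H, fun T => ?_, ?_⟩
  · have h1 := congrArg (entry i (T.map e)) hH
    rw [entry_mul (coeffsIn_homogeneous_succDeg hP) hHhom, entry_chooseDeg] at h1
    have h2 : ∑ U ∈ (T.map e).powerset, entry i U (succDeg (genericProd i x l).1) *
        entry i (T.map e \ U) H = ∑ U ∈ T.powerset,
          entry i (U.map e) (succDeg (genericProd i x l).1) * entry i ((T \ U).map e) H := by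
      symm
      refine sum_bij (fun U _ => U.map e) ?_ ?_ ?_ ?_
      · intro U hU
        exact mem_powerset.mpr (map_subset_map.mpr (mem_powerset.mp hU))
      · intro U _ V _ h
        exact map_injective e h
      · intro V hV
        obtain ⟨U, hU, rfl⟩ := subset_map_iff.mp (mem_powerset.mp hV)
        exact ⟨U, mem_powerset.mpr hU, rfl⟩
      · intro U _
        rw [Finset.map_sdiff]
    rw [h2] at h1
    simp only [mul_smul_comm, ← smul_sum]
    have h3 := congrArg (2 • ·) h1
    simp only [hentry] at h3
    refine h3.trans ?_
    change _ = (∑ t ∈ T, i (e t)) • gradedCoeff (fun t => i (e t)) (fun t => x (e t)) _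
    -- At a set of degree d, twice `chooseDeg` is d times `succDeg`, since 2 · C(d+1, 2) = d(d+1).
    rw [← hentry, entry_succDeg, smul_smul, smul_smul, sum_map]
    congr 1
    have h4 := Nat.triangle_succ (∑ t ∈ T, i (e t))
    rw [Nat.choose_two_right, Nat.add_sub_cancel]
    rw [Nat.mul_div_cancel', mul_comm]
    rw [mul_comm]
    exact (Nat.even_mul_succ_self _).two_dvd
  · have hfold : (List.ofFn fun t : Fin n => generic i x ⟨t + 1, by omega⟩).foldl
        (fun x y => x * y) (generic i x 0) = genericProd i x l := by
      rw [genericProd, hl, List.finRange_succ, List.map_cons, List.map_cons, List.foldl_cons,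
        UnipotentSeries.isLoop.one_mul, List.map_map, List.map_map, List.ofFn_eq_map]
      rfl
    have hκ₀ : ∀ (t : Fin (n + 3)) (f : PowerSeries (IncidenceAlgebra C (Finset (Fin (n + 3))))),
        CoeffsIn (fun _ => indepOf C t) f → entry i univ f = 0 := fun t f hf =>
      hf (∑ t, i t) _ _ (notMem_empty t) (mem_univ t)
    have hκ := (isSquareZeroIdeal_multiplesOf y).map_loopP_sub_one
      (isSquareZeroIdeal_multiplesOf z) (indepOf C) (fun t => inferInstance) (entry i univ)
      hκ₀ n (generic i x) id
      (fun s t hst => coeffsIn_generic hi x s (nilp_mem_indepOf hst (x s)))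
      (coeffsIn_generic_sub_one hi x y (nilp_mem_multiplesOf y (x y)))
      (coeffsIn_generic_sub_one hi x z (nilp_mem_multiplesOf z (x z)))
    rw [hfold, (isSquareZeroIdeal_multiplesOf y).assoc_val (isSquareZeroIdeal_multiplesOf z)
      (coeffsIn_generic_sub_one hi x y (nilp_mem_multiplesOf y (x y)))
      (coeffsIn_generic_sub_one hi x z (nilp_mem_multiplesOf z (x z))) _ hH, add_sub_cancel_left,
      map_sub, entry_one, if_neg univ_nonempty.ne_empty, sub_zero] at hκ
    rw [hκ]
    have hgen := fun t => coeffsIn_generic_sub_one (V := homogeneous C i) hi x t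
      (nilp_mem_homogeneous t (x t))
    rw [entry_mul hHhom (((hgen y).mul (hgen z)).sub ((hgen z).mul (hgen y)))]
    simp only [map_sub, entry_generic_mul x hi hyz, entry_generic_mul x hi hyz.symm]
    have hcompl : (univ : Finset (Fin (n + 3))) \ univ.map e = {y, z} := by
      ext t
      simp only [mem_sdiff, mem_univ, true_and, mem_map, mem_insert, mem_singleton, not_exists]
      constructor
      · intro h
        have h1 : ¬ (t : ℕ) < n + 1 := fun ht => h ⟨t, ht⟩ (Fin.ext rfl)
        have := t.2
        rcases (by omega : (t : ℕ) = n + 1 ∨ (t : ℕ) = n + 2) with h2 | h2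
        · exact Or.inl (Fin.ext h2)
        · exact Or.inr (Fin.ext h2)
      · intro h s hs
        have h1 : (s : ℕ) = t := congrArg Fin.val hs
        have := s.2
        rcases h with h | h
        · have : (t : ℕ) = n + 1 := congrArg Fin.val h
          omega
        · have : (t : ℕ) = n + 2 := congrArg Fin.val h
          omega
    -- The commutator of the y- and z-terms is supported at {y, z}, which leaves exactly the first
    -- `n + 1` variables for H.
    rw [sum_eq_single (univ.map e)]
    · rw [hcompl, if_pos rfl, if_pos (pair_comm y z)]
    · intro U _ hU
      have hne : univ \ U ≠ {y, z} := fun h => hU (by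
        rw [← hcompl] at h
        rw [← Finset.sdiff_sdiff_eq_self (subset_univ U), h,
          Finset.sdiff_sdiff_eq_self (subset_univ _)])
      rw [if_neg hne, if_neg (pair_comm y z ▸ hne), sub_zero, mul_zero]
    · intro h
      exact absurd (mem_powerset.mpr (subset_univ _)) h

end MarkedRing

/-! ### Sums over subsequences -/

section Splits

theorem shuffleSplits_map {α β : Type*} (f : α → β) (l : List α) :
    shuffleSplits (l.map f) = (shuffleSplits l).map fun s => (s.1.map f, s.2.map f) := by
  induction l with
  | nil => rfl
  | cons a l ih =>
    simp only [List.map_cons, shuffleSplits, ih, List.flatMap_map, List.map_flatMap, List.map_nil]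

theorem perm_of_mem_shuffleSplits {α : Type*} :
    ∀ (l : List α) (s : List α × List α), s ∈ shuffleSplits l → (s.1 ++ s.2).Perm l
  | [], s, h => by
    simp only [shuffleSplits, List.mem_singleton] at h
    simp [h]
  | a :: l, s, h => by
    simp only [shuffleSplits, List.mem_flatMap, List.mem_cons, List.not_mem_nil, or_false] at h
    obtain ⟨s', hs', rfl | rfl⟩ := h
    · exact (perm_of_mem_shuffleSplits l s' hs').cons a
    · exact List.perm_middle.trans ((perm_of_mem_shuffleSplits l s' hs').cons a)

/-- For a list without repetitions a subsequence is determined by its set of entries, so sums over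
shuffles become convolutions over subsets. -/
theorem sum_map_shuffleSplits_eq_sum_powerset {α A : Type*} [DecidableEq α] [AddCommMonoid A]
    (φ : List α → List α → A) {l : List α} (hl : l.Nodup) :
    ((shuffleSplits l).map fun s => φ s.1 s.2).sum =
      ∑ U ∈ l.toFinset.powerset, φ (l.filter (· ∈ U)) (l.filter (· ∈ l.toFinset \ U)) := by
  induction l generalizing φ with
  | nil => simp [shuffleSplits]
  | cons a l ih =>
    rw [List.nodup_cons] at hl
    have ha : a ∉ l.toFinset := fun h => hl.1 (List.mem_toFinset.mp h)
    have h1 : ((shuffleSplits (a :: l)).map fun s => φ s.1 s.2).sum =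
        ((shuffleSplits l).map fun s => φ (a :: s.1) s.2).sum +
          ((shuffleSplits l).map fun s => φ s.1 (a :: s.2)).sum := by
      rw [shuffleSplits, ← List.sum_map_add]
      generalize shuffleSplits l = L
      induction L with
      | nil => rfl
      | cons s L ihL => simp [ihL, add_assoc]
    rw [h1, ih (fun s t => φ (a :: s) t) hl.2, ih (fun s t => φ s (a :: t)) hl.2, List.toFinset_cons,
      sum_powerset_insert ha, add_comm]
    congr 1
    · refine sum_congr rfl fun U hU => ?_
      have haU : a ∉ U := fun h => ha (mem_powerset.mp hU h)
      rw [List.filter_cons_of_neg (by simpa using haU), List.filter_cons_of_pos (by simp [haU])]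
      congr 2
      refine List.filter_congr fun s hs => ?_
      have : s ≠ a := fun h => hl.1 (h ▸ hs)
      simp [this]
    · refine sum_congr rfl fun U hU => ?_
      rw [List.filter_cons_of_pos (by simp), List.filter_cons_of_neg (by simp)]
      have hne : ∀ s ∈ l, s ≠ a := fun s hs h => hl.1 (h ▸ hs)
      have h2 : l.filter (· ∈ U) = l.filter (· ∈ insert a U) :=
        List.filter_congr fun s hs => by simp [hne s hs]
      have h3 : l.filter (· ∈ l.toFinset \ U) =
          l.filter (· ∈ insert a l.toFinset \ insert a U) :=
        List.filter_congr fun s hs => by simp [hne s hs]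
      rw [h2, h3]

end Splits

/-! ### Multilinearity of the Shestakov–Umirbaev operations -/

section Multilinear

variable {K A : Type*} [CommRing K] [AddCommGroup A] [Module K A]

theorem suLeft_zero (μ : A →ₗ[K] A →ₗ[K] A) (I J : List A) : suLeft μ I J 0 = 0 := by
  cases I <;> cases J <;> simp [suLeft]

theorem suP_nil_left (μ : A →ₗ[K] A →ₗ[K] A) (J : List A) (c : A) : suP μ [] J c = 0 := by
  rw [suP, if_pos (Or.inl rfl)]

theorem suP_nil_right (μ : A →ₗ[K] A →ₗ[K] A) (I : List A) (c : A) : suP μ I [] c = 0 := by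
  rw [suP, if_pos (Or.inr rfl)]

/-- A one-element sequence has two splittings; the one that leaves nothing for p contributes 0. -/
theorem suP_singleton_fundamental (μ : A →ₗ[K] A →ₗ[K] A) {I : List A} (hI : I ≠ []) (b c : A) :
    μ (μ (leftNormed μ I) b) c - μ (leftNormed μ I) (μ b c) =
      ((shuffleSplits I).map fun s => suLeft μ s.1 [] (suP μ s.2 [b] c)).sum := by
  have h := suP_fundamental μ I [b] hI (by simp) c
  have hb : leftNormed μ [b] = b := rfl
  rw [hb] at h
  rw [h]
  simp [shuffleSplits, suP_nil_right, suLeft_zero]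

theorem leftNormed_append (μ : A →ₗ[K] A →ₗ[K] A) {l : List A} (hl : l ≠ []) (a : A) :
    leftNormed μ (l ++ [a]) = μ (leftNormed μ l) a := by
  cases l with
  | nil => exact absurd rfl hl
  | cons b l => simp [leftNormed]

theorem suP_singleton_eq (μ : A →ₗ[K] A →ₗ[K] A) {I : List A} (hI : I ≠ []) (b c : A) :
    suP μ I [b] c = μ (μ (leftNormed μ I) b) c - μ (leftNormed μ I) (μ b c) -
      ((shuffleSplits I).map fun s =>
        if s.1 = [] then 0 else μ (leftNormed μ s.1) (suP μ s.2 [b] c)).sum := by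
  rw [suP_singleton_fundamental μ hI, ← sum_shuffleSplits_nil I fun l => suP μ l [b] c,
    eq_sub_iff_add_eq, ← List.sum_map_add]
  congr 2
  funext s
  obtain ⟨_ | ⟨a, s₁⟩, s₂⟩ := s <;> simp [suLeft]

variable {α : Type*} [DecidableEq α]

/-- `G` is linear in the argument `t`. -/
def LinearAt (K : Type*) {A α : Type*} [CommRing K] [AddCommGroup A] [Module K A] [DecidableEq α]
    (t : α) (G : (α → A) → A) : Prop :=
  ∀ (x : α → A) (k : K) (u v : A), G (Function.update x t (u + k • v)) =
    G (Function.update x t u) + k • G (Function.update x t v)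

/-- `G` does not depend on the argument `t`. -/
def ConstantAt {A α : Type*} [DecidableEq α] (t : α) (G : (α → A) → A) : Prop :=
  ∀ (x : α → A) (u : A), G (Function.update x t u) = G x

namespace LinearAt

variable {t : α} {G G' : (α → A) → A}

theorem zero : LinearAt K t fun _ : α → A => (0 : A) := fun x k u v => by simp

theorem add (hG : LinearAt K t G) (hG' : LinearAt K t G') : LinearAt K t fun x => G x + G' x :=
  fun x k u v => by
    simp only [hG x k u v, hG' x k u v, smul_add]
    abel

theorem sub (hG : LinearAt K t G) (hG' : LinearAt K t G') : LinearAt K t fun x => G x - G' x :=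
  fun x k u v => by
    simp only [hG x k u v, hG' x k u v, smul_sub]
    abel

theorem smul (c : K) (hG : LinearAt K t G) : LinearAt K t fun x => c • G x :=
  fun x k u v => by simp only [hG x k u v, smul_add, smul_comm c k]

theorem bilin_left (μ : A →ₗ[K] A →ₗ[K] A) (hG : LinearAt K t G) (hG' : ConstantAt t G') :
    LinearAt K t fun x => μ (G x) (G' x) :=
  fun x k u v => by simp only [hG x k u v, hG' x, map_add, map_smul, LinearMap.add_apply,
    LinearMap.smul_apply]

theorem bilin_right (μ : A →ₗ[K] A →ₗ[K] A) (hG : ConstantAt t G) (hG' : LinearAt K t G') :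
    LinearAt K t fun x => μ (G x) (G' x) :=
  fun x k u v => by simp only [hG' x k u v, hG x, map_add, map_smul]

theorem list_sum {β : Type*} {G : β → (α → A) → A} (L : List β)
    (h : ∀ s ∈ L, LinearAt K t (G s)) : LinearAt K t fun x => (L.map fun s => G s x).sum := by
  induction L with
  | nil => exact zero
  | cons s L ih =>
    simp only [List.map_cons, List.sum_cons]
    exact (h s (by simp)).add (ih fun s hs => h s (by simp [hs]))

theorem apply_self (t : α) : LinearAt K t fun x : α → A => x t := fun x k u v => by simp

theorem map_update_add (hG : LinearAt K t G) (x : α → A) (u v : A) :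
    G (Function.update x t (u + v)) = G (Function.update x t u) + G (Function.update x t v) := by
  simpa using hG x 1 u v

theorem map_update_smul (hG : LinearAt K t G) (x : α → A) (k : K) (v : A) :
    G (Function.update x t (k • v)) = k • G (Function.update x t v) := by
  have h0 := hG.map_update_add x 0 0
  rw [add_zero, left_eq_add] at h0
  simpa [h0] using hG x k 0 v

end LinearAt

theorem ConstantAt.apply_of_ne {s t : α} (h : s ≠ t) : ConstantAt t fun x : α → A => x s :=
  fun x u => Function.update_of_ne h u x

theorem ConstantAt.map_list {t : α} {l : List α} (ht : t ∉ l) (G : List A → A) :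
    ConstantAt t fun x : α → A => G (l.map x) := fun x u => by
  have : l.map (Function.update x t u) = l.map x := List.map_congr_left fun s hs =>
    Function.update_of_ne (fun h => ht (by rwa [← h])) u x
  simp only [this]

theorem linearAt_leftNormed (μ : A →ₗ[K] A →ₗ[K] A) {t : α} {l : List α} (hl : l.Nodup)
    (ht : t ∈ l) : LinearAt K t fun x : α → A => leftNormed μ (l.map x) := by
  induction l using List.reverseRecOn with
  | nil => simp at ht
  | append_singleton l a ih =>
    rcases eq_or_ne l [] with rfl | hne
    · obtain rfl : t = a := by simpa using ht
      exact LinearAt.apply_self t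
    · have hfun : (fun x : α → A => leftNormed μ ((l ++ [a]).map x)) =
          fun x => μ (leftNormed μ (l.map x)) (x a) := by
        funext x
        rw [List.map_append, List.map_singleton, leftNormed_append μ (by simpa using hne)]
      rw [hfun]
      have hal : a ∉ l := fun h => (List.nodup_append.mp hl).2.2 a h a (by simp) rfl
      by_cases hta : t = a
      · subst hta
        exact LinearAt.bilin_right μ (ConstantAt.map_list hal _) (LinearAt.apply_self t)
      · have htl : t ∈ l := by simpa [hta] using ht
        exact LinearAt.bilin_left μ (ih (List.nodup_append.mp hl).1 htl)
          (ConstantAt.apply_of_ne (Ne.symm hta))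

/-- Strong induction along `suP_singleton_eq`: in each summand of the recursion every argument
occurs exactly once. Multilinearity is needed because the operation on S is constructed from `suP`.
-/
theorem linearAt_suP (μ : A →ₗ[K] A →ₗ[K] A) {p q t : α} (hpq : p ≠ q) (n : ℕ) :
    ∀ l : List α, l.length = n → l.Nodup → p ∉ l → q ∉ l → (t ∈ l ∨ t = p ∨ t = q) →
      LinearAt K t fun x : α → A => suP μ (l.map x) [x p] (x q) := by
  induction n using Nat.strong_induction_on with
  | _ n ih =>
    intro l hln hl hp hq ht
    rcases eq_or_ne l [] with rfl | hne
    · simp only [List.map_nil, suP_nil_left]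
      exact LinearAt.zero
    have hfun : (fun x : α → A => suP μ (l.map x) [x p] (x q)) = fun x =>
        μ (μ (leftNormed μ (l.map x)) (x p)) (x q) - μ (leftNormed μ (l.map x)) (μ (x p) (x q)) -
          ((shuffleSplits l).map fun s => if s.1 = [] then 0 else
            μ (leftNormed μ (s.1.map x)) (suP μ (s.2.map x) [x p] (x q))).sum := by
      funext x
      rw [suP_singleton_eq μ (by simpa using hne), shuffleSplits_map, List.map_map]
      congr 3
      funext s
      simp
    rw [hfun]
    have hp0 : t ≠ p → ConstantAt t fun x : α → A => x p :=
      fun h => ConstantAt.apply_of_ne (Ne.symm h)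
    have hq0 : t ≠ q → ConstantAt t fun x : α → A => x q :=
      fun h => ConstantAt.apply_of_ne (Ne.symm h)
    have hl0 : ∀ l : List α, t ∉ l → ConstantAt t fun x : α → A => leftNormed μ (l.map x) :=
      fun l h => ConstantAt.map_list h _
    refine LinearAt.sub (LinearAt.sub ?_ ?_) (LinearAt.list_sum _ fun s hs => ?_)
    · rcases ht with ht | rfl | rfl
      · exact LinearAt.bilin_left μ (LinearAt.bilin_left μ (linearAt_leftNormed μ hl ht)
          (hp0 fun h => hp (h ▸ ht))) (hq0 fun h => hq (h ▸ ht))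
      · exact LinearAt.bilin_left μ (LinearAt.bilin_right μ (hl0 l hp) (LinearAt.apply_self t))
          (hq0 hpq)
      · refine LinearAt.bilin_right μ (fun x u => ?_) (LinearAt.apply_self t)
        exact congrArg₂ (fun a b => μ a b) (hl0 l hq x u) (hp0 (Ne.symm hpq) x u)
    · rcases ht with ht | rfl | rfl
      · refine LinearAt.bilin_left μ (linearAt_leftNormed μ hl ht) fun x u => ?_
        exact congrArg₂ (fun a b => μ a b) (hp0 (fun h => hp (h ▸ ht)) x u)
          (hq0 (fun h => hq (h ▸ ht)) x u)
      · exact LinearAt.bilin_right μ (hl0 l hp) (LinearAt.bilin_left μ (LinearAt.apply_self t)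
          (hq0 hpq))
      · exact LinearAt.bilin_right μ (hl0 l hq) (LinearAt.bilin_right μ (hp0 (Ne.symm hpq))
          (LinearAt.apply_self t))
    · by_cases h1 : s.1 = []
      · simp only [h1, if_true]
        exact LinearAt.zero
      simp only [h1, if_false]
      have hperm := perm_of_mem_shuffleSplits l s hs
      have hlen := length_of_mem_shuffleSplits l s hs
      have hnd := List.nodup_append.mp (hperm.nodup_iff.mpr hl)
      have hmem : ∀ r, r ∈ l ↔ r ∈ s.1 ∨ r ∈ s.2 := fun r => by
        rw [← hperm.mem_iff, List.mem_append]
      have hlt : s.2.length < n := by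
        have := List.length_pos_iff.mpr h1
        omega
      have hps : p ∉ s.1 ∧ p ∉ s.2 := by rw [hmem] at hp; tauto
      have hqs : q ∉ s.1 ∧ q ∉ s.2 := by rw [hmem] at hq; tauto
      have hrec := ih _ hlt s.2 rfl hnd.2.1 hps.2 hqs.2
      rcases ht with ht | rfl | rfl
      · rcases (hmem t).mp ht with h | h
        · have ht2 : t ∉ s.2 := fun h' => hnd.2.2 t h t h' rfl
          refine LinearAt.bilin_left μ (linearAt_leftNormed μ hnd.1 h) fun x u => ?_
          have h2 : (Function.update x t u) p = x p := hp0 (fun h => hp (h ▸ ht)) x u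
          have h3 : (Function.update x t u) q = x q := hq0 (fun h => hq (h ▸ ht)) x u
          rw [h2, h3]
          exact ConstantAt.map_list ht2 (fun I => suP μ I [x p] (x q)) x u
        · have ht1 : t ∉ s.1 := fun h' => hnd.2.2 t h' t h rfl
          exact LinearAt.bilin_right μ (hl0 _ ht1) (hrec (Or.inl h))
      · exact LinearAt.bilin_right μ (hl0 _ hps.1) (hrec (Or.inr (Or.inl rfl)))
      · exact LinearAt.bilin_right μ (hl0 _ hqs.1) (hrec (Or.inr (Or.inr rfl)))

end Multilinear

/-! ### Division by a unipotent function of finite sets -/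

section Convolution

variable {C : Type*} [Ring C] {α : Type*} [DecidableEq α]

/-- The term U = ∅ isolates φ T, and all others involve smaller sets. -/
theorem eq_of_sum_powerset_mul_eq {b φ ψ : Finset α → C} (hb : b ∅ = 1)
    (h : ∀ T, ∑ U ∈ T.powerset, b U * φ (T \ U) = ∑ U ∈ T.powerset, b U * ψ (T \ U)) : φ = ψ := by
  funext T
  induction T using Finset.strongInduction with
  | H T ih =>
    have h1 := h T
    rw [← add_sum_erase _ _ (empty_mem_powerset T), ← add_sum_erase _ (fun U => b U * ψ (T \ U))
      (empty_mem_powerset T), hb, one_mul, one_mul, sdiff_empty,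
      sum_congr rfl (g := fun U => b U * ψ (T \ U))] at h1
    · exact add_right_cancel h1
    · intro U hU
      rw [mem_erase, mem_powerset] at hU
      rw [ih _ (sdiff_ssubset hU.2 (nonempty_iff_ne_empty.mpr hU.1))]

/-- The sum of `b U_1 ⋯ b U_k c V` over all ordered partitions of `T` into sets `U_1, …, U_k, V`
with nonempty `U_j`. -/
def chainSum (b c : Finset α → C) : ℕ → Finset α → C
  | 0, T => c T
  | k + 1, T => ∑ U ∈ T.powerset, (if U = ∅ then 0 else b U) * chainSum b c k (T \ U)

theorem chainSum_eq_zero {b c : Finset α → C} (hc : c ∅ = 0) (k : ℕ) (T : Finset α)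
    (hT : #T ≤ k) : chainSum b c k T = 0 := by
  induction k generalizing T with
  | zero =>
    rw [card_eq_zero.mp (Nat.le_zero.mp hT)]
    exact hc
  | succ k ih =>
    refine sum_eq_zero fun U hU => ?_
    split_ifs with h
    · rw [zero_mul]
    · have h1 := card_sdiff_add_card_eq_card (mem_powerset.mp hU)
      have h2 := card_pos.mpr (nonempty_iff_ne_empty.mpr h)
      rw [ih _ (by omega), mul_zero]

/-- Geometric series for the inverse of b under convolution: split b into its value 1 at ∅ and the
rest. The rest raises the length of a chain by one, and the alternating sum telescopes. -/
theorem sum_powerset_mul_alternating_chainSum {b c : Finset α → C} (hb : b ∅ = 1) (hc : c ∅ = 0)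
    {m : ℕ} (T : Finset α) (hT : #T ≤ m) :
    ∑ U ∈ T.powerset, b U * ∑ k ∈ range m, (-1) ^ k * chainSum b c k (T \ U) = c T := by
  have h1 : ∀ U ∈ T.powerset, b U * ∑ k ∈ range m, (-1) ^ k * chainSum b c k (T \ U) =
      (if U = ∅ then ∑ k ∈ range m, (-1) ^ k * chainSum b c k T else 0) +
        ∑ k ∈ range m, (-1) ^ k * ((if U = ∅ then 0 else b U) * chainSum b c k (T \ U)) := by
    intro U _
    split_ifs with h
    · subst h
      simp [hb]
    · rw [zero_add, mul_sum]
      refine sum_congr rfl fun k _ => ?_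
      rw [← mul_assoc, ← mul_assoc, ((Commute.neg_one_left (b U)).pow_left k).eq]
  rw [sum_congr rfl h1, sum_add_distrib, sum_ite_eq', if_pos (empty_mem_powerset T), sum_comm]
  simp only [← mul_sum]
  have h2 : ∀ k, ∑ U ∈ T.powerset, (if U = ∅ then 0 else b U) * chainSum b c k (T \ U) =
      chainSum b c (k + 1) T := fun _ => rfl
  simp only [h2]
  -- The end term of the telescope vanishes: `m` nonempty blocks use up all of T, and c ∅ = 0.
  have h3 := sum_range_succ (fun k => (-1) ^ k * chainSum b c k T) m
  rw [sum_range_succ', chainSum_eq_zero hc m T hT, mul_zero, add_zero] at h3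
  rw [← h3, pow_zero, one_mul, add_right_comm, ← sum_add_distrib, sum_eq_zero]
  · exact zero_add _
  · intro k _
    rw [pow_succ, mul_neg_one, neg_mul, neg_add_cancel]

variable [Fintype α]

/-- The maps sending `T` to `{0, …, k}` and all other elements to `k + 1`. -/
def blockMaps (k : ℕ) (T : Finset α) : Finset (α → ℕ) :=
  Fintype.piFinset fun t => if t ∈ T then range (k + 1) else {k + 1}

theorem mem_blockMaps {k : ℕ} {T : Finset α} {f : α → ℕ} :
    f ∈ blockMaps k T ↔ ∀ t, (t ∈ T → f t ≤ k) ∧ (t ∉ T → f t = k + 1) := by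
  rw [blockMaps, Fintype.mem_piFinset]
  refine forall_congr' fun t => ?_
  by_cases h : t ∈ T <;> simp [h]

theorem chainSum_eq_sum_blockMaps {b c : Finset α → C} (k : ℕ) (T : Finset α) :
    chainSum b c k T = ∑ f ∈ blockMaps k T,
      ((List.range k).map fun r =>
        if univ.filter (f · = r) = ∅ then 0 else b (univ.filter (f · = r))).prod *
          c (univ.filter (f · = k)) := by
  induction k generalizing T with
  | zero =>
    rw [sum_eq_single (fun t => if t ∈ T then 0 else 1)]
    · simp only [List.range_zero, List.map_nil, List.prod_nil, one_mul, chainSum]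
      congr 1
      ext t
      by_cases h : t ∈ T <;> simp [h]
    · intro f hf hne
      refine absurd (funext fun t => ?_) hne
      have := mem_blockMaps.mp hf t
      split_ifs with h
      · exact Nat.le_zero.mp (this.1 h)
      · exact this.2 h
    · intro h
      refine absurd (mem_blockMaps.mpr fun t => ?_) h
      by_cases h : t ∈ T <;> simp [h]
  | succ k ih =>
    rw [chainSum]
    simp only [ih, mul_sum]
    rw [sum_sigma']
    -- The first set U becomes the block of value 0 and the other values move up by one. In the
    -- inverse, elements of U get the value `k + 1`, which marks the complement of T \ U.
    refine sum_bij' (fun p _ t => if t ∈ p.1 then 0 else p.2 t + 1)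
      (fun f _ => ⟨univ.filter (f · = 0), fun t => if f t = 0 then k + 1 else f t - 1⟩)
      ?_ ?_ ?_ ?_ ?_
    · rintro ⟨U, f⟩ h
      rw [mem_sigma, mem_powerset, mem_blockMaps] at h
      rw [mem_blockMaps]
      intro t
      have h1 := @h.1 t
      have h2 := h.2 t
      simp only [mem_sdiff] at h1 h2 ⊢
      by_cases a : t ∈ U <;> by_cases b : t ∈ T <;> simp_all
    · intro f hf
      rw [mem_blockMaps] at hf
      rw [mem_sigma, mem_powerset, mem_blockMaps]
      refine ⟨fun t ht => ?_, fun t => ?_⟩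
      · rw [mem_filter] at ht
        by_contra h
        have := (hf t).2 h
        omega
      · have := hf t
        simp only [mem_sdiff, mem_filter, mem_univ, true_and]
        by_cases a : f t = 0 <;> by_cases b : t ∈ T <;> simp_all
    · rintro ⟨U, f⟩ h
      rw [mem_sigma, mem_powerset, mem_blockMaps] at h
      have h1 : univ.filter (fun t => (if t ∈ U then 0 else f t + 1) = 0) = U := by
        ext t
        by_cases a : t ∈ U <;> simp [a]
      have h2 : (fun t => if (if t ∈ U then 0 else f t + 1) = 0 then k + 1
          else (if t ∈ U then 0 else f t + 1) - 1) = f := by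
        funext t
        have h2 := h.2 t
        simp only [mem_sdiff] at h2
        by_cases a : t ∈ U <;> simp_all
      simp only [h1, h2]
    · intro f hf
      funext t
      by_cases a : f t = 0 <;> simp [a]
      omega
    · rintro ⟨U, f⟩ h
      rw [mem_sigma, mem_powerset, mem_blockMaps] at h
      have h0 : univ.filter (fun t => (if t ∈ U then 0 else f t + 1) = 0) = U := by
        ext t
        by_cases a : t ∈ U <;> simp [a]
      have h1 : ∀ r ≤ k, univ.filter (fun t => (if t ∈ U then 0 else f t + 1) = r + 1) =
          univ.filter (f · = r) := by
        intro r hr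
        ext t
        have h2 := h.2 t
        simp only [mem_sdiff] at h2
        by_cases a : t ∈ U
        · have : f t = k + 1 := h2.2 (fun h => h.2 a)
          simp only [mem_filter, mem_univ, true_and, if_pos a, this]
          omega
        · simp [a]
      rw [List.range_succ_eq_map, List.map_cons, List.prod_cons, List.map_map]
      dsimp only
      rw [h0, h1 k le_rfl, mul_assoc]
      congr 3
      refine List.map_congr_left fun r hr => ?_
      rw [List.mem_range] at hr
      simp only [Function.comp_apply, Nat.succ_eq_add_one, h1 r hr.le]

end Convolution

/-! ### Brackets of homogeneous elements -/

section Homogeneous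

open MarkedRing

variable {K S : Type*} [Field K] [NonUnitalRing S] [Module K S] [IsScalarTower K S S]
  [SMulCommClass K S S] (𝒜 : ℕ → Submodule K S) [DirectSum.Decomposition 𝒜]

theorem starMul_eq_nsmul {m : ℕ} {a : S} (ha : a ∈ 𝒜 m) (b : S) :
    starMul 𝒜 a b = (m + 1) • (a * b) := by
  rw [starMul_apply_of_mem 𝒜 ha, ← Nat.cast_smul_eq_nsmul K]
  push_cast
  rfl

variable [SetLike.GradedMul 𝒜]

theorem starMul_mem {m n : ℕ} {a b : S} (ha : a ∈ 𝒜 m) (hb : b ∈ 𝒜 n) :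
    starMul 𝒜 a b ∈ 𝒜 (m + n) := by
  rw [starMul_eq_nsmul 𝒜 ha]
  exact nsmul_mem (SetLike.mul_mem_graded ha hb) _

/-- For b of degree e the factor is (d+e+1)(d+1) - (d+1)(e+1) = d(d+1). It does not involve e, so
the formula extends to all b by additivity. -/
theorem starMul_assoc_defect {d : ℕ} {a : S} (ha : a ∈ 𝒜 d) (b c : S) :
    starMul 𝒜 (starMul 𝒜 a b) c - starMul 𝒜 a (starMul 𝒜 b c) =
      (d * (d + 1)) • (a * (b * c)) := by
  induction b using DirectSum.Decomposition.inductionOn 𝒜 with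
  | zero => simp
  | homogeneous b =>
    rename_i e
    rw [starMul_eq_nsmul 𝒜 (starMul_mem 𝒜 ha b.2), starMul_eq_nsmul 𝒜 ha, starMul_eq_nsmul 𝒜 ha,
      starMul_eq_nsmul 𝒜 b.2, smul_mul_assoc, mul_smul_comm, smul_smul, smul_smul, mul_assoc,
      sub_eq_iff_eq_add, ← add_smul]
    congr 1
    ring
  | add b b' hb hb' =>
    have h : starMul 𝒜 (starMul 𝒜 a (b + b')) c - starMul 𝒜 a (starMul 𝒜 (b + b') c) =
        (starMul 𝒜 (starMul 𝒜 a b) c - starMul 𝒜 a (starMul 𝒜 b c)) +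
          (starMul 𝒜 (starMul 𝒜 a b') c - starMul 𝒜 a (starMul 𝒜 b' c)) := by
      simp only [map_add, LinearMap.add_apply]
      abel
    rw [h, hb, hb', ← smul_add, ← mul_add, ← add_mul]

variable {m : ℕ} {i : Fin m → ℕ} {x : Fin m → S}

/-- The left-normed product contains all factors of N(I) but the last, as each multiplication on the
right by a further element contributes the degree so far plus one. -/
theorem leftNormed_starMul (hx : ∀ t, x t ∈ 𝒜 (i t)) {l : List (Fin m)} (hl : l ≠ []) :
    leftNormed (starMul 𝒜) (l.map x) ∈ 𝒜 (l.map i).sum ∧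
      ((l.map i).sum + 1) • ((leftNormed (starMul 𝒜) (l.map x) : S) : Unitization K S) =
        gradedCoeff i (fun t => (x t : Unitization K S)) l := by
  induction l using List.reverseRecOn with
  | nil => exact absurd rfl hl
  | append_singleton l a ih =>
    rcases eq_or_ne l [] with rfl | hne
    · simp [leftNormed, gradedCoeff, gradedN, hx a]
    · obtain ⟨h1, h2⟩ := ih hne
      rw [List.map_append, List.map_append, List.map_singleton, List.map_singleton,
        leftNormed_append _ (by simpa using hne)]
      refine ⟨?_, ?_⟩
      · rw [List.sum_append, List.sum_singleton]
        exact starMul_mem 𝒜 h1 (hx a)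
      · rw [starMul_eq_nsmul 𝒜 h1, Unitization.inr_smul, Unitization.inr_mul, ← smul_mul_assoc, h2,
          gradedCoeff, gradedCoeff, List.map_append, List.map_append, List.map_singleton,
          List.map_singleton, gradedN_append, List.prod_append, List.prod_singleton, mul_comm,
          mul_smul, smul_mul_assoc]

theorem inr_sum {β : Type*} (s : Finset β) (F : β → S) :
    ((∑ b ∈ s, F b : S) : Unitization K S) = ∑ b ∈ s, (F b : Unitization K S) :=
  map_sum (Unitization.inrNonUnitalAlgHom K S) F s

theorem inr_suLeft_starMul (hx : ∀ t, x t ∈ 𝒜 (i t)) (l : List (Fin m)) (w : S) :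
    ((suLeft (starMul 𝒜) (l.map x) [] w : S) : Unitization K S) =
      gradedCoeff i (fun t => (x t : Unitization K S)) l * (w : Unitization K S) := by
  rcases eq_or_ne l [] with rfl | hl
  · simp [suLeft, gradedCoeff, gradedN]
  · obtain ⟨h1, h2⟩ := leftNormed_starMul 𝒜 hx hl
    have h3 : suLeft (starMul 𝒜) (l.map x) [] w =
        starMul 𝒜 (leftNormed (starMul 𝒜) (l.map x)) w := by
      cases l with
      | nil => exact absurd rfl hl
      | cons a l => rfl
    rw [h3, starMul_eq_nsmul 𝒜 h1, Unitization.inr_smul, Unitization.inr_mul, ← smul_mul_assoc, h2]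

/-- The elements of `T` in increasing order. -/
def sortedList (T : Finset (Fin m)) : List (Fin m) := (List.finRange m).filter (· ∈ T)

theorem nodup_sortedList (T : Finset (Fin m)) : (sortedList T).Nodup :=
  (List.nodup_finRange m).filter _

theorem toFinset_sortedList (T : Finset (Fin m)) : (sortedList T).toFinset = T := by
  ext t
  simp [sortedList]

theorem sortedList_filter {U T : Finset (Fin m)} (h : U ⊆ T) :
    (sortedList T).filter (· ∈ U) = sortedList U := by
  rw [sortedList, sortedList, List.filter_filter]
  refine List.filter_congr fun t _ => ?_
  have := @h t
  by_cases h1 : t ∈ U <;> simp_all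

theorem sortedList_univ : sortedList (univ : Finset (Fin m)) = List.finRange m := by
  simp [sortedList]

theorem sortedList_empty : sortedList (∅ : Finset (Fin m)) = [] := by
  simp [sortedList]

theorem sortedList_ne_nil {T : Finset (Fin m)} (hT : T ≠ ∅) : sortedList T ≠ [] := fun h => hT (by
  rw [← toFinset_sortedList T, h, List.toFinset_nil])

theorem sum_map_sortedList (i : Fin m → ℕ) (T : Finset (Fin m)) :
    ((sortedList T).map i).sum = ∑ t ∈ T, i t := by
  rw [← List.sum_toFinset i (nodup_sortedList T), toFinset_sortedList]

/-- The coefficient `N(i_T) x_T`. -/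
def blockCoeff {C : Type*} [Ring C] (i : Fin m → ℕ) (x : Fin m → C) (T : Finset (Fin m)) : C :=
  gradedCoeff i x (sortedList T)

theorem blockCoeff_empty {C : Type*} [Ring C] (i : Fin m → ℕ) (x : Fin m → C) :
    blockCoeff i x ∅ = 1 := by
  simp [blockCoeff, sortedList_empty, gradedCoeff, gradedN]

/-- The fundamental formula with the associator d(d+1) a_I (bc) inserted: one factor d + 1 completes
N(I), and d = |I| remains. This is the convolution equation satisfied by the loop operation. -/
theorem sum_blockCoeff_mul_suP (hx : ∀ t, x t ∈ 𝒜 (i t)) (b c : S) (T : Finset (Fin m)) :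
    ∑ U ∈ T.powerset, blockCoeff i (fun t => (x t : Unitization K S)) U *
        ((suP (starMul 𝒜) ((sortedList (T \ U)).map x) [b] c : S) : Unitization K S) =
      (∑ t ∈ T, i t) • blockCoeff i (fun t => (x t : Unitization K S)) T *
        ((b * c : S) : Unitization K S) := by
  rcases eq_or_ne T ∅ with rfl | hT
  · simp [sortedList_empty, suP_nil_left]
  · have hne := sortedList_ne_nil hT
    have h1 := suP_singleton_fundamental (starMul 𝒜) (I := (sortedList T).map x)
      (by simpa using hne) b c
    obtain ⟨h2, h3⟩ := leftNormed_starMul 𝒜 hx hne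
    rw [starMul_assoc_defect 𝒜 h2, shuffleSplits_map, List.map_map] at h1
    have h4 := sum_map_shuffleSplits_eq_sum_powerset (fun s t =>
      suLeft (starMul 𝒜) (s.map x) [] (suP (starMul 𝒜) (t.map x) [b] c)) (nodup_sortedList T)
    have h5 := h1.trans h4
    rw [toFinset_sortedList] at h5
    have h6 := congrArg (fun s : S => (s : Unitization K S)) h5
    simp only [inr_sum, inr_suLeft_starMul 𝒜 hx] at h6
    rw [mul_smul, Unitization.inr_smul, Unitization.inr_smul, Unitization.inr_mul, ← smul_mul_assoc,
      h3, sum_map_sortedList] at h6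
    rw [smul_mul_assoc, blockCoeff, h6]
    refine sum_congr rfl fun U hU => ?_
    rw [sortedList_filter (mem_powerset.mp hU), sortedList_filter sdiff_subset, blockCoeff]

/-- The sum over ordered partitions with alternating signs that gives the explicit formula. -/
def alternatingSum {C : Type*} [Ring C] (i : Fin m → ℕ) (x : Fin m → C) (T : Finset (Fin m)) : C :=
  ∑ k ∈ range m, (-1) ^ k *
    chainSum (blockCoeff i x) (fun T => (∑ t ∈ T, i t) • blockCoeff i x T) k T

theorem sum_blockCoeff_mul_alternatingSum {C : Type*} [Ring C] (i : Fin m → ℕ) (x : Fin m → C)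
    (T : Finset (Fin m)) : ∑ U ∈ T.powerset, blockCoeff i x U * alternatingSum i x (T \ U) =
      (∑ t ∈ T, i t) • blockCoeff i x T :=
  sum_powerset_mul_alternating_chainSum (blockCoeff_empty i x) (by simp) T
    ((card_le_univ T).trans_eq (Fintype.card_fin m))

theorem inr_suP_starMul (hx : ∀ t, x t ∈ 𝒜 (i t)) (b c : S) :
    ((suP (starMul 𝒜) ((List.finRange m).map x) [b] c : S) : Unitization K S) =
      alternatingSum i (fun t => (x t : Unitization K S)) univ *
        ((b * c : S) : Unitization K S) := by
  have h := eq_of_sum_powerset_mul_eq (blockCoeff_empty i fun t => (x t : Unitization K S))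
    (φ := fun T => ((suP (starMul 𝒜) ((sortedList T).map x) [b] c : S) : Unitization K S))
    (ψ := fun T => alternatingSum i (fun t => (x t : Unitization K S)) T *
      ((b * c : S) : Unitization K S)) fun T => by
        rw [sum_blockCoeff_mul_suP 𝒜 hx]
        simp only [← mul_assoc, ← sum_mul]
        rw [sum_blockCoeff_mul_alternatingSum]
  have h1 := congrFun h univ
  rwa [sortedList_univ] at h1

theorem prod_map_smul {β C : Type*} [Ring C] (n : β → ℕ) (p : β → C) (L : List β) :
    (L.map fun r => n r • p r).prod = (L.map n).prod • (L.map p).prod := by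
  induction L with
  | nil => simp
  | cons a L ih =>
    simp only [List.map_cons, List.prod_cons]
    rw [ih, smul_mul_smul_comm]

theorem inr_foldr_mul (l : List S) (w : S) :
    ((l.foldr (fun x y => x * y) w : S) : Unitization K S) =
      (l.map fun x : S => (x : Unitization K S)).prod * (w : Unitization K S) := by
  induction l with
  | nil => simp
  | cons a l ih => simp [ih, mul_assoc]

theorem blockCoeff_chain {C : Type*} [Ring C] (i : Fin m → ℕ) (x : Fin m → C) (k : ℕ) :
    chainSum (blockCoeff i x) (fun T => (∑ t ∈ T, i t) • blockCoeff i x T) k univ =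
      ∑ f : Fin m → Fin (k + 1) with Function.Surjective f,
        (((orderedBlock f (Fin.last k)).map i).sum * ∏ r, gradedN ((orderedBlock f r).map i)) •
          (((List.finRange (k + 1)).flatMap (orderedBlock f)).map x).prod := by
  have hblock : ∀ (f : Fin m → Fin (k + 1)) (r : Fin (k + 1)),
      sortedList (univ.filter fun t => (f t : ℕ) = r) = orderedBlock f r := by
    intro f r
    rw [sortedList, orderedBlock]
    refine List.filter_congr fun t _ => ?_
    simp [Fin.ext_iff]
  rw [chainSum_eq_sum_blockMaps]
  symm
  rw [sum_filter]
  refine sum_bij (fun f _ t => (f t : ℕ)) ?_ ?_ ?_ ?_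
  · intro f _
    exact mem_blockMaps.mpr fun t => ⟨fun _ => Nat.lt_succ_iff.mp (f t).2,
      fun h => absurd (mem_univ t) h⟩
  · intro f _ g _ h
    exact funext fun t => Fin.ext (congrFun h t)
  · intro f hf
    have h := mem_blockMaps.mp hf
    exact ⟨fun t => ⟨f t, Nat.lt_succ_iff.mpr ((h t).1 (mem_univ t))⟩, mem_univ _, rfl⟩
  · intro f _
    have hprod : ((List.range k).map fun r => if univ.filter (fun t => (f t : ℕ) = r) = ∅ then 0
          else blockCoeff i x (univ.filter fun t => (f t : ℕ) = r)) =
        (List.finRange k).map fun r : Fin k => if univ.filter (fun t => (f t : ℕ) = r) = ∅ then 0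
          else blockCoeff i x (univ.filter fun t => (f t : ℕ) = r) := by
      rw [← List.map_coe_finRange_eq_range, List.map_map]
      rfl
    rw [hprod]
    split_ifs with hf
    · have hne : ∀ r : Fin (k + 1), univ.filter (fun t => (f t : ℕ) = r) ≠ ∅ := fun r h => by
        obtain ⟨t, rfl⟩ := hf r
        exact notMem_empty t (h ▸ mem_filter.mpr ⟨mem_univ t, rfl⟩)
      have h1 : ((List.finRange k).map fun r : Fin k =>
          if univ.filter (fun t => (f t : ℕ) = r) = ∅ then 0
            else blockCoeff i x (univ.filter fun t => (f t : ℕ) = r)) =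
          (List.finRange k).map fun r => gradedN ((orderedBlock f r.castSucc).map i) •
            ((orderedBlock f r.castSucc).map x).prod := by
        refine List.map_congr_left fun r _ => ?_
        have h0 := hne r.castSucc
        rw [Fin.val_castSucc] at h0
        rw [if_neg h0, blockCoeff, gradedCoeff]
        have := hblock f r.castSucc
        rw [Fin.val_castSucc] at this
        rw [this]
      have h2 := hblock f (Fin.last k)
      rw [Fin.val_last] at h2
      rw [h1, prod_map_smul, blockCoeff, gradedCoeff, ← sum_map_sortedList, h2, smul_smul,
        smul_mul_smul_comm, Fin.prod_univ_castSucc, ← List.prod_ofFn, List.ofFn_eq_map,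
        List.finRange_succ_last, List.flatMap_append, List.map_append, List.prod_append,
        List.flatMap_map, List.map_flatMap]
      congr 1
      · ring
      · congr 1
        · rw [List.flatMap, List.prod_flatten, List.map_map]
          rfl
        · simp
    · rw [Function.Surjective] at hf
      push Not at hf
      obtain ⟨r, hr⟩ := hf
      have hempty : univ.filter (fun t => (f t : ℕ) = r) = ∅ :=
        filter_eq_empty_iff.mpr fun t _ h => hr t (Fin.ext h)
      -- An empty last block has degree sum 0; any other empty block puts a zero factor into the
      -- product.
      refine Fin.lastCases (fun hr => ?_) (fun r hr => ?_) r hempty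
      · rw [Fin.val_last] at hr
        rw [hr]
        simp
      · rw [List.prod_eq_zero, zero_mul]
        refine List.mem_map.mpr ⟨r, List.mem_finRange r, ?_⟩
        rw [Fin.val_castSucc] at hr
        exact if_pos hr

theorem inr_explicitBracket (i : Fin m → ℕ) (x : Fin m → S) (b c : S) :
    ((explicitBracket i x b c : S) : Unitization K S) =
      alternatingSum i (fun t => (x t : Unitization K S)) univ *
        ((c * b - b * c : S) : Unitization K S) := by
  rw [explicitBracket, alternatingSum, inr_sum, sum_mul]
  refine sum_congr rfl fun k _ => ?_
  rw [blockCoeff_chain, inr_sum, mul_sum, sum_mul]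
  refine sum_congr (by congr) fun f _ => ?_
  rw [Unitization.inr_smul, inr_foldr_mul, List.map_map, ← smul_mul_assoc]
  congr 1
  have h : ∀ (n : ℕ) (v : Unitization K S), ((-1 : ℤ) ^ k) • (n : ℤ) • v = (-1) ^ k * (n • v) := by
    intro n v
    rw [natCast_zsmul]
    rcases Nat.even_or_odd k with h | h <;> simp [h.neg_one_pow]
  rw [← h, ← mul_smul]
  congr 1
  push_cast
  ring

end Homogeneous

/-! ### Multilinearity -/

section Multilinear

variable {K A : Type*} [CommRing K] [AddCommGroup A] [Module K A] {n : ℕ}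

/-- A function that is linear in each variable, as a multilinear map. -/
def multilinearOfLinearAt (G : (Fin n → A) → A) (h : ∀ t, LinearAt K t G) :
    MultilinearMap K (fun _ : Fin n => A) A where
  toFun := G
  map_update_add' {inst} x t u v := by
    obtain rfl := Subsingleton.elim inst (instDecidableEqFin n)
    exact (h t).map_update_add x u v
  map_update_smul' {inst} x t k v := by
    obtain rfl := Subsingleton.elim inst (instDecidableEqFin n)
    exact (h t).map_update_smul x k v

end Multilinear

/-! ### N-sequence -/

namespace SubstLoop

variable {K S : Type*} [Field K] [NonUnitalRing S] [Module K S] [IsScalarTower K S S]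
  [SMulCommClass K S S] {𝒜 : ℕ → Submodule K S} [SetLike.GradedMul 𝒜]

theorem mem_filtration_iff_toUnipotent {i : ℕ} {f : SubstLoop 𝒜} :
    f ∈ filtration 𝒜 i ↔ EqUpTo i (toUnipotent f).1 1 := mem_filtration_iff

/-- Positivity of the number of variables is carried through the induction: the estimate for
deviations requires each inner bracket to lie in a term of positive index. -/
theorem bracket_mem_filtration {n : ℕ} {P : (Fin n → SubstLoop 𝒜) → SubstLoop 𝒜}
    (hP : IsLoopBracket n P) : 1 ≤ n ∧ ∀ i : Fin n → ℕ, (∀ j, 1 ≤ i j) →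
      ∀ a : Fin n → SubstLoop 𝒜, (∀ j, a j ∈ filtration 𝒜 (i j)) →
        P a ∈ filtration 𝒜 (∑ j, i j) := by
  induction hP with
  | var => exact ⟨le_rfl, fun i _ a ha => by simpa using ha 0⟩
  | comm _ _ ihP ihR =>
    refine ⟨ihP.1.trans (Nat.le_add_right _ _), fun i hi a ha => ?_⟩
    rw [Fin.sum_univ_add, mem_filtration_iff_toUnipotent, toUnipotent_comm]
    exact UnipotentSeries.eqUpTo_comm
      (mem_filtration_iff_toUnipotent.mp (ihP.2 _ (fun _ => hi _) _ fun _ => ha _))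
      (mem_filtration_iff_toUnipotent.mp (ihR.2 _ (fun _ => hi _) _ fun _ => ha _))
  | @dev n d m P _ ih =>
    refine ⟨(ih 0).1.trans (single_le_sum (f := m) (fun _ _ => Nat.zero_le _) (mem_univ 0)),
      fun i hi a ha => ?_⟩
    have hsum : ∑ j, i j = ∑ j, ∑ t, i (finSigmaFinEquiv ⟨j, t⟩) := by
      rw [← finSigmaFinEquiv.sum_comp, Fintype.sum_sigma]
    rw [hsum, mem_filtration_iff_toUnipotent, toUnipotent_deviation]
    refine MarkedRing.eqUpTo_deviation d (fun j => ?_) fun j =>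
      mem_filtration_iff_toUnipotent.mp ((ih j).2 _ (fun _ => hi _) _ fun _ => ha _)
    exact (hi (finSigmaFinEquiv ⟨j, ⟨0, (ih j).1⟩⟩)).trans
      (single_le_sum (f := fun t => i (finSigmaFinEquiv ⟨j, t⟩)) (fun _ _ => Nat.zero_le _)
        (mem_univ _))

theorem isNSequence_filtration : IsNSequence (filtration 𝒜) where
  one := filtration_one
  anti i _ := filtration_anti i.le_succ
  normal i _ := isNormalSubloop_filtration i
  bracket_mem _ _ hP := (bracket_mem_filtration hP).2

/-! ### Induced operations -/

theorem induces_of_coeff {n : ℕ} [NeZero n] {P : (Fin n → SubstLoop 𝒜) → SubstLoop 𝒜}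
    {p : MultilinearMap K (fun _ : Fin n => S) S}
    (h : ∀ i : Fin n → ℕ, (∀ t, 1 ≤ i t) → ∀ x : (t : Fin n) → 𝒜 (i t),
      ∀ a : Fin n → SubstLoop 𝒜, (∀ t, EqUpTo (i t) (toUnipotent (a t)).1 1) →
        (∀ t, PowerSeries.coeff (i t) (toUnipotent (a t)).1 =
          (((x t : 𝒜 (i t)) : S) : Unitization K S)) →
        EqUpTo (∑ t, i t) (toUnipotent (P a)).1 1 ∧
          PowerSeries.coeff (∑ t, i t) (toUnipotent (P a)).1 =
            ((p fun t => (x t : S) : S) : Unitization K S)) :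
    Induces 𝒜 P p := by
  intro i hi x
  have hi0 : ∀ t, i t ≠ 0 := fun t => Nat.one_le_iff_ne_zero.mp (hi t)
  have hpos : 1 ≤ ∑ t, i t := (hi 0).trans
    (single_le_sum (f := i) (fun _ _ => Nat.zero_le _) (mem_univ 0))
  refine ⟨?_, fun a ha => ?_⟩
  · obtain ⟨s, hs, hs'⟩ := (P fun t => single 𝒜 (i t) (x t)).2.2 _ hpos
    have h1 := (h i hi x (fun t => single 𝒜 (i t) (x t)) (fun t => eqUpTo_single (i t) (x t))
      fun t => coeff_single (i t) (hi0 t) (x t)).2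
    rw [toUnipotent_val, hs'] at h1
    rwa [← Unitization.inr_injective h1]
  · have ha' := fun t => (mem_ident_iff (hi0 t) (x t) (a t)).mp (ha t)
    exact (mem_ident_iff (Nat.one_le_iff_ne_zero.mp hpos) _ _).mpr
      (h i hi x a (fun t => (ha' t).1) fun t => (ha' t).2)

theorem Induces.eq_of_mem {n : ℕ} [NeZero n] {P : (Fin n → SubstLoop 𝒜) → SubstLoop 𝒜}
    {p p' : MultilinearMap K (fun _ : Fin n => S) S} (h : Induces 𝒜 P p) (h' : Induces 𝒜 P p')
    {i : Fin n → ℕ} (hi : ∀ t, 1 ≤ i t) (x : (t : Fin n) → 𝒜 (i t)) :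
    (p fun t => (x t : S)) = p' fun t => (x t : S) := by
  have hi0 : ∀ t, i t ≠ 0 := fun t => Nat.one_le_iff_ne_zero.mp (hi t)
  have hpos : ∑ t, i t ≠ 0 := Nat.one_le_iff_ne_zero.mp ((hi 0).trans
    (single_le_sum (f := i) (fun _ _ => Nat.zero_le _) (mem_univ 0)))
  have ha : ∀ t, single 𝒜 (i t) (x t) ∈ ident 𝒜 (i t) (x t) := fun t =>
    (mem_ident_iff (hi0 t) _ _).mpr ⟨eqUpTo_single (i t) (x t), coeff_single (i t) (hi0 t) (x t)⟩
  obtain ⟨_, h1⟩ := h i hi x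
  obtain ⟨_, h2⟩ := h' i hi x
  have h3 := ((mem_ident_iff hpos _ _).mp (h1 _ ha)).2
  rw [((mem_ident_iff hpos _ _).mp (h2 _ ha)).2] at h3
  exact (Unitization.inr_injective h3).symm

theorem Induces.unique [DirectSum.Decomposition 𝒜] (h𝒜 : 𝒜 0 = ⊥) {n : ℕ} [NeZero n]
    {P : (Fin n → SubstLoop 𝒜) → SubstLoop 𝒜} {p p' : MultilinearMap K (fun _ : Fin n => S) S}
    (h : Induces 𝒜 P p) (h' : Induces 𝒜 P p') : p = p' := by
  classical
  ext v
  have hv : v = fun t => ∑ k ∈ (DirectSum.decompose 𝒜 (v t)).support,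
      (DirectSum.decompose 𝒜 (v t) k : S) := funext fun t =>
    (DirectSum.sum_support_decompose 𝒜 (v t)).symm
  rw [hv, MultilinearMap.map_sum_finset, MultilinearMap.map_sum_finset]
  refine sum_congr rfl fun i _ => ?_
  by_cases hi : ∀ t, 1 ≤ i t
  · exact h.eq_of_mem h' hi fun t => DirectSum.decompose 𝒜 (v t) (i t)
  · push Not at hi
    obtain ⟨t, ht⟩ := hi
    -- `Induces` says nothing in degree 0, where the component vanishes by hypothesis.
    have h0 : (DirectSum.decompose 𝒜 (v t) (i t) : S) = 0 := by
      have h1 := (DirectSum.decompose 𝒜 (v t) (i t)).2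
      have h2 : ∀ k, k = 0 → ∀ s ∈ 𝒜 k, s = 0 := by
        rintro _ rfl s hs
        rwa [h𝒜, Submodule.mem_bot] at hs
      exact h2 _ (Nat.lt_one_iff.mp ht) _ h1
    rw [p.map_coord_zero t h0, p'.map_coord_zero t h0]

/-! ### The commutator -/

variable (𝒜) [DirectSum.Decomposition 𝒜]

/-- The commutator of the product `starMul`. -/
noncomputable def starCommutator : MultilinearMap K (fun _ : Fin 2 => S) S :=
  multilinearOfLinearAt (fun v => starMul 𝒜 (v 0) (v 1) - starMul 𝒜 (v 1) (v 0)) fun t => by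
    have h : ∀ s s' : Fin 2, s ≠ s' → LinearAt K t fun v : Fin 2 → S =>
        starMul 𝒜 (v s) (v s') := by
      intro s s' hs
      by_cases ht : t = s
      · subst ht
        exact (LinearAt.apply_self t).bilin_left _ (ConstantAt.apply_of_ne hs.symm)
      · have ht' : t = s' := by omega
        subst ht'
        exact LinearAt.bilin_right _ (ConstantAt.apply_of_ne hs) (LinearAt.apply_self t)
    exact (h 0 1 (by decide)).sub (h 1 0 (by decide))

theorem starCommutator_apply (v : Fin 2 → S) :
    starCommutator 𝒜 v = starMul 𝒜 (v 0) (v 1) - starMul 𝒜 (v 1) (v 0) := rfl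

theorem induces_starCommutator :
    Induces 𝒜 (fun a => loopComm (a 0) (a 1)) (starCommutator 𝒜) := by
  refine induces_of_coeff fun i hi x a ha hx => ?_
  rw [Fin.sum_univ_two, toUnipotent_comm]
  refine ⟨UnipotentSeries.eqUpTo_comm (ha 0) (ha 1), ?_⟩
  rw [UnipotentSeries.coeff_comm (Nat.one_le_iff_ne_zero.mp (hi 0))
    (Nat.one_le_iff_ne_zero.mp (hi 1)) (ha 0) (ha 1), hx, hx, starCommutator_apply,
    starMul_eq_nsmul 𝒜 (x 0).2, starMul_eq_nsmul 𝒜 (x 1).2, Unitization.inr_sub,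
    Unitization.inr_smul, Unitization.inr_smul, Unitization.inr_mul, Unitization.inr_mul,
    ← nsmul_eq_mul, ← nsmul_eq_mul, mul_smul_comm, mul_smul_comm]

/-! ### The operations of the deviations -/

/-- Half the Shestakov–Umirbaev bracket of the product `starMul`. -/
noncomputable def halfBracket (K : Type*) {S : Type*} [Field K] [NonUnitalRing S] [Module K S]
    [IsScalarTower K S S] [SMulCommClass K S S] (𝒜 : ℕ → Submodule K S)
    [DirectSum.Decomposition 𝒜] (n : ℕ) : MultilinearMap K (fun _ : Fin (n + 3) => S) S :=
  multilinearOfLinearAt (fun v => (2⁻¹ : K) •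
    (suP (starMul 𝒜) (((List.finRange (n + 1)).map (Fin.castAdd 2)).map v)
        [v ⟨n + 1, by omega⟩] (v ⟨n + 2, by omega⟩) -
      suP (starMul 𝒜) (((List.finRange (n + 1)).map (Fin.castAdd 2)).map v)
        [v ⟨n + 2, by omega⟩] (v ⟨n + 1, by omega⟩))) fun t => by
    have hnd : ((List.finRange (n + 1)).map (Fin.castAdd 2)).Nodup :=
      (List.nodup_finRange _).map (Fin.castAdd_injective _ _)
    have hmem : ∀ t : Fin (n + 3), t ∈ (List.finRange (n + 1)).map (Fin.castAdd 2) ↔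
        (t : ℕ) < n + 1 := by
      intro t
      simp only [List.mem_map, List.mem_finRange, true_and]
      exact ⟨fun ⟨s, hs⟩ => hs ▸ s.2, fun h => ⟨⟨t, h⟩, rfl⟩⟩
    have h1 : t ∈ (List.finRange (n + 1)).map (Fin.castAdd 2) ∨ t = ⟨n + 1, by omega⟩ ∨
        t = ⟨n + 2, by omega⟩ := by
      rw [hmem, Fin.ext_iff, Fin.ext_iff]
      dsimp only
      omega
    have h2 : t ∈ (List.finRange (n + 1)).map (Fin.castAdd 2) ∨ t = ⟨n + 2, by omega⟩ ∨
        t = ⟨n + 1, by omega⟩ := h1.imp_right Or.symm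
    refine LinearAt.smul _ (LinearAt.sub ?_ ?_)
    · exact linearAt_suP _ (by simp [Fin.ext_iff]) _ _ rfl hnd (by rw [hmem]; simp)
        (by rw [hmem]; simp) h1
    · exact linearAt_suP _ (by simp [Fin.ext_iff]) _ _ rfl hnd (by rw [hmem]; simp)
        (by rw [hmem]; simp) h2

/-- Twice the coefficient function h of the loop operation and the alternating sum for `suP` solve
the same convolution equation, so they agree. Invertibility of 2 is used here. -/
theorem induces_halfBracket [CharZero K] (n : ℕ) : Induces 𝒜 (loopP n) (halfBracket K 𝒜 n) := by
  refine induces_of_coeff fun i hi x a ha hx => ?_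
  rw [loopP, toUnipotent_deviation]
  refine ⟨MarkedRing.eqUpTo_deviation _ hi ha, ?_⟩
  rw [MarkedRing.coeff_deviation _ hi ha]
  simp only [hx]
  obtain ⟨h, h1, h2⟩ := MarkedRing.exists_entry_loopP_eq n hi
    fun t => (((x t : 𝒜 (i t)) : S) : Unitization K S)
  refine h2.trans ?_
  have h3 := eq_of_sum_powerset_mul_eq (blockCoeff_empty (fun t => i (Fin.castAdd 2 t))
    fun t => (((x (Fin.castAdd 2 t) : 𝒜 _) : S) : Unitization K S))
    (φ := fun T => 2 • h T) (ψ := alternatingSum _ _) fun T => (h1 T).trans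
      (sum_blockCoeff_mul_alternatingSum _ _ T).symm
  have h4 := congrFun h3 univ
  have h5 : ∀ b c : S, ((suP (starMul 𝒜) (((List.finRange (n + 1)).map (Fin.castAdd 2)).map
      fun t => (x t : S)) [b] c : S) : Unitization K S) = 2 • h univ * ((b * c : S) : Unitization K S) := by
    intro b c
    rw [h4, List.map_map]
    exact inr_suP_starMul 𝒜 (fun t => (x (Fin.castAdd 2 t)).2) b c
  change _ = (((2⁻¹ : K) • (_ - _) : S) : Unitization K S)
  rw [Unitization.inr_smul, Unitization.inr_sub, h5, h5, Unitization.inr_mul, Unitization.inr_mul,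
    ← mul_sub, smul_mul_assoc, ← Nat.cast_smul_eq_nsmul K, smul_smul]
  norm_num

/-- `halfBracket` is antisymmetric in its last two arguments, so the difference in the Sabinin
bracket doubles it. -/
theorem sabininBracket_halfBracket [CharZero K] (n : ℕ) (x : Fin (n + 1) → S) (y z : S) :
    sabininBracket (halfBracket K 𝒜 n) x y z = suBracket (starMul 𝒜) (List.ofFn x) y z := by
  have h : ∀ b c : S, halfBracket K 𝒜 n
      (Fin.snoc (n := n + 2) (Fin.snoc (n := n + 1) x b : Fin (n + 2) → S) c) =
      (2⁻¹ : K) • (suP (starMul 𝒜) (List.ofFn x) [b] c - suP (starMul 𝒜) (List.ofFn x) [c] b) := by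
    intro b c
    set v : Fin (n + 3) → S :=
      Fin.snoc (n := n + 2) (Fin.snoc (n := n + 1) x b : Fin (n + 2) → S) c with hv
    have hb : v ⟨n + 1, by omega⟩ = b := by
      rw [show (⟨n + 1, by omega⟩ : Fin (n + 3)) = Fin.castSucc (Fin.last (n + 1)) from rfl, hv,
        Fin.snoc_castSucc, Fin.snoc_last]
    have hc : v ⟨n + 2, by omega⟩ = c := Fin.snoc_last (α := fun _ => S) _ _
    have hx : ((List.finRange (n + 1)).map (Fin.castAdd 2)).map v = List.ofFn x := by
      rw [List.map_map, List.ofFn_eq_map]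
      refine List.map_congr_left fun t _ => ?_
      rw [Function.comp_apply, show Fin.castAdd 2 t = Fin.castSucc (Fin.castSucc t) from rfl, hv,
        Fin.snoc_castSucc, Fin.snoc_castSucc]
    change (2⁻¹ : K) • ((_ : S) - (_ : S)) = _
    rw [hb, hc, hx]
  have h2 : ∀ b c : S, (2⁻¹ : K) • (b - c) - (2⁻¹ : K) • (c - b) = b - c := by
    intro b c
    rw [← smul_sub, ← neg_sub b c, sub_neg_eq_add, ← two_smul K, smul_smul,
      inv_mul_cancel₀ two_ne_zero, one_smul]
  rw [sabininBracket, h, h, suBracket, h2]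

theorem suBracket_starMul_eq_explicitBracket {m : ℕ} {i : Fin m → ℕ} {x : Fin m → S}
    (hx : ∀ t, x t ∈ 𝒜 (i t)) (y z : S) :
    suBracket (starMul 𝒜) (List.ofFn x) y z = explicitBracket i x y z := by
  refine Unitization.inr_injective (R := K) ?_
  rw [suBracket, List.ofFn_eq_map, Unitization.inr_sub, inr_suP_starMul 𝒜 hx,
    inr_suP_starMul 𝒜 hx, inr_explicitBracket, Unitization.inr_sub, mul_sub]

end SubstLoop

/-! ### The theorem -/

theorem mainTheorem1 {K S : Type*} [Field K] [CharZero K] [NonUnitalRing S] [Module K S]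
    [IsScalarTower K S S] [SMulCommClass K S S] (𝒜 : ℕ → Submodule K S)
    [DirectSum.Decomposition 𝒜] [SetLike.GradedMul 𝒜] (h𝒜 : 𝒜 0 = ⊥) :
    -- the substitution product is a loop, and its natural filtration is an N-sequence
    IsLoop (SubstLoop 𝒜) ∧
    IsNSequence (SubstLoop.filtration 𝒜) ∧
    -- `x ↦ (1 + x) J_{i+1}` identifies the groups `S_i` and `J_i / J_{i+1}`
    (∀ i, 1 ≤ i →
      Set.BijOn (SubstLoop.ident 𝒜 i) Set.univ (loopGr (SubstLoop.filtration 𝒜) i) ∧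
      ∀ x y : 𝒜 i, ∀ a ∈ SubstLoop.ident 𝒜 i x, ∀ b ∈ SubstLoop.ident 𝒜 i y,
        a * b ∈ SubstLoop.ident 𝒜 i (x + y)) ∧
    -- the commutator induces `y * z - z * y`
    (∃! q : MultilinearMap K (fun _ : Fin 2 => S) S,
      SubstLoop.Induces 𝒜 (fun a => loopComm (a 0) (a 1)) q) ∧
    (∀ q : MultilinearMap K (fun _ : Fin 2 => S) S,
      SubstLoop.Induces 𝒜 (fun a => loopComm (a 0) (a 1)) q →
      ∀ y z : S, q ![y, z] = starMul 𝒜 y z - starMul 𝒜 z y) ∧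
    -- the brackets of the deviations are the Shestakov–Umirbaev brackets of `*`,
    -- and are given by the explicit formula
    (∀ n : ℕ,
      (∃! p : MultilinearMap K (fun _ : Fin (n + 3) => S) S,
        SubstLoop.Induces 𝒜 (loopP n) p) ∧
      ∀ p : MultilinearMap K (fun _ : Fin (n + 3) => S) S, SubstLoop.Induces 𝒜 (loopP n) p →
        ∀ (x : Fin (n + 1) → S) (y z : S),
          sabininBracket p x y z = suBracket (starMul 𝒜) (List.ofFn x) y z ∧
          ∀ i : Fin (n + 1) → ℕ, (∀ t, x t ∈ 𝒜 (i t)) →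
            sabininBracket p x y z = explicitBracket i x y z) := by
  refine ⟨SubstLoop.isLoop, SubstLoop.isNSequence_filtration, fun i hi => ?_,
    ⟨_, SubstLoop.induces_starCommutator 𝒜, fun q hq =>
      hq.unique h𝒜 (SubstLoop.induces_starCommutator 𝒜)⟩, fun q hq y z => ?_, fun n => ?_⟩
  · have hi0 := Nat.one_le_iff_ne_zero.mp hi
    exact ⟨SubstLoop.bijOn_ident hi0, fun x y a ha b hb => SubstLoop.mul_mem_ident hi0 x y ha hb⟩
  · rw [hq.unique h𝒜 (SubstLoop.induces_starCommutator 𝒜)]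
    rfl
  · refine ⟨⟨_, SubstLoop.induces_halfBracket 𝒜 n, fun p hp =>
      hp.unique h𝒜 (SubstLoop.induces_halfBracket 𝒜 n)⟩, fun p hp x y z => ?_⟩
    rw [hp.unique h𝒜 (SubstLoop.induces_halfBracket 𝒜 n), SubstLoop.sabininBracket_halfBracket]
    exact ⟨rfl, fun i hx => SubstLoop.suBracket_starMul_eq_explicitBracket 𝒜 hx y z⟩
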